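/- **Notation.** Let $d\ge 0$. Points of $\mathbb R\times\mathbb R^d$ are $x=(x_0,x')$; multi-indices are $n\in\mathbb N\times\mathbb N^d$, with $|n|=2n_0+n_1+\dots+n_d$, $n!=\prod n_i!$, $x^n=\prod x_i^{n_i}$, and unit vectors $e_0,\dots,e_d$. Put $d(x,y)=\sqrt{|x_0-y_0|}+|x'-y'|$. Let $p_t$ be the kernel of $e^{t(\partial_{x_0}^2-\Delta_{x'}^2)}$, and $$K=\int_0^1K_r\,dr-(e-1)K_1,\qquad K_r=-(\partial_{x_0}+\Delta_{x'}-1)\,e^{r(\partial_{x_0}^2-(\Delta_{x'}-1)^2)}.$$ **Regularity structure.** $T^+=\bigoplus_{\alpha\ge0}T^+_\alpha$ is a commutative connected graded real bialgebra ($T_0^+=\langle 1\rangle$) with coproduct $\Delta^+$. $T=\bigoplus_\beta T_\beta$ has a homogeneous basis $\mathcal B$ (homogeneity $|\tau|$) with finitely many elements of homogeneity $\le c$ for each $c$, and is a right $T^+$-comodule by $\Delta:T\to T\otimes T^+$ with $\Delta T_\beta\subset\bigoplus_{\alpha\ge 0}T_{\beta-\alpha}\otimes T^+_\alpha$. Write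 $\Delta\tau=\sum_{\sigma\in\mathcal B}\sigma\otimes(\tau/\sigma)$ for $\tau\in\mathcal B$. **Assumption (A).** $\mathcal B$ contains distinct elements $X^n$ with $|X^n|=|n|$, and $X^0=\mathbf 1$ is its only element of homogeneity $0$; $T^+$ contains elements $X_+^{e_i}$ of homogeneity $|e_i|$. With $X_+^n=\prod_i(X_+^{e_i})^{n_i}$, $$\Delta^+X_+^{e_i}=X_+^{e_i}\otimes1+1\otimes X_+^{e_i},\qquad \Delta X^n=\sum_{k\le n}\tbinom nk X^k\otimes X_+^{n-k}.$$ There are linear maps $\tau\mapsto X^n\star\tau$ on $T$, mapping each $T_\beta$ to $T_{\beta+|n|}$, with $\mathbf 1\star\tau=\tau$, $X^k\star X^\ell=X^{k+\ell}$ and $\Delta(X^n\star\tau)=(\Delta X^n)(\Delta\tau)$. **Assumption (B).** There are linear maps $\mathcal I_n^+:T\to T^+$ (all $n$), with $\mathcal I_n^+\tau=0$ for $\tau\in\mathcal B$ with $|\tau|+2-|n|\le0$, and $\mathcal I_n:T\to T$ ($n\in\{0,e_1,\dots,e_d\}$); both change the homogeneity of every $\tau\in\mathcal B$ to $|\tau|+2-|n|$.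 The algebra $T^+$ is freely generated, as a commutative algebra, by the $X_+^{e_i}$ and the $\mathcal I^+_n\tau$ ($\tau\in\mathcal B$, $|\tau|+2-|n|>0$). For $\tau\in\mathcal B$, $$\Delta^+\mathcal I_n^+\tau=(\mathcal I_n^+\otimes\mathrm{Id})\Delta\tau+\sum_{|\ell|<|\tau|+2-|n|}\tfrac{X_+^\ell}{\ell!}\otimes\mathcal I^+_{n+\ell}\tau,\qquad \Delta\,\mathcal I_n\tau=(\mathcal I_n\otimes\mathrm{Id})\Delta\tau+\sum_{|\ell|<|\tau|+2-|n|}\tfrac{X^\ell}{\ell!}\otimes\mathcal I^+_{n+\ell}\tau .$$ For $\tau,\sigma\in\mathcal B$, $\tau/\sigma$ lies in the algebra generated by the $X_+^{e_i}$ and the $\mathcal I_n^+\eta$ with $\eta\in\mathcal B$, $|\eta|<|\tau|$. Finally $|\tau|>-2$ for all $\tau\in\mathcal B$. **Models.** Consider pairs of a linear map $\Pi:T\to\mathcal S'(\mathbb R\times\mathbb R^d)$ and a family $(g_x)_{x\in\mathbb R\times\mathbb R^d}$ of characters of $T^+$. With $g*h=(g\otimes h)\Delta^+$ put $g_{yx}=g_y*g_x^{-1}$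 and $\Pi_x=(\Pi\otimes g_x^{-1})\Delta$. The pair is a *model* if $$\sup_{x,y}\frac{|g_{yx}(\mu)|}{d(y,x)^{\alpha}}<\infty\ \ (\alpha\ge 0,\ \mu\in T^+_\alpha),\qquad \sup_{x,\;0<t\le1}t^{-|\sigma|/4}\,|\langle\Pi_x\sigma,p_t(x,\cdot)\rangle|<\infty\ \ (\sigma\in\mathcal B),$$ the first bound being read as $|g_{yx}(\mu)|\le C\,d(y,x)^\alpha$. It is a *local model* if, for every compact set $Q$, these bounds hold with $x,y$ restricted to $Q$. It is *canonical on polynomials* if $\Pi X^n=x^n$ and $g_x(X_+^{e_i})=x_i$. It is *$K$-admissible* if $\Pi(\mathcal I_0\tau)=K(\Pi\tau)$ and $\Pi(X^n\star\tau)=x^n\,\Pi\tau$ for all $\tau\in\mathcal B$ and all $n$. **Theorem.** Under assumptions (A) and (B), let $[\tau]$, $\tau\in\mathcal B$ with $|\tau|<0$, be smooth real functions on $\mathbb R\times\mathbb R^d$ all of whose derivatives have at most polynomial growth. Extend $[\cdot]$ linearly to the span of these $\tau$, and suppose that $[X^n\star\tau]=x^n[\tau]$ whenever $\tau\in\mathcal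 B$ and $|\tau|+|n|<0$. 1. There is a unique $K$-admissible local model $(\Pi,g)$, canonical on polynomials, such that $\Pi\tau=[\tau]$ for all $\tau\in\mathcal B$ with $|\tau|<0$. 2. For $x\in\mathbb R\times\mathbb R^d$ let $c_x$ be the character of $T^+$ with $c_x(X_+^{e_i})=-x_i$ and $c_x(\mathcal I_n^+\tau)=0$. Suppose moreover that, for each $\tau\in\mathcal B$ with $|\tau|<0$, every derivative at the point $x$ of the function $[(\mathrm{Id}\otimes c_x)\Delta\tau]$ is bounded uniformly in $x$. (If no $X_+^{e_i}$ occurs in $\Delta\tau$ this says that $[\tau]$ has bounded derivatives of all orders.) Then there is a unique $K$-admissible model $(\Pi,g)$, canonical on polynomials, such that $\Pi\tau=[\tau]$ for all $\tau\in\mathcal B$ with $|\tau|<0$. -/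

import Mathlib

open SchwartzMap MeasureTheory
open scoped ContDiff FourierTransform

noncomputable section

/-- The space `ℝ × ℝᵈ`; the coordinate `0` is time. -/
abbrev Space (d : ℕ) : Type := EuclideanSpace ℝ (Fin (d + 1))

/-- Multi-indices `n ∈ ℕ × ℕᵈ`. -/
abbrev MIdx (d : ℕ) : Type := Fin (d + 1) → ℕ

/-- The scaled degree `|n| = 2 n₀ + n₁ + ⋯ + n_d`. -/
def sdeg {d : ℕ} (n : MIdx d) : ℕ := 2 * n 0 + ∑ i : Fin d, n i.succ

/-- `|x'|²`, for the space component `x'` of `x`. -/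
def spaceNormSq {d : ℕ} (x : Space d) : ℝ := ∑ i : Fin d, x i.succ ^ 2

/-- The parabolic distance `√|x₀ - y₀| + |x' - y'|`. -/
def pdist {d : ℕ} (x y : Space d) : ℝ :=
  Real.sqrt |x 0 - y 0| + Real.sqrt (spaceNormSq (x - y))

/-- The monomial `xⁿ`. -/
def monomialFun {d : ℕ} (n : MIdx d) (x : Space d) : ℝ := ∏ i, x i ^ n i

lemma coord_temperate {d : ℕ} (i : Fin (d + 1)) :
    Function.HasTemperateGrowth (fun x : Space d => x i) :=
  (EuclideanSpace.proj (𝕜 := ℝ) i : Space d →L[ℝ] ℝ).hasTemperateGrowth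

lemma prod_temperate {d : ℕ} {ι : Type*} (s : Finset ι) (f : ι → Space d → ℝ)
    (h : ∀ i, (f i).HasTemperateGrowth) :
    Function.HasTemperateGrowth (fun x : Space d => ∏ i ∈ s, f i x) := by
  classical
  induction s using Finset.induction_on with
  | empty => simp
  | insert a s ha ih =>
    simp only [Finset.prod_insert ha]
    exact (h a).mul ih

lemma monomialFun_temperate {d : ℕ} (n : MIdx d) :
    (monomialFun n : Space d → ℝ).HasTemperateGrowth :=
  prod_temperate _ _ fun i => (coord_temperate i).pow (n i)

lemma spaceNormSq_temperate {d : ℕ} :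
    (spaceNormSq : Space d → ℝ).HasTemperateGrowth := by
  unfold spaceNormSq
  exact Function.HasTemperateGrowth.sum fun i _ => (coord_temperate i.succ).pow 2

lemma norm_sq_eq {d : ℕ} (x : Space d) : ‖x‖ ^ 2 = x 0 ^ 2 + spaceNormSq x := by
  rw [EuclideanSpace.norm_sq_eq, Fin.sum_univ_succ]
  simp [spaceNormSq]

lemma exp_neg_iteratedFDeriv_bound {d : ℕ} {q : Space d → ℝ} (hq : q.HasTemperateGrowth)
    (n : ℕ) : ∃ (k : ℕ) (C : ℝ), 0 ≤ C ∧ ∀ x,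
      ‖iteratedFDeriv ℝ n (fun x => Real.exp (-q x)) x‖ ≤
        C * (1 + ‖x‖) ^ k * Real.exp (-q x) := by
  obtain ⟨k, C, hC, h⟩ := hq.neg.norm_iteratedFDeriv_le_uniform n
  refine ⟨k * n, n.factorial * (1 + C) ^ n, by positivity, fun x => ?_⟩
  have h1 : ∀ i, i ≤ n → ‖iteratedFDeriv ℝ i Real.exp ((-q) x)‖ ≤ Real.exp (-q x) := by
    intro i _
    rw [norm_iteratedFDeriv_eq_norm_iteratedDeriv, iteratedDeriv_eq_iterate, Real.iter_deriv_exp]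
    simp
  have h2 : ∀ i, 1 ≤ i → i ≤ n →
      ‖iteratedFDeriv ℝ i (-q) x‖ ≤ ((1 + C) * (1 + ‖x‖) ^ k) ^ i := by
    intro i hi hi'
    have hone : 1 ≤ (1 + C) * (1 + ‖x‖) ^ k :=
      one_le_mul_of_one_le_of_one_le (by linarith) (one_le_pow₀ (by linarith [norm_nonneg x]))
    calc _ ≤ C * (1 + ‖x‖) ^ k := h i hi' x
      _ ≤ (1 + C) * (1 + ‖x‖) ^ k := by gcongr; linarith
      _ ≤ _ := le_self_pow₀ hone (by omega)
  have := norm_iteratedFDeriv_comp_le (g := Real.exp) (f := -q) (N := ∞) Real.contDiff_exp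
    hq.neg.1 (mod_cast le_top) x h1 h2
  calc _ ≤ _ := this
    _ = _ := by rw [mul_pow, ← pow_mul]; ring

/-- `(2πξ₀)² + (4π²|ξ'|² + m)²`. -/
def ellSymbol {d : ℕ} (m : ℝ) (ξ : Space d) : ℝ :=
  (2 * Real.pi * ξ 0) ^ 2 + (4 * Real.pi ^ 2 * spaceNormSq ξ + m) ^ 2

lemma ellSymbol_temperate {d : ℕ} (m : ℝ) :
    (ellSymbol m : Space d → ℝ).HasTemperateGrowth := by
  have h1 : Function.HasTemperateGrowth (fun ξ : Space d => (2 * Real.pi) * ξ 0) :=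
    (Function.HasTemperateGrowth.const _).mul (coord_temperate 0)
  have h2 : Function.HasTemperateGrowth
      (fun ξ : Space d => 4 * Real.pi ^ 2 * spaceNormSq ξ + m) :=
    ((Function.HasTemperateGrowth.const _).mul spaceNormSq_temperate).add
      (Function.HasTemperateGrowth.const _)
  exact (h1.pow 2).add (h2.pow 2)

lemma exp_ellSymbol_temperate {d : ℕ} (m : ℝ) {t : ℝ} (ht : 0 ≤ t) :
    Function.HasTemperateGrowth (fun ξ : Space d => Real.exp (-(t * ellSymbol m ξ))) := by
  have hq : Function.HasTemperateGrowth (fun ξ : Space d => t * ellSymbol m ξ) :=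
    (Function.HasTemperateGrowth.const t).mul (ellSymbol_temperate m)
  refine ⟨Real.contDiff_exp.comp hq.1.neg, fun n => ?_⟩
  obtain ⟨k, C, hC, h⟩ := exp_neg_iteratedFDeriv_bound hq n
  refine ⟨k, C, fun x => (h x).trans ?_⟩
  have h0 : 0 ≤ t * ellSymbol m x := by unfold ellSymbol; positivity
  have : Real.exp (-(t * ellSymbol m x)) ≤ 1 := Real.exp_le_one_iff.2 (by linarith)
  calc _ ≤ C * (1 + ‖x‖) ^ k * 1 := by gcongr
    _ = _ := mul_one _

lemma norm_sq_le_ellSymbol {d : ℕ} (x : Space d) : ‖x‖ ^ 2 - 1 ≤ ellSymbol 0 x := by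
  rw [norm_sq_eq]
  have hs : 0 ≤ spaceNormSq x := Finset.sum_nonneg fun i _ => sq_nonneg _
  have hp : 1 ≤ Real.pi := by linarith [Real.pi_gt_three]
  have h1 : x 0 ^ 2 ≤ (2 * Real.pi * x 0) ^ 2 := by
    rw [mul_pow]
    exact le_mul_of_one_le_left (sq_nonneg _) (by nlinarith)
  have h2 : spaceNormSq x ≤ 4 * Real.pi ^ 2 * spaceNormSq x :=
    le_mul_of_one_le_left hs (by nlinarith)
  unfold ellSymbol
  nlinarith [sq_nonneg (4 * Real.pi ^ 2 * spaceNormSq x - 1)]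

/-- The Fourier symbol of `exp (t G)`, with `G = ∂₀² - Δ'²` and `Δ'` the Laplacian in space;
`e^{2πi⟨x, ξ⟩}` is an eigenfunction of `-G` with eigenvalue `ellSymbol 0 ξ`. -/
def heatSymbol (d : ℕ) (t : ℝ) (ht : 0 < t) : 𝓢(Space d, ℝ) where
  toFun ξ := Real.exp (-(t * ellSymbol 0 ξ))
  smooth' := (exp_ellSymbol_temperate 0 ht.le).1
  decay' := by
    intro k n
    have hq : Function.HasTemperateGrowth (fun ξ : Space d => t * ellSymbol 0 ξ) :=
      (Function.HasTemperateGrowth.const t).mul (ellSymbol_temperate 0)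
    obtain ⟨l, C, hC, h⟩ := exp_neg_iteratedFDeriv_bound hq n
    refine ⟨C * (2 ^ (k + l) * (Real.exp (2 * t) * ((k + l).factorial / t ^ (k + l)))),
      fun x => ?_⟩
    have hx : 0 ≤ ‖x‖ := norm_nonneg x
    set s : ℝ := 1 + ‖x‖ ^ 2 with hs
    have hs0 : 0 < s := by positivity
    have e1 : ‖x‖ ^ k * (1 + ‖x‖) ^ l ≤ 2 ^ (k + l) * s ^ (k + l) := by
      calc _ ≤ (1 + ‖x‖) ^ k * (1 + ‖x‖) ^ l := by gcongr; linarith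
        _ = (1 + ‖x‖) ^ (k + l) := (pow_add _ _ _).symm
        _ ≤ (2 * s) ^ (k + l) := by gcongr; nlinarith [sq_nonneg (‖x‖ - 1)]
        _ = _ := mul_pow _ _ _
    have e2 : Real.exp (-(t * ellSymbol 0 x)) ≤ Real.exp (2 * t) * Real.exp (-(t * s)) := by
      rw [← Real.exp_add]
      apply Real.exp_le_exp.2
      nlinarith [norm_sq_le_ellSymbol x]
    have e3 : s ^ (k + l) * Real.exp (-(t * s)) ≤ (k + l).factorial / t ^ (k + l) := by
      have := Real.pow_div_factorial_le_exp (t * s) (by positivity) (k + l)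
      rw [Real.exp_neg, ← div_eq_mul_inv, div_le_div_iff₀ (Real.exp_pos _) (by positivity)]
      rw [div_le_iff₀ (by positivity), mul_pow] at this
      linarith
    calc _ ≤ ‖x‖ ^ k * (C * (1 + ‖x‖) ^ l * Real.exp (-(t * ellSymbol 0 x))) := by
            gcongr; exact h x
      _ = C * ((‖x‖ ^ k * (1 + ‖x‖) ^ l) * Real.exp (-(t * ellSymbol 0 x))) := by ring
      _ ≤ C * ((2 ^ (k + l) * s ^ (k + l)) * (Real.exp (2 * t) * Real.exp (-(t * s)))) := by
            gcongr
      _ = C * (2 ^ (k + l) * (Real.exp (2 * t) * (s ^ (k + l) * Real.exp (-(t * s))))) := by ring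
      _ ≤ _ := by gcongr

/-- A real Schwartz function as a complex one. -/
abbrev realToComplex (d : ℕ) : 𝓢(Space d, ℝ) → 𝓢(Space d, ℂ) :=
  fun φ => φ.postcompCLM Complex.ofRealCLM

/-- The real part of a Schwartz function. -/
abbrev complexToReal (d : ℕ) : 𝓢(Space d, ℂ) → 𝓢(Space d, ℝ) :=
  fun φ => φ.postcompCLM Complex.reCLM

/-- The function `p_t(x, ·)`, where `p_t` is the kernel of `exp (t G)`, `G = ∂₀² - Δ'²`. -/
def heatKernel {d : ℕ} (t : ℝ) (ht : 0 < t) (x : Space d) : 𝓢(Space d, ℝ) :=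
  SchwartzMap.compSubConstCLM ℝ x
    (complexToReal d (𝓕⁻ (realToComplex d (heatSymbol d t ht))))

/-- The Fourier symbol of the transpose `(∂₀ - Δ' + 1) e^{r(∂₀² - (Δ' - 1)²)}` of
`K_r = -(∂₀ + Δ' - 1) e^{r(∂₀² - (Δ' - 1)²)}`. -/
def kernelSymbol {d : ℕ} (r : ℝ) (ξ : Space d) : ℂ :=
  ((4 * Real.pi ^ 2 * spaceNormSq ξ + 1 : ℝ) + (2 * Real.pi * ξ 0 : ℝ) * Complex.I) *
    (Real.exp (-(r * ellSymbol 1 ξ)) : ℝ)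

lemma kernelSymbol_temperate {d : ℕ} {r : ℝ} (hr : 0 ≤ r) :
    (kernelSymbol r : Space d → ℂ).HasTemperateGrowth := by
  have hc {f : Space d → ℝ} (hf : f.HasTemperateGrowth) :
      Function.HasTemperateGrowth (fun ξ => (f ξ : ℂ)) :=
    Complex.ofRealCLM.hasTemperateGrowth.comp hf
  have h1 : Function.HasTemperateGrowth (fun ξ : Space d => (2 * Real.pi) * ξ 0) :=
    (Function.HasTemperateGrowth.const _).mul (coord_temperate 0)
  have h2 : Function.HasTemperateGrowth
      (fun ξ : Space d => 4 * Real.pi ^ 2 * spaceNormSq ξ + 1) :=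
    ((Function.HasTemperateGrowth.const _).mul spaceNormSq_temperate).add
      (Function.HasTemperateGrowth.const _)
  exact ((hc h2).add ((hc h1).mul (Function.HasTemperateGrowth.const _))).mul
    (hc (exp_ellSymbol_temperate 1 hr))

/-- The transpose of `K_r`, on Schwartz functions. -/
def KrAdj {d : ℕ} (r : ℝ) (φ : 𝓢(Space d, ℝ)) : 𝓢(Space d, ℝ) :=
  complexToReal d (SchwartzMap.fourierMultiplierCLM ℂ (kernelSymbol r) (realToComplex d φ))

/-- Real tempered distributions. -/
abbrev TDist (d : ℕ) : Type := 𝓢(Space d, ℝ) →L[ℝ] ℝ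

/-- The value `⟨K Λ, φ⟩` of the distribution `K Λ`, where `K = ∫₀¹ K_r dr - (e - 1) K_1`. -/
def Kapply {d : ℕ} (Λ : TDist d) (φ : 𝓢(Space d, ℝ)) : ℝ :=
  (∫ r in (0 : ℝ)..1, Λ (KrAdj r φ)) - (Real.exp 1 - 1) * Λ (KrAdj 1 φ)


/-! ## Concrete regularity structures -/

open scoped TensorProduct

/-- `f ⊗ h` followed by the multiplication of vectors by scalars. -/
def pairRight {V W U : Type*} [AddCommGroup V] [Module ℝ V] [AddCommGroup W] [Module ℝ W]
    [AddCommGroup U] [Module ℝ U] (f : V →ₗ[ℝ] U) (h : W →ₗ[ℝ] ℝ) : V ⊗[ℝ] W →ₗ[ℝ] U :=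
  (TensorProduct.rid ℝ U).toLinearMap ∘ₗ TensorProduct.map f h

/-- The subspace `V₁ ⊗ W₁` of `V ⊗ W`. -/
def tensorSub {V W : Type*} [AddCommGroup V] [Module ℝ V] [AddCommGroup W] [Module ℝ W]
    (V₁ : Submodule ℝ V) (W₁ : Submodule ℝ W) : Submodule ℝ (V ⊗[ℝ] W) :=
  LinearMap.range (TensorProduct.map V₁.subtype W₁.subtype)

/-- A concrete regularity structure `((T⁺, Δ⁺), (T, Δ))`: `T⁺` is a connected graded bialgebra
(its coproduct `Δ⁺` is `Coalgebra.comul`), and `T`, with its homogeneous basis `B`, is a graded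
right comodule over `T⁺`. -/
structure RegStructure (B T Tp : Type*) [AddCommGroup T] [Module ℝ T] [CommRing Tp]
    [Bialgebra ℝ Tp] where
  /-- the homogeneous basis of `T` -/
  basis : Module.Basis B ℝ T
  /-- the homogeneity of a basis element -/
  deg : B → ℝ
  finite_deg_le : ∀ c : ℝ, {b | deg b ≤ c}.Finite
  /-- the homogeneous subspaces of `T⁺` -/
  gradeP : ℝ → Submodule ℝ Tp
  gradeP_internal : DirectSum.IsInternal gradeP
  gradeP_neg : ∀ α < 0, gradeP α = ⊥
  gradeP_zero : gradeP 0 = Submodule.span ℝ {1}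
  gradeP_mul : ∀ α β : ℝ, ∀ u ∈ gradeP α, ∀ v ∈ gradeP β, u * v ∈ gradeP (α + β)
  gradeP_comul : ∀ α : ℝ, ∀ u ∈ gradeP α,
    Coalgebra.comul (R := ℝ) u ∈ ⨆ β : ℝ, tensorSub (gradeP β) (gradeP (α - β))
  /-- the splitting map of `T` -/
  Δ : T →ₗ[ℝ] T ⊗[ℝ] Tp
  coassoc : (TensorProduct.assoc ℝ T Tp Tp).toLinearMap ∘ₗ Δ.rTensor Tp ∘ₗ Δ =
    (Coalgebra.comul (R := ℝ) (A := Tp)).lTensor T ∘ₗ Δ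
  counit : (TensorProduct.rid ℝ T).toLinearMap ∘ₗ
    (Coalgebra.counit (R := ℝ) (A := Tp)).lTensor T ∘ₗ Δ = LinearMap.id
  graded : ∀ b : B, Δ (basis b) ∈ ⨆ α : ℝ,
    tensorSub (Submodule.span ℝ (basis '' {b' | deg b' = deg b - α})) (gradeP α)

namespace RegStructure

variable {B T Tp : Type*} [AddCommGroup T] [Module ℝ T] [CommRing Tp] [Bialgebra ℝ Tp]

/-- The homogeneous subspace `T_β`. -/
def gradeT (S : RegStructure B T Tp) (β : ℝ) : Submodule ℝ T :=
  Submodule.span ℝ (S.basis '' {b | S.deg b = β})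

/-- The element `τ/σ` of `T⁺`, defined by `Δτ = ∑_σ σ ⊗ (τ/σ)`. -/
def quot (S : RegStructure B T Tp) (τ σ : B) : Tp :=
  TensorProduct.lid ℝ Tp ((S.basis.coord σ).rTensor Tp (S.Δ (S.basis τ)))

end RegStructure

/-! ## Multi-indices -/

/-- `n! = ∏ᵢ nᵢ!`. -/
def midxFactorial {d : ℕ} (n : MIdx d) : ℕ := ∏ i, (n i).factorial

/-- The multi-index binomial coefficient `∏ᵢ (nᵢ choose kᵢ)`. -/
def midxChoose {d : ℕ} (n k : MIdx d) : ℕ := ∏ i, (n i).choose (k i)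

/-- The finite set of the multi-indices `ℓ` with `|ℓ| < c`. -/
def lowDeg (d : ℕ) (c : ℝ) : Finset (MIdx d) :=
  (Fintype.piFinset fun _ => Finset.range ⌈c⌉₊).filter fun l => (sdeg l : ℝ) < c

lemma mem_lowDeg {d : ℕ} {c : ℝ} {l : MIdx d} : l ∈ lowDeg d c ↔ (sdeg l : ℝ) < c := by
  simp only [lowDeg, Finset.mem_filter, Fintype.mem_piFinset, Finset.mem_range,
    and_iff_right_iff_imp]
  intro h i
  have hi : l i ≤ sdeg l := by
    unfold sdeg
    refine Fin.cases ?_ (fun j => ?_) i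
    · omega
    · have := Finset.single_le_sum (f := fun j : Fin d => l j.succ) (fun _ _ => Nat.zero_le _)
        (Finset.mem_univ j)
      omega
  exact Nat.lt_ceil.2 (lt_of_le_of_lt (by exact_mod_cast hi) h)

/-! ## Structural assumptions -/

/-- `T` and `T⁺` contain the polynomials, and `T` carries a regular product with polynomials. -/
structure PolySector (d : ℕ) {B T Tp : Type*} [AddCommGroup T] [Module ℝ T] [CommRing Tp]
    [Bialgebra ℝ Tp] (S : RegStructure B T Tp) where
  /-- the basis elements `Xⁿ` -/
  X : MIdx d → B
  X_injective : Function.Injective X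
  deg_X : ∀ n, S.deg (X n) = sdeg n
  eq_X_zero : ∀ b, S.deg b = 0 → b = X 0
  /-- the elements `X₊^{eᵢ}` of `T⁺` -/
  Xp : Fin (d + 1) → Tp
  Xp_mem : ∀ i, Xp i ∈ S.gradeP (sdeg (Pi.single i 1 : MIdx d))
  comul_Xp : ∀ i, Coalgebra.comul (R := ℝ) (Xp i) = Xp i ⊗ₜ[ℝ] 1 + 1 ⊗ₜ[ℝ] Xp i
  Δ_X : ∀ n, S.Δ (S.basis (X n)) = ∑ k ∈ Finset.Iic n,
    (midxChoose n k : ℝ) • (S.basis (X k) ⊗ₜ[ℝ] ∏ i, Xp i ^ (n i - k i))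
  /-- the product `τ ↦ Xⁿ ⋆ τ` -/
  mulX : MIdx d → T →ₗ[ℝ] T
  mulX_mem : ∀ n b, mulX n (S.basis b) ∈ S.gradeT (S.deg b + sdeg n)
  mulX_zero : mulX 0 = LinearMap.id
  mulX_X : ∀ k l, mulX k (S.basis (X l)) = S.basis (X (k + l))
  Δ_mulX : ∀ n τ, S.Δ (mulX n τ) = ∑ k ∈ Finset.Iic n, (midxChoose n k : ℝ) •
    TensorProduct.map (mulX k) (LinearMap.mulLeft ℝ (∏ i, Xp i ^ (n i - k i))) (S.Δ τ)

/-- The element `X₊ⁿ` of `T⁺`. -/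
def PolySector.XpPow {d : ℕ} {B T Tp : Type*} [AddCommGroup T] [Module ℝ T] [CommRing Tp]
    [Bialgebra ℝ Tp] {S : RegStructure B T Tp} (P : PolySector d S) (n : MIdx d) : Tp :=
  ∏ i, P.Xp i ^ n i

/-- The indices of the generators of `T⁺`: `X₊^{eᵢ}`, and `I⁺ₙ τ` with `|τ| + 2 - |n| > 0`. -/
abbrev GenIdx (d : ℕ) {B T Tp : Type*} [AddCommGroup T] [Module ℝ T] [CommRing Tp]
    [Bialgebra ℝ Tp] (S : RegStructure B T Tp) : Type _ :=
  Fin (d + 1) ⊕ {p : B × MIdx d // (sdeg p.2 : ℝ) < S.deg p.1 + 2}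

/-- The generators of `T⁺`. -/
def genP {d : ℕ} {B T Tp : Type*} [AddCommGroup T] [Module ℝ T] [CommRing Tp]
    [Bialgebra ℝ Tp] {S : RegStructure B T Tp} (P : PolySector d S)
    (Ip : MIdx d → T →ₗ[ℝ] Tp) : GenIdx d S → Tp :=
  Sum.elim P.Xp fun p => Ip p.1.2 (S.basis p.1.1)

/-- The abstract integration operators `I⁺ₙ : T → T⁺` and `Iₙ : T → T`. The condition
`|n| ≤ 1` singles out `n = 0` and the spatial unit vectors `n = e₁, …, e_d`. -/
structure IntSector {d : ℕ} {B T Tp : Type*} [AddCommGroup T] [Module ℝ T] [CommRing Tp]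
    [Bialgebra ℝ Tp] (S : RegStructure B T Tp) (P : PolySector d S) where
  /-- the operators `I⁺ₙ` -/
  Ip : MIdx d → T →ₗ[ℝ] Tp
  Ip_eq_zero : ∀ n b, S.deg b + 2 ≤ sdeg n → Ip n (S.basis b) = 0
  Ip_mem : ∀ n b, Ip n (S.basis b) ∈ S.gradeP (S.deg b + 2 - sdeg n)
  free : Function.Bijective
    (MvPolynomial.aeval (genP P Ip) : MvPolynomial (GenIdx d S) ℝ →ₐ[ℝ] Tp)
  comul_Ip : ∀ n b, Coalgebra.comul (R := ℝ) (Ip n (S.basis b)) =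
    (Ip n).rTensor Tp (S.Δ (S.basis b)) +
      ∑ l ∈ lowDeg d (S.deg b + 2 - sdeg n),
        (midxFactorial l : ℝ)⁻¹ • (P.XpPow l ⊗ₜ[ℝ] Ip (n + l) (S.basis b))
  /-- the operators `Iₙ` -/
  I : {n : MIdx d // sdeg n ≤ 1} → T →ₗ[ℝ] T
  I_mem : ∀ n b, I n (S.basis b) ∈ S.gradeT (S.deg b + 2 - sdeg n.1)
  Δ_I : ∀ n b, S.Δ (I n (S.basis b)) =
    (I n).rTensor Tp (S.Δ (S.basis b)) +
      ∑ l ∈ lowDeg d (S.deg b + 2 - sdeg n.1),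
        (midxFactorial l : ℝ)⁻¹ • (S.basis (P.X l) ⊗ₜ[ℝ] Ip (n.1 + l) (S.basis b))

section Models

variable {d : ℕ} {B T Tp : Type*} [AddCommGroup T] [Module ℝ T] [CommRing Tp]
  [Bialgebra ℝ Tp] {S : RegStructure B T Tp} {P : PolySector d S}

/-- The operator `I = I₀`. -/
def IntSector.I₀ (J : IntSector S P) : T →ₗ[ℝ] T := J.I ⟨0, by simp [sdeg]⟩

/-- Each `τ/σ` is generated by the `X₊^{eᵢ}` and by the `I⁺ₙ η` with `|η| < |τ|`. -/
def IntSector.IsInductive (J : IntSector S P) : Prop :=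
  ∀ τ σ : B, S.quot τ σ ∈ Algebra.adjoin ℝ
    (Set.range P.Xp ∪ {u | ∃ n η, S.deg η < S.deg τ ∧ u = J.Ip n (S.basis η)})

/-- The character of `T⁺` with `X₊^{eᵢ} ↦ xᵢ` and `I⁺ₙ τ ↦ 0`. -/
def IntSector.transChar (J : IntSector S P) (x : Space d) : Tp →ₐ[ℝ] ℝ :=
  (MvPolynomial.aeval (Sum.elim (fun i => x i) fun _ => 0)).comp
    (AlgEquiv.ofBijective _ J.free).symm.toAlgHom

/-! ## Models -/

variable (d T Tp) in
/-- A linear map `Π : T → S'(ℝ × ℝᵈ)` and a family `g` of characters of `T⁺`. -/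
structure PreModel where
  /-- the map `Π` -/
  Pi : T →ₗ[ℝ] TDist d
  /-- the characters `g_x` -/
  g : Space d → Tp →ₐ[ℝ] ℝ

namespace PreModel

/-- The inverse `g_x⁻¹` for the convolution `g * h = (g ⊗ h) Δ⁺`. -/
def gInv (M : PreModel d T Tp) (x : Space d) : Tp →ₗ[ℝ] ℝ :=
  (Ring.inverse (WithConv.toConv (M.g x).toLinearMap)).ofConv

/-- `g_{yx} = g_y * g_x⁻¹`. -/
def gyx (M : PreModel d T Tp) (y x : Space d) : Tp →ₗ[ℝ] ℝ :=
  (WithConv.toConv (M.g y).toLinearMap * WithConv.toConv (M.gInv x)).ofConv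

/-- `Π_x = (Π ⊗ g_x⁻¹) Δ`. -/
def Pix (M : PreModel d T Tp) (S : RegStructure B T Tp) (x : Space d) : T →ₗ[ℝ] TDist d :=
  pairRight M.Pi (M.gInv x) ∘ₗ S.Δ

/-- The bounds of a model, with base points in the set `Q`. -/
def BoundsOn (M : PreModel d T Tp) (S : RegStructure B T Tp) (Q : Set (Space d)) : Prop :=
  (∀ α : ℝ, ∀ u ∈ S.gradeP α, ∃ C : ℝ, ∀ x ∈ Q, ∀ y ∈ Q, |M.gyx y x u| ≤ C * pdist y x ^ α) ∧
  ∀ b : B, ∃ C : ℝ, ∀ x ∈ Q, ∀ (t : ℝ) (ht : 0 < t), t ≤ 1 →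
    |M.Pix S x (S.basis b) (heatKernel t ht x)| ≤ C * t ^ (S.deg b / 4)

/-- `(Π, g)` is a model. -/
def IsModel (M : PreModel d T Tp) (S : RegStructure B T Tp) : Prop := M.BoundsOn S Set.univ

/-- `(Π, g)` is a model on compact sets. -/
def IsLocalModel (M : PreModel d T Tp) (S : RegStructure B T Tp) : Prop :=
  ∀ Q : Set (Space d), IsCompact Q → M.BoundsOn S Q

/-- `(Π, g)` is the canonical model on polynomials. -/
def IsCanonical (M : PreModel d T Tp) (P : PolySector d S) : Prop :=
  (∀ n (φ : 𝓢(Space d, ℝ)), M.Pi (S.basis (P.X n)) φ = ∫ x, monomialFun n x * φ x) ∧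
  ∀ x i, M.g x (P.Xp i) = x i

/-- `Π` is `K`-admissible. -/
def IsAdmissible (M : PreModel d T Tp) (J : IntSector S P) : Prop :=
  (∀ b (φ : 𝓢(Space d, ℝ)), M.Pi (J.I₀ (S.basis b)) φ = Kapply (M.Pi (S.basis b)) φ) ∧
  ∀ n b (φ : 𝓢(Space d, ℝ)), M.Pi (P.mulX n (S.basis b)) φ =
    M.Pi (S.basis b) (SchwartzMap.smulLeftCLM ℝ (monomialFun n) φ)

/-- `Π τ = [τ]` for every basis element `τ` of negative homogeneity. -/
def Extends (M : PreModel d T Tp) (S : RegStructure B T Tp)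
    (fam : {b : B // S.deg b < 0} → Space d → ℝ) : Prop :=
  ∀ b (φ : 𝓢(Space d, ℝ)), M.Pi (S.basis b.1) φ = ∫ x, fam b x * φ x

end PreModel

open Classical in
/-- The linear extension of `τ ↦ [τ]`, by zero on the basis elements of homogeneity `≥ 0`. -/
def famLin (S : RegStructure B T Tp) (fam : {b : B // S.deg b < 0} → Space d → ℝ) :
    T →ₗ[ℝ] Space d → ℝ :=
  S.basis.constr ℝ fun b => if h : S.deg b < 0 then fam ⟨b, h⟩ else 0

/-- The family is compatible with multiplication by polynomials: `[Xⁿ ⋆ τ] = xⁿ [τ]`. -/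
def IsCompatible (P : PolySector d S) (fam : {b : B // S.deg b < 0} → Space d → ℝ) : Prop :=
  ∀ n b, S.deg b + sdeg n < 0 → famLin S fam (P.mulX n (S.basis b)) =
    fun x => monomialFun n x * famLin S fam (S.basis b) x

/-- All derivatives at `x` of the family recentred polynomially at `x` are bounded in `x`. -/
def IsUniform (J : IntSector S P) (fam : {b : B // S.deg b < 0} → Space d → ℝ) : Prop :=
  ∀ b, S.deg b < 0 → ∀ k : ℕ, ∃ C : ℝ, ∀ x : Space d,
    ‖iteratedFDeriv ℝ k
      (pairRight (famLin S fam) (J.transChar (-x)).toLinearMap (S.Δ (S.basis b))) x‖ ≤ C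

end Models

end

/-! All data are smooth functions, so the model can be defined pointwise, and its bounds come from
Taylor expansion alone; no smoothing by `K` is used. Write `h_x = g_x⁻¹` and let `t_x` be the
character `X₊^{eᵢ} ↦ xᵢ`, `I⁺ₙ τ ↦ 0`. The model is singled out by two requirements: `(Π_y τ)(y) =
0` for `|τ| > 0`, and `h_x = t_{-x} * a_x`, where `a_x` vanishes on the `X₊^{eᵢ}` and `a_x(I⁺ₙ τ) =
-∂ⁿ(K Π_x τ)(x)`. Because `Δ τ` is `τ ⊗ 1` plus terms of lower homogeneity, and `τ/σ` involves only
generators below `τ`, these requirements are a recursion on homogeneity (`exists_solution`).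

Admissibility is algebra. The functional `eps x v = (Π_x v)(x)` kills positive homogeneity, and `(Π
v)(x) = eps x ((Id ⊗ g_x) Δ v)`. Applied to `I₀ τ`, only the coefficient of `X⁰` survives, and `a_x
* g_x = t_x` identifies it with `(K Π τ)(x)` (`F_I₀`). In the same way `Π(Xⁿ ⋆ τ) = xⁿ Π τ`
(`F_mulX`); homogeneities `|τ| + |n| < 0` use the compatibility of the given family, and `|τ| + |n|
= 0` with `n ≠ 0` cannot occur.

For the bounds, `a_y * g_{yx} = t_{y-x} * a_x` expresses `g_{yx}(I⁺ₙ τ)` as the Taylor remainder of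
`∂ⁿ K Π_x τ` at `x`, up to terms that already have the right order (`gb_up_Ip`). For `|τ| > 0`, `Π_x
τ` evaluated at `y` is a combination of `g_{yx}(τ/σ)` with `|σ| ≤ 0`, hence of order `|τ|`
(`gb_phi`). The constants are uniform for `x ∈ Q` once the polynomially recentred functions `[(Id ⊗
t_{-x}) Δ τ](x + ·)`, `|τ| < 0`, are uniformly temperate (`regular`). For compact `Q` this is
automatic, and for the whole space it follows from the assumption of the second part. For distant
points, the recursive formula for `g_{yx}` with its bounded coefficients replaces Taylor's formula
(`upBound_Ip`).

Uniqueness is again an induction on homogeneity. If two models agree below `τ` and `|τ| > 0`, the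
difference of their `Π τ` equals that of their `Π_x τ` for every `x`, so its heat averages tend to
zero locally uniformly, and it vanishes (`tdist_eq_zero`). The limit of `Π_x I₀ τ` tested against
`p_t(y, ·)` is `g_{yx}(I⁺₀ τ)`. For two models these differ by a polynomial in `y` of scaled degree
below `|τ| + 2` that vanishes at `x` to that order, so it is zero; its coefficients determine all
`g_x(I⁺ₙ τ)` (`char_unique`). -/

open SchwartzMap MeasureTheory
open scoped ContDiff FourierTransform
open scoped TensorProduct

noncomputable section

/-! ## Partial derivatives and families of temperate functions -/

namespace Temperate

variable {d : ℕ}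

/-- The `i`-th unit vector. -/
def unitVec (i : Fin (d + 1)) : Space d := EuclideanSpace.single i (1 : ℝ)

/-- The `i`-th partial derivative. -/
def pd (i : Fin (d + 1)) (f : Space d → ℝ) : Space d → ℝ := fun x => fderiv ℝ f x (unitVec i)

lemma unitVec_apply (i j : Fin (d + 1)) : (unitVec i : Space d) j = if j = i then 1 else 0 := by
  simp [unitVec]

lemma norm_unitVec (i : Fin (d + 1)) : ‖(unitVec i : Space d)‖ = 1 := by simp [unitVec]

lemma eq_sum_unitVec (z : Space d) : z = ∑ i, z i • unitVec i := by
  ext j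
  simp [unitVec_apply]

lemma fderiv_apply_eq_sum (f : Space d → ℝ) (x z : Space d) :
    fderiv ℝ f x z = ∑ i, z i * pd i f x := by
  conv_lhs => rw [eq_sum_unitVec z]
  simp [pd]

lemma abs_coord_le (z : Space d) (i : Fin (d + 1)) : |z i| ≤ ‖z‖ := by
  simpa using EuclideanSpace.norm_eq z ▸ PiLp.norm_apply_le z i

lemma pd_smooth {f : Space d → ℝ} (hf : ContDiff ℝ ∞ f) (i : Fin (d + 1)) :
    ContDiff ℝ ∞ (pd i f) :=
  (hf.fderiv_right (m := ∞) (by simp)).clm_apply contDiff_const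

lemma diffAt {f : Space d → ℝ} (hf : ContDiff ℝ ∞ f) (x : Space d) : DifferentiableAt ℝ f x :=
  (hf.differentiable (by simp)) x

lemma pd_comm {f : Space d → ℝ} (hf : ContDiff ℝ ∞ f) (i j : Fin (d + 1)) :
    pd i (pd j f) = pd j (pd i f) := by
  funext x
  have h1 : DifferentiableAt ℝ (fderiv ℝ f) x :=
    (hf.fderiv_right (m := ∞) (by simp)).differentiable (by simp) x
  have key : ∀ a b : Space d, fderiv ℝ (fun y => fderiv ℝ f y a) x b =
      fderiv ℝ (fderiv ℝ f) x b a := by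
    intro a b
    rw [fderiv_clm_apply h1 (differentiableAt_const a)]
    simp
  have hs : IsSymmSndFDerivAt ℝ f x :=
    (hf.contDiffAt).isSymmSndFDerivAt (by
      rw [minSmoothness_of_isRCLikeNormedField]; exact WithTop.coe_le_coe.2 le_top)
  unfold pd
  rw [key, key]
  exact hs _ _

lemma pd_add {f g : Space d → ℝ} (hf : ContDiff ℝ ∞ f) (hg : ContDiff ℝ ∞ g) (i : Fin (d + 1)) :
    pd i (f + g) = pd i f + pd i g := by
  funext x
  simp [pd, fderiv_add (diffAt hf x) (diffAt hg x)]

lemma pd_smul {f : Space d → ℝ} (hf : ContDiff ℝ ∞ f) (c : ℝ) (i : Fin (d + 1)) :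
    pd i (c • f) = c • pd i f := by
  funext x
  simp [pd, fderiv_const_smul (diffAt hf x)]

lemma pd_mul {f g : Space d → ℝ} (hf : ContDiff ℝ ∞ f) (hg : ContDiff ℝ ∞ g) (i : Fin (d + 1)) :
    pd i (f * g) = pd i f * g + f * pd i g := by
  funext x
  simp [pd, fderiv_mul (diffAt hf x) (diffAt hg x)]
  ring

lemma pd_translate (f : Space d → ℝ) (i : Fin (d + 1)) (a : Space d) :
    pd i (fun z => f (a + z)) = fun z => pd i f (a + z) := by
  funext x
  simp only [pd]
  rw [fderiv_comp_add_left]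

/-- The partial derivatives `∂^k` along a list of coordinates. -/
def lpd (k : MIdx d) (l : List (Fin (d + 1))) (f : Space d → ℝ) : Space d → ℝ :=
  l.foldr (fun i g => (pd i)^[k i] g) f

/-- The iterated partial derivative `∂^k`. -/
def mpd (k : MIdx d) (f : Space d → ℝ) : Space d → ℝ := lpd k (List.finRange (d + 1)) f

lemma iter_pd_smooth {f : Space d → ℝ} (hf : ContDiff ℝ ∞ f) (i : Fin (d + 1)) (n : ℕ) :
    ContDiff ℝ ∞ ((pd i)^[n] f) := by
  induction n generalizing f with
  | zero => simpa
  | succ n ih => exact ih (pd_smooth hf i)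

lemma lpd_smooth {f : Space d → ℝ} (hf : ContDiff ℝ ∞ f) (k : MIdx d) (l : List (Fin (d + 1))) :
    ContDiff ℝ ∞ (lpd k l f) := by
  induction l with
  | nil => exact hf
  | cons j l ih => exact iter_pd_smooth ih j _

lemma iter_pd_comm {f : Space d → ℝ} (hf : ContDiff ℝ ∞ f) (i j : Fin (d + 1)) (n : ℕ) :
    (pd j)^[n] (pd i f) = pd i ((pd j)^[n] f) := by
  induction n generalizing f with
  | zero => rfl
  | succ n ih => rw [Function.iterate_succ_apply, Function.iterate_succ_apply, pd_comm hf j i,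
      ih (pd_smooth hf j)]

lemma lpd_pd {f : Space d → ℝ} (hf : ContDiff ℝ ∞ f) (k : MIdx d) (l : List (Fin (d + 1)))
    (i : Fin (d + 1)) : lpd k l (pd i f) = pd i (lpd k l f) := by
  induction l with
  | nil => rfl
  | cons j l ih =>
    simp only [lpd, List.foldr_cons] at ih ⊢
    rw [ih]
    exact iter_pd_comm (lpd_smooth hf k l) i j _

lemma lpd_add_single_of_notMem (f : Space d → ℝ) (k : MIdx d) (l : List (Fin (d + 1)))
    (i : Fin (d + 1)) (hi : i ∉ l) : lpd (k + Pi.single i 1) l f = lpd k l f := by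
  induction l with
  | nil => rfl
  | cons j l ih =>
    simp only [List.mem_cons, not_or] at hi
    simp only [lpd, List.foldr_cons] at ih ⊢
    rw [ih hi.2]
    simp [Ne.symm hi.1]

lemma lpd_add_single {f : Space d → ℝ} (hf : ContDiff ℝ ∞ f) (k : MIdx d)
    (l : List (Fin (d + 1))) (hl : l.Nodup) (i : Fin (d + 1)) (hi : i ∈ l) :
    lpd (k + Pi.single i 1) l f = lpd k l (pd i f) := by
  induction l with
  | nil => simp at hi
  | cons j l ih =>
    rw [List.nodup_cons] at hl
    by_cases hij : i = j
    · subst hij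
      have h1 := lpd_add_single_of_notMem f k l i hl.1
      have h2 := lpd_pd hf k l i
      simp only [lpd, List.foldr_cons] at h1 h2 ⊢
      rw [h1, h2]
      rw [← Function.iterate_succ_apply]
      simp
    · have hi' : i ∈ l := by simpa [hij] using hi
      have h1 := ih hl.2 hi'
      simp only [lpd, List.foldr_cons] at h1 ⊢
      rw [h1]
      simp [Ne.symm hij]

lemma mpd_zero (f : Space d → ℝ) : mpd 0 f = f := by
  unfold mpd lpd
  induction List.finRange (d + 1) with
  | nil => rfl
  | cons j l ih => simp

/-- Partial derivatives of a smooth function commute, so the additional one may be taken to act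
first, directly on `f`. Inductions over multi-indices, with `f` generalised, peel off derivatives in
this form. -/
lemma mpd_add_single {f : Space d → ℝ} (hf : ContDiff ℝ ∞ f) (k : MIdx d) (i : Fin (d + 1)) :
    mpd (k + Pi.single i 1) f = mpd k (pd i f) :=
  lpd_add_single hf k _ (List.nodup_finRange _) i (List.mem_finRange i)

lemma mpd_smooth {f : Space d → ℝ} (hf : ContDiff ℝ ∞ f) (k : MIdx d) :
    ContDiff ℝ ∞ (mpd k f) := lpd_smooth hf k _

lemma exists_eq_add_single {k : MIdx d} {n : ℕ} (hn : ∑ i, k i = n + 1) :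
    ∃ (l : MIdx d) (i : Fin (d + 1)), k = l + Pi.single i 1 ∧ ∑ i, l i = n := by
  obtain ⟨i, hi⟩ : ∃ i, k i ≠ 0 := by
    by_contra! h
    simp [h] at hn
  obtain ⟨l, rfl⟩ : ∃ l : MIdx d, k = l + Pi.single i 1 := by
    refine ⟨fun j => k j - (Pi.single i 1 : MIdx d) j, ?_⟩
    funext j
    by_cases hj : j = i
    · subst hj; simp; omega
    · simp [hj]
  refine ⟨l, i, rfl, ?_⟩
  simpa [Finset.sum_add_distrib] using hn

lemma eq_zero_of_sum {k : MIdx d} (hn : ∑ i, k i = 0) : k = 0 := by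
  funext i
  simpa using (Finset.sum_eq_zero_iff.1 hn) i (Finset.mem_univ i)

/-- Induction on multi-indices. -/
lemma midx_induction {p : MIdx d → Prop} (h0 : p 0)
    (h1 : ∀ k i, p k → p (k + Pi.single i 1)) (k : MIdx d) : p k := by
  induction hn : ∑ i, k i generalizing k with
  | zero => rwa [eq_zero_of_sum hn]
  | succ n ih =>
    obtain ⟨l, i, rfl, hl⟩ := exists_eq_add_single hn
    exact h1 _ _ (ih _ hl)

lemma mpd_single {f : Space d → ℝ} (hf : ContDiff ℝ ∞ f) (i : Fin (d + 1)) :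
    mpd (Pi.single i 1) f = pd i f := by
  rw [← zero_add (Pi.single i 1), mpd_add_single hf, mpd_zero]

lemma mpd_add_idx {f : Space d → ℝ} (hf : ContDiff ℝ ∞ f) (k l : MIdx d) :
    mpd (k + l) f = mpd k (mpd l f) := by
  induction l using midx_induction generalizing f with
  | h0 => simp [mpd_zero]
  | h1 l i ih => rw [← add_assoc, mpd_add_single hf, mpd_add_single hf, ih (pd_smooth hf i)]

lemma mpd_add {f g : Space d → ℝ} (hf : ContDiff ℝ ∞ f) (hg : ContDiff ℝ ∞ g) (k : MIdx d) :
    mpd k (f + g) = mpd k f + mpd k g := by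
  induction k using midx_induction generalizing f g with
  | h0 => simp [mpd_zero]
  | h1 k i ih =>
    rw [mpd_add_single (f := f + g) (hf.add hg), mpd_add_single hf, mpd_add_single hg, pd_add hf hg,
      ih (pd_smooth hf i) (pd_smooth hg i)]

lemma mpd_smul {f : Space d → ℝ} (hf : ContDiff ℝ ∞ f) (c : ℝ) (k : MIdx d) :
    mpd k (c • f) = c • mpd k f := by
  induction k using midx_induction generalizing f with
  | h0 => simp [mpd_zero]
  | h1 k i ih =>
    rw [mpd_add_single (f := c • f) (contDiff_const.smul hf), mpd_add_single hf, pd_smul hf,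
      ih (pd_smooth hf i)]

lemma mpd_zero_fun (k : MIdx d) : mpd k (0 : Space d → ℝ) = 0 := by
  simpa using mpd_smul (contDiff_const (c := (0 : ℝ))) 0 k (f := (0 : Space d → ℝ))

lemma mpd_sum {ι : Type*} (s : Finset ι) {f : ι → Space d → ℝ}
    (hf : ∀ j ∈ s, ContDiff ℝ ∞ (f j)) (k : MIdx d) :
    mpd k (∑ j ∈ s, f j) = ∑ j ∈ s, mpd k (f j) := by
  classical
  induction s using Finset.induction_on with
  | empty => simp [mpd_zero_fun]
  | insert a s ha ih =>
    rw [Finset.sum_insert ha, Finset.sum_insert ha, mpd_add (hf _ (by simp)), ih]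
    · exact fun j hj => hf j (by simp [hj])
    · have : ContDiff ℝ ∞ (fun x => ∑ j ∈ s, f j x) :=
        ContDiff.sum fun j hj => hf j (by simp [hj])
      convert this using 1
      ext x
      simp

lemma mpd_translate {f : Space d → ℝ} (hf : ContDiff ℝ ∞ f) (k : MIdx d) (a : Space d) :
    mpd k (fun z => f (a + z)) = fun z => mpd k f (a + z) := by
  induction k using midx_induction generalizing f with
  | h0 => simp [mpd_zero]
  | h1 k i ih =>
    rw [mpd_add_single (f := fun z => f (a + z)) (hf.comp (contDiff_const.add contDiff_id)),
      mpd_add_single hf, pd_translate,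
      ih (pd_smooth hf i)]

lemma norm_iteratedFDeriv_pd_le {f : Space d → ℝ} (hf : ContDiff ℝ ∞ f) (i : Fin (d + 1)) (n : ℕ)
    (x : Space d) : ‖iteratedFDeriv ℝ n (pd i f) x‖ ≤ ‖iteratedFDeriv ℝ (n + 1) f x‖ := by
  have h1 : ContDiff ℝ ∞ (fderiv ℝ f) := hf.fderiv_right (m := ∞) (by simp)
  have : pd i f = (ContinuousLinearMap.apply ℝ ℝ (unitVec i)) ∘ (fderiv ℝ f) := rfl
  rw [this]
  refine (ContinuousLinearMap.norm_iteratedFDeriv_comp_left _ (h1.contDiffAt) (n := n)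
    (by exact_mod_cast le_top)).trans ?_
  rw [← norm_iteratedFDeriv_fderiv]
  refine mul_le_of_le_one_left (norm_nonneg _) ?_
  refine ContinuousLinearMap.opNorm_le_bound _ zero_le_one fun L => ?_
  simpa [norm_unitVec] using L.le_opNorm (unitVec i)

lemma abs_mpd_le {f : Space d → ℝ} (hf : ContDiff ℝ ∞ f) (k : MIdx d) (x : Space d) :
    |mpd k f x| ≤ ‖iteratedFDeriv ℝ (∑ i, k i) f x‖ := by
  -- The extra order `n` gives the induction room: each peeled partial derivative is traded for one
  -- order of the full derivative. The free `m` avoids rewriting inside the dependent type of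
  -- `iteratedFDeriv`.
  suffices h : ∀ n m, m = n + ∑ i, k i →
      ‖iteratedFDeriv ℝ n (mpd k f) x‖ ≤ ‖iteratedFDeriv ℝ m f x‖ by
    have := h 0 _ (zero_add _).symm
    simpa using this
  induction k using midx_induction generalizing f with
  | h0 =>
    intro n m h
    simp only [Pi.zero_apply, Finset.sum_const_zero, add_zero] at h
    rw [h, mpd_zero]
  | h1 k i ih =>
    intro n m h
    simp only [Pi.add_apply, Finset.sum_add_distrib, Finset.sum_pi_single', Finset.mem_univ,
      if_true, ← add_assoc] at h
    rw [mpd_add_single hf, h]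
    exact (ih (pd_smooth hf i) n _ rfl).trans (norm_iteratedFDeriv_pd_le hf i _ x)

/-- A family of smooth functions whose derivatives have polynomial growth, uniformly in the
parameter. -/
structure UT {Θ : Type*} (F : Θ → Space d → ℝ) : Prop where
  smooth : ∀ θ, ContDiff ℝ ∞ (F θ)
  bound : ∀ k : MIdx d, ∃ (C : ℝ) (N : ℕ), ∀ θ z, |mpd k (F θ) z| ≤ C * (1 + ‖z‖) ^ N

/-! ### Calculus of uniformly temperate families -/

namespace UT

variable {Θ : Type*} {F G : Θ → Space d → ℝ}

lemma one_le_weight (z : Space d) (N : ℕ) : 1 ≤ (1 + ‖z‖) ^ N :=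
  one_le_pow₀ (by linarith [norm_nonneg z])

lemma weight_mono (z : Space d) {N M : ℕ} (h : N ≤ M) : (1 + ‖z‖) ^ N ≤ (1 + ‖z‖) ^ M :=
  pow_le_pow_right₀ (by linarith [norm_nonneg z]) h

lemma bound_nonneg (hF : UT F) (k : MIdx d) : ∃ (C : ℝ) (N : ℕ), 0 ≤ C ∧
    ∀ θ z, |mpd k (F θ) z| ≤ C * (1 + ‖z‖) ^ N := by
  obtain ⟨C, N, h⟩ := hF.bound k
  refine ⟨|C|, N, abs_nonneg _, fun θ z => (h θ z).trans ?_⟩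
  gcongr
  exact le_abs_self C

lemma bound_zero (hF : UT F) : ∃ (C : ℝ) (N : ℕ), 0 ≤ C ∧ ∀ θ z, |F θ z| ≤ C * (1 + ‖z‖) ^ N := by
  obtain ⟨C, N, hC, h⟩ := hF.bound_nonneg 0
  exact ⟨C, N, hC, by simpa [mpd_zero] using h⟩

lemma pd (hF : UT F) (i : Fin (d + 1)) : UT (fun θ => pd i (F θ)) where
  smooth θ := pd_smooth (hF.smooth θ) i
  bound k := by
    obtain ⟨C, N, h⟩ := hF.bound (k + Pi.single i 1)
    refine ⟨C, N, fun θ z => ?_⟩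
    rw [← mpd_add_single (hF.smooth θ)]
    exact h θ z

lemma mpd (hF : UT F) (l : MIdx d) : UT (fun θ => mpd l (F θ)) where
  smooth θ := mpd_smooth (hF.smooth θ) l
  bound k := by
    obtain ⟨C, N, h⟩ := hF.bound (k + l)
    refine ⟨C, N, fun θ z => ?_⟩
    rw [← mpd_add_idx (hF.smooth θ)]
    exact h θ z

lemma comp_param {Θ' : Type*} (hF : UT F) (e : Θ' → Θ) : UT (fun θ => F (e θ)) where
  smooth θ := hF.smooth _
  bound k := by
    obtain ⟨C, N, h⟩ := hF.bound k
    exact ⟨C, N, fun θ z => h _ z⟩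

lemma congr (hF : UT F) (h : ∀ θ z, G θ z = F θ z) : UT G := by
  have : G = F := funext fun θ => funext fun z => h θ z
  rwa [this]

lemma add (hF : UT F) (hG : UT G) : UT (fun θ z => F θ z + G θ z) where
  smooth θ := (hF.smooth θ).add (hG.smooth θ)
  bound k := by
    obtain ⟨C, N, hC, h⟩ := hF.bound_nonneg k
    obtain ⟨C', N', hC', h'⟩ := hG.bound_nonneg k
    refine ⟨C + C', N + N', fun θ z => ?_⟩
    have := mpd_add (hF.smooth θ) (hG.smooth θ) k
    change |Temperate.mpd k (F θ + G θ) z| ≤ _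
    rw [this]
    calc _ ≤ |Temperate.mpd k (F θ) z| + |Temperate.mpd k (G θ) z| := abs_add_le _ _
      _ ≤ C * (1 + ‖z‖) ^ N + C' * (1 + ‖z‖) ^ N' := add_le_add (h θ z) (h' θ z)
      _ ≤ C * (1 + ‖z‖) ^ (N + N') + C' * (1 + ‖z‖) ^ (N + N') := by
        gcongr ?_ * ?_ + ?_ * ?_
        · exact weight_mono z (by omega)
        · exact weight_mono z (by omega)
      _ = _ := by ring

/-- Families that do not depend on the point. -/
lemma const {a : Θ → ℝ} {C : ℝ} (ha : ∀ θ, |a θ| ≤ C) : UT (fun θ (_ : Space d) => a θ) where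
  smooth θ := contDiff_const
  bound k := by
    refine ⟨C, 0, fun θ z => ?_⟩
    have h0 : 0 ≤ C := (abs_nonneg _).trans (ha θ)
    have : ∀ k : MIdx d, Temperate.mpd k (fun _ : Space d => a θ) = 0 ∨
        Temperate.mpd k (fun _ : Space d => a θ) = fun _ => a θ := by
      intro k
      induction k using midx_induction with
      | h0 => right; exact mpd_zero _
      | h1 k i ih =>
        left
        rw [mpd_add_single contDiff_const]
        have : Temperate.pd i (fun _ : Space d => a θ) = 0 := by funext x; simp [Temperate.pd]
        rw [this, mpd_zero_fun]
    rcases this k with h | h <;> simp [h, ha θ, h0]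

/-- Leibniz' rule without binomial coefficients: after one derivative is peeled off, both resulting
products have one derivative fewer to go. The induction must therefore range over all pairs of
families. -/
lemma mul_aux (n : ℕ) : ∀ {F G : Θ → Space d → ℝ}, UT F → UT G → ∀ k : MIdx d, ∑ i, k i = n →
    ∃ (C : ℝ) (N : ℕ), 0 ≤ C ∧
      ∀ θ z, |Temperate.mpd k (F θ * G θ) z| ≤ C * (1 + ‖z‖) ^ N := by
  induction n with
  | zero =>
    intro F G hF hG k hk
    have hk0 : k = 0 := eq_zero_of_sum hk
    obtain ⟨C, N, hC, h⟩ := hF.bound_zero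
    obtain ⟨C', N', hC', h'⟩ := hG.bound_zero
    refine ⟨C * C', N + N', by positivity, fun θ z => ?_⟩
    rw [hk0, mpd_zero, Pi.mul_apply, abs_mul]
    calc _ ≤ (C * (1 + ‖z‖) ^ N) * (C' * (1 + ‖z‖) ^ N') :=
          mul_le_mul (h θ z) (h' θ z) (abs_nonneg _) (by positivity)
      _ = _ := by ring
  | succ n ih =>
    intro F G hF hG k hk
    obtain ⟨l, i, rfl, hsum⟩ := exists_eq_add_single hk
    obtain ⟨C, N, hC, h⟩ := ih (hF.pd i) hG _ hsum
    obtain ⟨C', N', hC', h'⟩ := ih hF (hG.pd i) _ hsum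
    refine ⟨C + C', N + N', by positivity, fun θ z => ?_⟩
    rw [mpd_add_single (f := F θ * G θ) ((hF.smooth θ).mul (hG.smooth θ)), pd_mul (hF.smooth θ) (hG.smooth θ),
      mpd_add (f := Temperate.pd i (F θ) * G θ) (g := F θ * Temperate.pd i (G θ))
        ((pd_smooth (hF.smooth θ) i).mul (hG.smooth θ))
        ((hF.smooth θ).mul (pd_smooth (hG.smooth θ) i))]
    calc _ ≤ _ := abs_add_le _ _
      _ ≤ C * (1 + ‖z‖) ^ N + C' * (1 + ‖z‖) ^ N' := add_le_add (h θ z) (h' θ z)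
      _ ≤ C * (1 + ‖z‖) ^ (N + N') + C' * (1 + ‖z‖) ^ (N + N') := by
        gcongr ?_ * ?_ + ?_ * ?_
        · exact weight_mono z (by omega)
        · exact weight_mono z (by omega)
      _ = _ := by ring

lemma mul (hF : UT F) (hG : UT G) : UT (fun θ z => F θ z * G θ z) where
  smooth θ := (hF.smooth θ).mul (hG.smooth θ)
  bound k := by
    obtain ⟨C, N, _, h⟩ := mul_aux _ hF hG k rfl
    exact ⟨C, N, h⟩

lemma const_mul {a : Θ → ℝ} {C : ℝ} (ha : ∀ θ, |a θ| ≤ C) (hF : UT F) :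
    UT (fun θ z => a θ * F θ z) := (const ha).mul hF

lemma smul_const (a : ℝ) (hF : UT F) : UT (fun θ z => a * F θ z) :=
  const_mul (fun _ => le_refl |a|) hF

lemma neg (hF : UT F) : UT (fun θ z => -F θ z) :=
  (hF.smul_const (-1)).congr fun θ z => by ring

lemma sub (hF : UT F) (hG : UT G) : UT (fun θ z => F θ z - G θ z) :=
  (hF.add hG.neg).congr fun θ z => by ring

lemma zero : UT (fun (_ : Θ) (_ : Space d) => (0 : ℝ)) := const (C := 0) (by simp)

lemma sum {ι : Type*} (s : Finset ι) {F : ι → Θ → Space d → ℝ} (h : ∀ j ∈ s, UT (F j)) :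
    UT (fun θ z => ∑ j ∈ s, F j θ z) := by
  classical
  induction s using Finset.induction_on with
  | empty => simpa using zero
  | insert a s ha ih =>
    simp only [Finset.sum_insert ha]
    exact (h a (by simp)).add (ih fun j hj => h j (by simp [hj]))

lemma prod {ι : Type*} (s : Finset ι) {F : ι → Θ → Space d → ℝ} (h : ∀ j ∈ s, UT (F j)) :
    UT (fun θ z => ∏ j ∈ s, F j θ z) := by
  classical
  induction s using Finset.induction_on with
  | empty => simpa using const (Θ := Θ) (d := d) (a := fun _ => 1) (C := 1) (by simp)
  | insert a s ha ih =>
    simp only [Finset.prod_insert ha]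
    exact (h a (by simp)).mul (ih fun j hj => h j (by simp [hj]))

lemma pow (hF : UT F) (n : ℕ) : UT (fun θ z => F θ z ^ n) := by
  simpa using prod (Finset.range n) (F := fun _ => F) fun _ _ => hF

lemma of_iteratedFDeriv (hs : ∀ θ, ContDiff ℝ ∞ (F θ))
    (h : ∀ n : ℕ, ∃ (C : ℝ) (N : ℕ), ∀ θ z, ‖iteratedFDeriv ℝ n (F θ) z‖ ≤ C * (1 + ‖z‖) ^ N) :
    UT F where
  smooth := hs
  bound k := by
    obtain ⟨C, N, h⟩ := h (∑ i, k i)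
    exact ⟨C, N, fun θ z => (abs_mpd_le (hs θ) k z).trans (h θ z)⟩

lemma of_temperate {f : Space d → ℝ} (hf : f.HasTemperateGrowth) : UT (fun _ : Θ => f) := by
  refine of_iteratedFDeriv (fun _ => hf.1) fun n => ?_
  obtain ⟨N, C, h⟩ := hf.2 n
  exact ⟨C, N, fun _ z => h z⟩

lemma coord (i : Fin (d + 1)) : UT (fun (_ : Θ) (z : Space d) => z i) :=
  of_temperate (coord_temperate i)

lemma neg_coord (i : Fin (d + 1)) : UT (fun (_ : Θ) (z : Space d) => -z i) := (coord i).neg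

lemma monomial (n : MIdx d) : UT (fun (_ : Θ) (z : Space d) => monomialFun n z) :=
  of_temperate (monomialFun_temperate n)

/-- Recentring a single temperate function at points of a bounded set. -/
lemma recentre {f : Space d → ℝ} (hf : UT (fun _ : Unit => f)) (e : Θ → Space d) {R : ℝ}
    (he : ∀ θ, ‖e θ‖ ≤ R) : UT (fun θ z => f (e θ + z)) where
  smooth θ := (hf.smooth ()).comp (contDiff_const.add contDiff_id)
  bound k := by
    obtain ⟨C, N, hC, h⟩ := hf.bound_nonneg k
    refine ⟨C * (1 + R) ^ N, N, fun θ z => ?_⟩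
    rw [mpd_translate (hf.smooth ())]
    refine (h () _).trans ?_
    rw [mul_assoc, ← mul_pow]
    have hR : 0 ≤ R := (norm_nonneg _).trans (he θ)
    gcongr
    calc 1 + ‖e θ + z‖ ≤ 1 + (R + ‖z‖) := by
          have := norm_add_le (e θ) z
          linarith [he θ]
      _ ≤ (1 + R) * (1 + ‖z‖) := by nlinarith [norm_nonneg z]

end UT

end Temperate

/-! ## Parabolic Taylor expansions -/

namespace Temperate

variable {d : ℕ}

/-- The parabolic norm `√|z₀| + |z'|`. -/
def pn (z : Space d) : ℝ := Real.sqrt |z 0| + Real.sqrt (spaceNormSq z)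

lemma pdist_eq (x y : Space d) : pdist x y = pn (x - y) := rfl

lemma pdist_add_left (x z : Space d) : pdist (x + z) x = pn z := by
  rw [pdist_eq, add_sub_cancel_left]

lemma pn_nonneg (z : Space d) : 0 ≤ pn z := by unfold pn; positivity

lemma spaceNormSq_nonneg (z : Space d) : 0 ≤ spaceNormSq z :=
  Finset.sum_nonneg fun _ _ => sq_nonneg _

lemma sqrt_spaceNormSq_le (z : Space d) : Real.sqrt (spaceNormSq z) ≤ ‖z‖ := by
  apply Real.sqrt_le_iff.2 ⟨norm_nonneg _, ?_⟩
  rw [norm_sq_eq]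
  nlinarith [sq_nonneg (z 0)]

lemma pn_le (z : Space d) : pn z ≤ 2 * (1 + ‖z‖) := by
  have h1 : Real.sqrt |z 0| ≤ 1 + ‖z‖ := by
    apply Real.sqrt_le_iff.2 ⟨by positivity, ?_⟩
    nlinarith [abs_coord_le z 0, norm_nonneg z]
  have := sqrt_spaceNormSq_le z
  unfold pn
  linarith [norm_nonneg z]

lemma abs_succ_le_pn (z : Space d) (i : Fin d) : |z i.succ| ≤ pn z := by
  have : |z i.succ| ≤ Real.sqrt (spaceNormSq z) := by
    apply Real.abs_le_sqrt
    exact Finset.single_le_sum (f := fun j : Fin d => z j.succ ^ 2) (fun _ _ => sq_nonneg _)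
      (Finset.mem_univ i)
  exact this.trans (le_add_of_nonneg_left (Real.sqrt_nonneg _))

lemma abs_zero_le_pn (z : Space d) : |z 0| ≤ pn z ^ 2 := by
  have h : Real.sqrt |z 0| ≤ pn z := le_add_of_nonneg_right (Real.sqrt_nonneg _)
  calc |z 0| = Real.sqrt |z 0| ^ 2 := (Real.sq_sqrt (abs_nonneg _)).symm
    _ ≤ _ := by gcongr

lemma norm_le_of_pn_le_one {z : Space d} (h : pn z ≤ 1) : ‖z‖ ≤ 2 := by
  have h0 := abs_zero_le_pn z
  have h1 : Real.sqrt (spaceNormSq z) ≤ pn z := le_add_of_nonneg_left (Real.sqrt_nonneg _)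
  have h2 : spaceNormSq z ≤ 1 := by
    rw [← Real.sq_sqrt (spaceNormSq_nonneg z)]
    exact pow_le_one₀ (Real.sqrt_nonneg _) (h1.trans h)
  have h3 : z 0 ^ 2 ≤ 1 := by
    rw [← sq_abs]
    exact pow_le_one₀ (abs_nonneg _) (h0.trans (pow_le_one₀ (pn_nonneg z) h))
  have := norm_sq_eq z
  nlinarith [norm_nonneg z]

lemma pn_smul_le {z : Space d} {s : ℝ} (h0 : 0 ≤ s) (h1 : s ≤ 1) : pn (s • z) ≤ pn z := by
  unfold pn spaceNormSq
  refine add_le_add (Real.sqrt_le_sqrt ?_)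
    (Real.sqrt_le_sqrt (Finset.sum_le_sum fun i _ => ?_))
  · simp only [PiLp.smul_apply, smul_eq_mul, abs_mul, abs_of_nonneg h0]
    exact mul_le_of_le_one_left (abs_nonneg _) h1
  · simp only [PiLp.smul_apply, smul_eq_mul, mul_pow]
    exact mul_le_of_le_one_left (sq_nonneg _) (pow_le_one₀ h0 h1)

lemma sdeg_add (k l : MIdx d) : sdeg (k + l) = sdeg k + sdeg l := by
  simp [sdeg, Finset.sum_add_distrib]; ring

lemma sdeg_zero : sdeg (0 : MIdx d) = 0 := by simp [sdeg]

lemma sdeg_single_zero : sdeg (Pi.single 0 1 : MIdx d) = 2 := by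
  simp [sdeg]

lemma sdeg_single_succ (i : Fin d) : sdeg (Pi.single i.succ 1 : MIdx d) = 1 := by
  simp [sdeg, Pi.single_apply]

lemma abs_coord_le_pn (z : Space d) (i : Fin (d + 1)) :
    |z i| ≤ pn z ^ sdeg (Pi.single i 1 : MIdx d) := by
  refine Fin.cases ?_ (fun j => ?_) i
  · rw [sdeg_single_zero]; exact abs_zero_le_pn z
  · rw [sdeg_single_succ, pow_one]; exact abs_succ_le_pn z j

lemma monomialFun_zero (z : Space d) : monomialFun 0 z = 1 := by simp [monomialFun]

lemma monomialFun_single (z : Space d) (i : Fin (d + 1)) :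
    monomialFun (Pi.single i 1) z = z i := by
  simp [monomialFun, Pi.single_apply, pow_ite]

lemma monomialFun_add (k l : MIdx d) (z : Space d) :
    monomialFun (k + l) z = monomialFun k z * monomialFun l z := by
  simp [monomialFun, pow_add, Finset.prod_mul_distrib]

lemma abs_monomialFun_le (k : MIdx d) (z : Space d) : |monomialFun k z| ≤ pn z ^ sdeg k := by
  induction k using midx_induction with
  | h0 => simp [monomialFun_zero, sdeg_zero]
  | h1 k i ih =>
    rw [monomialFun_add, monomialFun_single, sdeg_add, pow_add, abs_mul]
    exact mul_le_mul ih (abs_coord_le_pn z i) (abs_nonneg _) (pow_nonneg (pn_nonneg z) _)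

/-- Families bounded by `C d(z, 0)^α (1 + |z|)^N`. -/
def GB {Θ : Type*} (α : ℝ) (G : Θ → Space d → ℝ) : Prop :=
  ∃ (C : ℝ) (N : ℕ), 0 ≤ C ∧ ∀ θ z, |G θ z| ≤ C * pn z ^ α * (1 + ‖z‖) ^ N

/-! ### Calculus of parabolic orders of vanishing -/

namespace GB

variable {Θ : Type*} {F G : Θ → Space d → ℝ} {α β : ℝ}

lemma of_UT (hF : UT F) : GB 0 F := by
  obtain ⟨C, N, hC, h⟩ := hF.bound_zero
  exact ⟨C, N, hC, by simpa using h⟩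

lemma congr (hF : GB α F) (h : ∀ θ z, G θ z = F θ z) : GB α G := by
  have : G = F := funext fun θ => funext fun z => h θ z
  rwa [this]

lemma zero : GB α (fun (_ : Θ) (_ : Space d) => (0 : ℝ)) :=
  ⟨0, 0, le_rfl, fun θ z => by simp⟩

lemma add (hF : GB α F) (hG : GB α G) : GB α (fun θ z => F θ z + G θ z) := by
  obtain ⟨C, N, hC, h⟩ := hF
  obtain ⟨C', N', hC', h'⟩ := hG
  refine ⟨C + C', N + N', by positivity, fun θ z => ?_⟩
  have := pn_nonneg z
  calc _ ≤ |F θ z| + |G θ z| := abs_add_le _ _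
    _ ≤ C * pn z ^ α * (1 + ‖z‖) ^ N + C' * pn z ^ α * (1 + ‖z‖) ^ N' := add_le_add (h θ z) (h' θ z)
    _ ≤ C * pn z ^ α * (1 + ‖z‖) ^ (N + N') + C' * pn z ^ α * (1 + ‖z‖) ^ (N + N') := by
      gcongr ?_ * ?_ + ?_ * ?_
      · exact UT.weight_mono z (by omega)
      · exact UT.weight_mono z (by omega)
    _ = _ := by ring

lemma mul (hF : GB α F) (hG : GB β G) (hα : 0 ≤ α) (hβ : 0 ≤ β) :
    GB (α + β) (fun θ z => F θ z * G θ z) := by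
  obtain ⟨C, N, hC, h⟩ := hF
  obtain ⟨C', N', hC', h'⟩ := hG
  refine ⟨C * C', N + N', by positivity, fun θ z => ?_⟩
  have := pn_nonneg z
  rw [abs_mul, Real.rpow_add_of_nonneg this hα hβ]
  calc _ ≤ (C * pn z ^ α * (1 + ‖z‖) ^ N) * (C' * pn z ^ β * (1 + ‖z‖) ^ N') :=
        mul_le_mul (h θ z) (h' θ z) (abs_nonneg _) (by positivity)
    _ = _ := by ring

lemma smul (hF : GB α F) (c : ℝ) : GB α (fun θ z => c * F θ z) := by
  obtain ⟨C, N, hC, h⟩ := hF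
  refine ⟨|c| * C, N, by positivity, fun θ z => ?_⟩
  rw [abs_mul, mul_assoc, mul_assoc, ← mul_assoc C]
  gcongr
  exact h θ z

lemma neg (hF : GB α F) : GB α (fun θ z => -F θ z) :=
  (hF.smul (-1)).congr fun θ z => by ring

lemma sub (hF : GB α F) (hG : GB α G) : GB α (fun θ z => F θ z - G θ z) :=
  (hF.add hG.neg).congr fun θ z => by ring

lemma sum {ι : Type*} (s : Finset ι) {F : ι → Θ → Space d → ℝ} (h : ∀ j ∈ s, GB α (F j)) :
    GB α (fun θ z => ∑ j ∈ s, F j θ z) := by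
  classical
  induction s using Finset.induction_on with
  | empty => simpa using zero
  | insert a s ha ih =>
    simp only [Finset.sum_insert ha]
    exact (h a (by simp)).add (ih fun j hj => h j (by simp [hj]))

/-- The surplus power of `pn z` is at most a power of `2 * (1 + ‖z‖)` and goes into the polynomial
weight, so no restriction to small `z` is needed. -/
lemma mono (hF : GB α F) (hβ : 0 ≤ β) (h : β ≤ α) : GB β F := by
  obtain ⟨C, N, hC, hb⟩ := hF
  refine ⟨C * 2 ^ ⌈α - β⌉₊, N + ⌈α - β⌉₊, by positivity, fun θ z => (hb θ z).trans ?_⟩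
  have h0 := pn_nonneg z
  have e : pn z ^ α ≤ pn z ^ β * (2 * (1 + ‖z‖)) ^ ⌈α - β⌉₊ := by
    rw [show α = β + (α - β) by ring, Real.rpow_add_of_nonneg h0 hβ (by linarith)]
    gcongr
    calc pn z ^ (α - β) ≤ (2 * (1 + ‖z‖)) ^ (α - β) :=
          Real.rpow_le_rpow h0 (pn_le z) (by linarith)
      _ ≤ (2 * (1 + ‖z‖)) ^ ((⌈α - β⌉₊ : ℕ) : ℝ) :=
          Real.rpow_le_rpow_of_exponent_le (by linarith [norm_nonneg z]) (Nat.le_ceil _)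
      _ = (2 * (1 + ‖z‖)) ^ ⌈β + (α - β) - β⌉₊ := by
          rw [Real.rpow_natCast]
          congr 2
          ring
  calc _ ≤ C * (pn z ^ β * (2 * (1 + ‖z‖)) ^ ⌈α - β⌉₊) * (1 + ‖z‖) ^ N := by gcongr
    _ = _ := by rw [mul_pow, pow_add]; ring

lemma coord (i : Fin (d + 1)) :
    GB (sdeg (Pi.single i 1 : MIdx d)) (fun (_ : Θ) (z : Space d) => z i) :=
  ⟨1, 0, zero_le_one, fun _ z => by simpa using abs_coord_le_pn z i⟩

end GB

lemma exists_segment_bound {f : Space d → ℝ} (hf : ContDiff ℝ ∞ f) (z : Space d) {C : ℝ}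
    (h : ∀ s : ℝ, 0 ≤ s → s ≤ 1 → |∑ i, z i * pd i f (s • z)| ≤ C) : |f z - f 0| ≤ C := by
  have key : ∀ s ∈ Set.Icc (0 : ℝ) 1, HasDerivWithinAt (fun s : ℝ => f (s • z))
      (fderiv ℝ f (s • z) z) (Set.Icc 0 1) s := by
    intro s _
    have h1 : HasFDerivAt f (fderiv ℝ f (s • z)) (s • z) := (diffAt hf _).hasFDerivAt
    have h2 : HasDerivAt (fun s : ℝ => s • z) z s := by
      simpa using (hasDerivAt_id s).smul_const z
    exact (h1.comp_hasDerivAt s h2).hasDerivWithinAt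
  have := norm_image_sub_le_of_norm_deriv_le_segment_01' key (C := C) fun s hs => by
    rw [fderiv_apply_eq_sum]
    exact h s hs.1 hs.2.le
  simpa using this

/-- Families vanishing at `0` to parabolic order `m`. -/
lemma GB_of_vanishing (m : ℕ) : ∀ {Θ : Type*} {F : Θ → Space d → ℝ}, UT F →
    (∀ θ k, sdeg k < m → mpd k (F θ) 0 = 0) → GB m F := by
  induction m using Nat.strong_induction_on with
  | _ m ih =>
  intro Θ F hF h0
  rcases Nat.eq_zero_or_pos m with rfl | hm
  · simpa using GB.of_UT hF
  -- The derivative `∂ᵢ F` vanishes to order `m - e`, with `e ∈ {1, 2}` the weight of the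
  -- coordinate, and the factor `zᵢ` restores the loss. The subtraction is truncated: for `m = 1`,
  -- `e = 2` one power of `pn z` is left over. This is the exponent `e + (m - e) - m`, which the
  -- weight absorbs.
  have h1 : ∀ i, ∃ (C : ℝ) (N : ℕ), 0 ≤ C ∧ ∀ θ z (s : ℝ), 0 ≤ s → s ≤ 1 →
      |z i * pd i (F θ) (s • z)| ≤ C * pn z ^ m * (1 + ‖z‖) ^ N := by
    intro i
    set e := sdeg (Pi.single i 1 : MIdx d) with he
    have hepos : 0 < e ∧ e ≤ 2 := by
      rw [he]
      refine Fin.cases ?_ (fun j => ?_) i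
      · rw [sdeg_single_zero]; omega
      · rw [sdeg_single_succ]; omega
    obtain ⟨C, N, hC, h⟩ := ih (m - e) (by omega) (hF.pd i) fun θ k hk => by
      rw [← mpd_add_single (hF.smooth θ)]
      apply h0
      rw [sdeg_add]
      omega
    refine ⟨C * 2 ^ (e + (m - e) - m), N + (e + (m - e) - m), by positivity,
      fun θ z s hs0 hs1 => ?_⟩
    have hp := pn_nonneg z
    rw [abs_mul]
    have hsz : ‖s • z‖ ≤ ‖z‖ := by
      rw [norm_smul, Real.norm_of_nonneg hs0]
      exact mul_le_of_le_one_left (norm_nonneg _) hs1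
    have e1 : |pd i (F θ) (s • z)| ≤ C * pn z ^ (m - e) * (1 + ‖z‖) ^ N := by
      refine (h θ (s • z)).trans ?_
      rw [Real.rpow_natCast]
      have := pn_nonneg (s • z)
      gcongr
      exact pn_smul_le hs0 hs1
    calc _ ≤ pn z ^ e * (C * pn z ^ (m - e) * (1 + ‖z‖) ^ N) :=
          mul_le_mul (abs_coord_le_pn z i) e1 (abs_nonneg _) (by positivity)
      _ = C * pn z ^ m * pn z ^ (e + (m - e) - m) * (1 + ‖z‖) ^ N := by
          have : pn z ^ e * pn z ^ (m - e) = pn z ^ m * pn z ^ (e + (m - e) - m) := by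
            rw [← pow_add, ← pow_add]
            congr 1
            omega
          linear_combination (C * (1 + ‖z‖) ^ N) * this
      _ ≤ C * pn z ^ m * (2 * (1 + ‖z‖)) ^ (e + (m - e) - m) * (1 + ‖z‖) ^ N := by
          gcongr
          exact pn_le z
      _ = _ := by rw [mul_pow, pow_add]; ring
  choose C N hC h using h1
  refine ⟨∑ i, C i, ∑ i, N i, Finset.sum_nonneg fun i _ => hC i, fun θ z => ?_⟩
  have hF0 : F θ 0 = 0 := by
    have := h0 θ 0 (by rw [sdeg_zero]; exact hm)
    rwa [mpd_zero] at this
  rw [← sub_zero (F θ z), ← hF0, Real.rpow_natCast]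
  apply exists_segment_bound (hF.smooth θ)
  intro s hs0 hs1
  refine (Finset.abs_sum_le_sum_abs _ _).trans ?_
  rw [Finset.sum_mul, Finset.sum_mul]
  refine Finset.sum_le_sum fun i _ => (h i θ z s hs0 hs1).trans ?_
  have hp := pn_nonneg z
  have := hC i
  gcongr
  · linarith [norm_nonneg z]
  · exact Finset.single_le_sum (f := N) (fun _ _ => Nat.zero_le _) (Finset.mem_univ i)

/-- The normalised monomials `zᵏ / k!`. -/
def nmon (k : MIdx d) (z : Space d) : ℝ := (midxFactorial k : ℝ)⁻¹ * monomialFun k z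

lemma midxFactorial_pos (k : MIdx d) : (0 : ℝ) < midxFactorial k := by
  unfold midxFactorial
  exact_mod_cast Finset.prod_pos fun i _ => Nat.factorial_pos _

lemma midxFactorial_add_single (k : MIdx d) (i : Fin (d + 1)) :
    midxFactorial (k + Pi.single i 1) = (k i + 1) * midxFactorial k := by
  unfold midxFactorial
  rw [← Finset.mul_prod_erase _ _ (Finset.mem_univ i),
    ← Finset.mul_prod_erase _ (fun j => (k j).factorial) (Finset.mem_univ i), ← mul_assoc]
  congr 1
  · simp [Nat.factorial_succ]
  · refine Finset.prod_congr rfl fun j hj => ?_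
    simp [(Finset.ne_of_mem_erase hj)]

lemma nmon_smooth (k : MIdx d) : ContDiff ℝ ∞ (nmon k : Space d → ℝ) :=
  contDiff_const.mul (monomialFun_temperate k).1

lemma pd_coord (i j : Fin (d + 1)) :
    pd i (fun z : Space d => z j) = fun _ => if j = i then 1 else 0 := by
  funext x
  have : fderiv ℝ (fun z : Space d => z j) x = (EuclideanSpace.proj j : Space d →L[ℝ] ℝ) :=
    (EuclideanSpace.proj j : Space d →L[ℝ] ℝ).fderiv
  simp [pd, this, unitVec_apply]

lemma pd_monomialFun (k : MIdx d) (i : Fin (d + 1)) (z : Space d) :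
    pd i (monomialFun k) z = k i * monomialFun (fun j => k j - (Pi.single i 1 : MIdx d) j) z := by
  induction k using midx_induction with
  | h0 =>
    have : (monomialFun 0 : Space d → ℝ) = fun _ => 1 := funext monomialFun_zero
    simp [this, pd]
  | h1 k j ih =>
    have e : (monomialFun (k + Pi.single j 1) : Space d → ℝ) =
        monomialFun k * fun z => z j := by
      funext z
      simp [monomialFun_add, monomialFun_single]
    rw [e, pd_mul (monomialFun_temperate k).1 (coord_temperate j).1, pd_coord]
    simp only [Pi.add_apply, Pi.mul_apply, ih]
    by_cases hij : j = i
    · subst hij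
      have e2 : (fun l => k l + (Pi.single j 1 : MIdx d) l - (Pi.single j 1 : MIdx d) l) = k := by
        funext l; simp
      rw [e2]
      rcases Nat.eq_zero_or_pos (k j) with h | h
      · simp [h]
      · have e3 : k = (fun l => k l - (Pi.single j 1 : MIdx d) l) + Pi.single j 1 := by
          funext l
          by_cases hl : l = j
          · subst hl; simp; omega
          · simp [hl]
        have : monomialFun k z = monomialFun (fun l => k l - (Pi.single j 1 : MIdx d) l) z * z j := by
          conv_lhs => rw [e3]
          rw [monomialFun_add, monomialFun_single]
        simp
        linear_combination (-(k j : ℝ)) * this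
    · rcases Nat.eq_zero_or_pos (k i) with h | h
      · simp [h, hij, Ne.symm hij]
      · have e3 : (fun l => k l + (Pi.single j 1 : MIdx d) l - (Pi.single i 1 : MIdx d) l) =
            (fun l => k l - (Pi.single i 1 : MIdx d) l) + Pi.single j 1 := by
          funext l
          by_cases hl : l = i
          · subst hl; simp [Ne.symm hij]
          · simp [hl]
        rw [e3, monomialFun_add, monomialFun_single]
        simp [hij, Ne.symm hij]
        ring

lemma mpd_nmon_zero (l k : MIdx d) : mpd l (nmon k) (0 : Space d) = if k = l then 1 else 0 := by
  induction l using midx_induction generalizing k with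
  | h0 =>
    rw [mpd_zero]
    by_cases h : k = 0
    · subst h; simp [nmon, monomialFun, midxFactorial]
    · obtain ⟨i, hi⟩ : ∃ i, k i ≠ 0 := by
        by_contra! h'
        exact h (funext h')
      have : monomialFun k (0 : Space d) = 0 := by
        unfold monomialFun
        exact Finset.prod_eq_zero (Finset.mem_univ i) (by simp [hi])
      simp [nmon, this, h]
  | h1 l i ih =>
    rw [mpd_add_single (nmon_smooth k)]
    by_cases hk : k i = 0
    · have : pd i (nmon k : Space d → ℝ) = 0 := by
        funext z
        have := pd_smul (monomialFun_temperate k).1 (midxFactorial k : ℝ)⁻¹ i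
        change pd i ((midxFactorial k : ℝ)⁻¹ • monomialFun k) z = 0
        rw [this]
        simp [pd_monomialFun, hk]
      rw [this, mpd_zero_fun, if_neg]
      · rfl
      · rintro rfl
        simp at hk
    · obtain ⟨k, rfl⟩ : ∃ k' : MIdx d, k = k' + Pi.single i 1 := by
        refine ⟨fun j => k j - (Pi.single i 1 : MIdx d) j, ?_⟩
        funext j
        by_cases hj : j = i
        · subst hj; simp; omega
        · simp [hj]
      have : pd i (nmon (k + Pi.single i 1) : Space d → ℝ) = nmon k := by
        funext z
        have := pd_smul (monomialFun_temperate (k + Pi.single i 1)).1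
          (midxFactorial (k + Pi.single i 1) : ℝ)⁻¹ i
        change pd i ((midxFactorial (k + Pi.single i 1) : ℝ)⁻¹ •
          monomialFun (k + Pi.single i 1)) z = _
        rw [this, midxFactorial_add_single, Pi.smul_apply, pd_monomialFun]
        have e : (fun j => (k + Pi.single i 1 : MIdx d) j - (Pi.single i 1 : MIdx d) j) = k := by
          funext l; simp
        rw [e]
        have h2 := (midxFactorial_pos k).ne'
        have h1 : ((k i : ℝ) + 1) ≠ 0 := by positivity
        simp [nmon]
        field_simp
      rw [this, ih]
      simp

/-- Taylor's formula with parabolic remainder. -/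
lemma GB_taylor {Θ : Type*} {F : Θ → Space d → ℝ} (hF : UT F) {γ : ℝ} (hγ : 0 < γ) :
    GB γ (fun θ z => F θ z - ∑ k ∈ lowDeg d γ, nmon k z * mpd k (F θ) 0) := by
  have hb : ∀ k, ∃ C : ℝ, ∀ θ, |mpd k (F θ) 0| ≤ C := fun k => by
    obtain ⟨C, N, h⟩ := hF.bound k
    exact ⟨C, fun θ => by simpa using h θ 0⟩
  have hn : ∀ k, UT (fun (_ : Θ) => (nmon k : Space d → ℝ)) := fun k =>
    (UT.monomial k).smul_const _
  have hU : UT (fun θ z => F θ z - ∑ k ∈ lowDeg d γ, nmon k z * mpd k (F θ) 0) := by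
    refine hF.sub (UT.sum _ fun k _ => ?_)
    obtain ⟨C, h⟩ := hb k
    exact (UT.const_mul h (hn k)).congr fun θ z => by ring
  -- Scaled degrees are integers, so the subtracted polynomial contains all degrees below `⌈γ⌉₊`,
  -- and the remainder vanishes to that order, which is at least `γ`.
  have := GB_of_vanishing ⌈γ⌉₊ hU fun θ l hl => by
    have hl' : l ∈ lowDeg d γ := mem_lowDeg.2 (Nat.lt_ceil.1 hl)
    have e : (fun z => F θ z - ∑ k ∈ lowDeg d γ, nmon k z * mpd k (F θ) 0) =
        F θ + ∑ k ∈ lowDeg d γ, (-mpd k (F θ) 0) • nmon k := by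
      funext z
      simp [sub_eq_add_neg, mul_comm]
    rw [e, mpd_add (hF.smooth θ), mpd_sum]
    · simp only [Pi.add_apply, Finset.sum_apply, mpd_smul (nmon_smooth _), Pi.smul_apply,
        mpd_nmon_zero, smul_eq_mul]
      rw [Finset.sum_eq_single_of_mem l hl' fun b _ hb => by simp [hb]]
      simp
    · exact fun k _ => contDiff_const.smul (nmon_smooth k)
    · have : ContDiff ℝ ∞ (fun x : Space d => ∑ k ∈ lowDeg d γ, (-mpd k (F θ) 0) • nmon k x) :=
        ContDiff.sum fun k _ => contDiff_const.mul (nmon_smooth k)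
      convert this using 1
      ext x
      simp
  exact this.mono hγ.le (Nat.le_ceil γ)

end Temperate

/-! ## Averages of translates -/

namespace Temperate

variable {d : ℕ}

/-- Smooth functions all of whose derivatives have polynomial growth. -/
abbrev TG (f : Space d → ℝ) : Prop := UT (fun _ : Unit => f)

lemma UT.tg {Θ : Type*} {F : Θ → Space d → ℝ} (hF : UT F) (θ : Θ) : TG (F θ) :=
  hF.comp_param fun _ => θ

lemma TG.smooth {f : Space d → ℝ} (hf : TG f) : ContDiff ℝ ∞ f := UT.smooth hf ()

lemma TG.continuous {f : Space d → ℝ} (hf : TG f) : Continuous f := hf.smooth.continuous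

lemma TG.translate {f : Space d → ℝ} (hf : TG f) (a : Space d) : TG (fun z => f (a + z)) :=
  UT.recentre hf (fun _ => a) (R := ‖a‖) fun _ => le_rfl

lemma weight_add_le (x y : Space d) (N : ℕ) :
    (1 + ‖x + y‖) ^ N ≤ (1 + ‖x‖) ^ N * (1 + ‖y‖) ^ N := by
  rw [← mul_pow]
  gcongr
  nlinarith [norm_add_le x y, norm_nonneg x, norm_nonneg y]

lemma integrable_weight_schwartz {F : Type*} [NormedAddCommGroup F] [NormedSpace ℝ F]
    (φ : 𝓢(Space d, F)) (N : ℕ) : Integrable (fun x : Space d => (1 + ‖x‖) ^ N * ‖φ x‖) := by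
  have : (fun x : Space d => (1 + ‖x‖) ^ N * ‖φ x‖) =
      fun x => ∑ m ∈ Finset.range (N + 1), (N.choose m : ℝ) * (‖x‖ ^ m * ‖φ x‖) := by
    funext x
    rw [add_comm, add_pow, Finset.sum_mul]
    refine Finset.sum_congr rfl fun m _ => ?_
    simp
    ring
  rw [this]
  exact integrable_finsetSum _ fun m _ => (φ.integrable_pow_mul volume m).const_mul _

/-- A weight `k` and a displacement `ρ` such that `k` is integrable against all powers of `ρ`. -/
structure IsAvg {Ω : Type*} [MeasurableSpace Ω] (μ : Measure Ω) (k : Ω → ℝ) (ρ : Ω → Space d) :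
    Prop where
  meas_k : Measurable k
  meas_ρ : Measurable ρ
  integrable : ∀ N : ℕ, Integrable (fun w => k w * (1 + ‖ρ w‖) ^ N) μ

/-- The function `x ↦ ∫ k(w) f(x + ρ(w)) dμ(w)`. -/
def avg {Ω : Type*} [MeasurableSpace Ω] (μ : Measure Ω) (k : Ω → ℝ) (ρ : Ω → Space d)
    (f : Space d → ℝ) (x : Space d) : ℝ := ∫ w, k w * f (x + ρ w) ∂μ

namespace IsAvg

variable {Ω : Type*} [MeasurableSpace Ω] {μ : Measure Ω} {k : Ω → ℝ} {ρ : Ω → Space d}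

lemma integrable_mul (h : IsAvg μ k ρ) {f : Space d → ℝ} (hf : Measurable f) {C : ℝ} {N : ℕ}
    (hb : ∀ z, |f z| ≤ C * (1 + ‖z‖) ^ N) (x : Space d) :
    Integrable (fun w => k w * f (x + ρ w)) μ := by
  refine ((h.integrable N).const_mul (C * (1 + ‖x‖) ^ N)).mono
    (h.meas_k.mul (hf.comp (measurable_const.add h.meas_ρ))).aestronglyMeasurable
    (Filter.Eventually.of_forall fun w => ?_)
  have hC : 0 ≤ C := by
    have := (abs_nonneg _).trans (hb 0)
    simpa using this
  rw [Real.norm_eq_abs, Real.norm_eq_abs, abs_mul, abs_mul (C * _), abs_mul (k w) (_ ^ N),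
    abs_of_nonneg (show 0 ≤ C * (1 + ‖x‖) ^ N by positivity),
    abs_of_nonneg (show 0 ≤ (1 + ‖ρ w‖) ^ N by positivity)]
  calc |k w| * |f (x + ρ w)| ≤ |k w| * (C * ((1 + ‖x‖) ^ N * (1 + ‖ρ w‖) ^ N)) := by
        gcongr
        refine (hb _).trans ?_
        gcongr
        exact weight_add_le _ _ _
    _ = _ := by ring

lemma abs_avg_le (h : IsAvg μ k ρ) {f : Space d → ℝ} {C : ℝ} {N : ℕ}
    (hb : ∀ z, |f z| ≤ C * (1 + ‖z‖) ^ N) (x : Space d) :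
    |avg μ k ρ f x| ≤ C * (∫ w, |k w| * (1 + ‖ρ w‖) ^ N ∂μ) * (1 + ‖x‖) ^ N := by
  have hC : 0 ≤ C := by
    have := (abs_nonneg _).trans (hb 0)
    simpa using this
  have hi : Integrable (fun w => |k w| * (1 + ‖ρ w‖) ^ N) μ := by
    refine (h.integrable N).norm.congr (Filter.Eventually.of_forall fun w => ?_)
    simp only [norm_mul, Real.norm_eq_abs]
    rw [abs_of_nonneg (show 0 ≤ (1 + ‖ρ w‖) ^ N by positivity)]
  rw [mul_right_comm, ← integral_const_mul, ← Real.norm_eq_abs]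
  refine norm_integral_le_of_norm_le (hi.const_mul _) (Filter.Eventually.of_forall fun w => ?_)
  rw [Real.norm_eq_abs, abs_mul]
  calc |k w| * |f (x + ρ w)| ≤ |k w| * (C * ((1 + ‖x‖) ^ N * (1 + ‖ρ w‖) ^ N)) := by
        gcongr
        refine (hb _).trans ?_
        gcongr
        exact weight_add_le _ _ _
    _ = _ := by ring

lemma integrable_TG (h : IsAvg μ k ρ) {f : Space d → ℝ} (hf : TG f) (x : Space d) :
    Integrable (fun w => k w * f (x + ρ w)) μ := by
  obtain ⟨C, N, _, hb⟩ := UT.bound_zero hf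
  exact h.integrable_mul hf.continuous.measurable (fun z => hb () z) x

lemma norm_fderiv_le (f : Space d → ℝ) (x : Space d) :
    ‖fderiv ℝ f x‖ ≤ ∑ i, |pd i f x| := by
  refine ContinuousLinearMap.opNorm_le_bound _ (Finset.sum_nonneg fun _ _ => abs_nonneg _)
    fun z => ?_
  rw [fderiv_apply_eq_sum, Finset.sum_mul]
  refine (norm_sum_le _ _).trans (Finset.sum_le_sum fun i _ => ?_)
  rw [norm_mul, mul_comm]
  exact mul_le_mul_of_nonneg_left (abs_coord_le z i) (norm_nonneg _)

lemma exists_fderiv_bound {f : Space d → ℝ} (hf : TG f) :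
    ∃ (C : ℝ) (N : ℕ), 0 ≤ C ∧ ∀ z, ‖fderiv ℝ f z‖ ≤ C * (1 + ‖z‖) ^ N := by
  have h : ∀ i, ∃ (C : ℝ) (N : ℕ), 0 ≤ C ∧ ∀ z, |pd i f z| ≤ C * (1 + ‖z‖) ^ N := fun i => by
    obtain ⟨C, N, hC, h⟩ := (UT.pd hf i).bound_zero
    exact ⟨C, N, hC, h ()⟩
  choose C N hC h using h
  refine ⟨∑ i, C i, ∑ i, N i, Finset.sum_nonneg fun i _ => hC i, fun z => ?_⟩
  refine (norm_fderiv_le f z).trans ?_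
  rw [Finset.sum_mul]
  refine Finset.sum_le_sum fun i _ => (h i z).trans ?_
  gcongr
  · exact hC i
  · linarith [norm_nonneg z]
  · exact Finset.single_le_sum (f := N) (fun _ _ => Nat.zero_le _) (Finset.mem_univ i)

lemma hasFDerivAt_avg (h : IsAvg μ k ρ) {f : Space d → ℝ} (hf : TG f) (x : Space d) :
    HasFDerivAt (avg μ k ρ f) (∫ w, k w • fderiv ℝ f (x + ρ w) ∂μ) x := by
  obtain ⟨C, N, hC, hb⟩ := exists_fderiv_bound hf
  have hcf : Continuous (fderiv ℝ f) := hf.smooth.continuous_fderiv (by simp)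
  refine hasFDerivAt_integral_of_dominated_of_fderiv_le (F := fun y w => k w * f (y + ρ w))
    (F' := fun y w => k w • fderiv ℝ f (y + ρ w))
    (bound := fun w => |C * (1 + (‖x‖ + 1)) ^ N| * ‖k w * (1 + ‖ρ w‖) ^ N‖)
    (Metric.ball_mem_nhds x zero_lt_one) ?_ (h.integrable_TG hf x) ?_ ?_ ?_ ?_
  · exact Filter.Eventually.of_forall fun y => (h.integrable_TG hf y).aestronglyMeasurable
  · exact (h.meas_k.smul (hcf.measurable.comp
      (measurable_const.add h.meas_ρ))).aestronglyMeasurable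
  · refine Filter.Eventually.of_forall fun w y hy => ?_
    have hy' : ‖y‖ ≤ ‖x‖ + 1 := by
      have : ‖y - x‖ < 1 := by simpa [dist_eq_norm] using hy
      have := norm_le_norm_add_norm_sub' y x
      linarith
    rw [norm_smul, norm_mul, Real.norm_eq_abs, abs_of_nonneg
      (show 0 ≤ C * (1 + (‖x‖ + 1)) ^ N by positivity), Real.norm_of_nonneg
      (show 0 ≤ (1 + ‖ρ w‖) ^ N by positivity)]
    calc |k w| * ‖fderiv ℝ f (y + ρ w)‖ ≤ |k w| * (C * ((1 + ‖y‖) ^ N * (1 + ‖ρ w‖) ^ N)) := by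
          gcongr
          refine (hb _).trans ?_
          gcongr
          exact weight_add_le _ _ _
      _ ≤ |k w| * (C * ((1 + (‖x‖ + 1)) ^ N * (1 + ‖ρ w‖) ^ N)) := by gcongr
      _ = _ := by ring
  · exact (h.integrable N).norm.const_mul _
  · refine Filter.Eventually.of_forall fun w y _ => ?_
    have h1 : HasFDerivAt f (fderiv ℝ f (y + ρ w)) (y + ρ w) := (diffAt hf.smooth _).hasFDerivAt
    exact ((hasFDerivAt_comp_add_right (ρ w)).2 h1).const_mul (k w)

lemma fderiv_integrable (h : IsAvg μ k ρ) {f : Space d → ℝ} (hf : TG f) (x : Space d) :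
    Integrable (fun w => k w • fderiv ℝ f (x + ρ w)) μ := by
  obtain ⟨C, N, hC, hb⟩ := exists_fderiv_bound hf
  have hcf : Continuous (fderiv ℝ f) := hf.smooth.continuous_fderiv (by simp)
  refine ((h.integrable N).const_mul (C * (1 + ‖x‖) ^ N)).mono
    (h.meas_k.smul (hcf.measurable.comp (measurable_const.add h.meas_ρ))).aestronglyMeasurable
    (Filter.Eventually.of_forall fun w => ?_)
  rw [norm_smul, norm_mul (C * _), norm_mul (k w), Real.norm_of_nonneg (show 0 ≤ C * (1 + ‖x‖) ^ N by positivity),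
    Real.norm_of_nonneg (show 0 ≤ (1 + ‖ρ w‖) ^ N by positivity)]
  calc ‖k w‖ * ‖fderiv ℝ f (x + ρ w)‖ ≤ ‖k w‖ * (C * ((1 + ‖x‖) ^ N * (1 + ‖ρ w‖) ^ N)) := by
        gcongr
        refine (hb _).trans ?_
        gcongr
        exact weight_add_le _ _ _
    _ = _ := by ring

lemma pd_avg (h : IsAvg μ k ρ) {f : Space d → ℝ} (hf : TG f) (i : Fin (d + 1)) :
    pd i (avg μ k ρ f) = avg μ k ρ (pd i f) := by
  funext x
  simp only [pd, avg]
  rw [(h.hasFDerivAt_avg hf x).fderiv, ContinuousLinearMap.integral_apply (h.fderiv_integrable hf x)]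
  simp

/-- The differential of an average is a finite combination, with constant vectors, of averages of
first partial derivatives, which are temperate again; so the order of differentiability can be
raised step by step. -/
lemma contDiff_avg (h : IsAvg μ k ρ) {f : Space d → ℝ} (hf : TG f) :
    ContDiff ℝ ∞ (avg μ k ρ f) := by
  rw [contDiff_infty]
  intro n
  induction n generalizing f with
  | zero =>
    have : Differentiable ℝ (avg μ k ρ f) := fun x => (h.hasFDerivAt_avg hf x).differentiableAt
    simpa using this.continuous
  | succ n ih =>
    have hd : Differentiable ℝ (avg μ k ρ f) := fun x => (h.hasFDerivAt_avg hf x).differentiableAt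
    have e : fderiv ℝ (avg μ k ρ f) = fun x => ∑ i, avg μ k ρ (pd i f) x •
        (EuclideanSpace.proj i : Space d →L[ℝ] ℝ) := by
      funext x
      ext z
      rw [fderiv_apply_eq_sum]
      simp [h.pd_avg hf, mul_comm]
    rw [Nat.cast_add, Nat.cast_one, contDiff_succ_iff_fderiv]
    refine ⟨hd, by simp, ?_⟩
    rw [e]
    exact ContDiff.sum fun i _ => (ih (UT.pd hf i)).smul contDiff_const

lemma mpd_avg (h : IsAvg μ k ρ) {f : Space d → ℝ} (hf : TG f) (l : MIdx d) :
    mpd l (avg μ k ρ f) = avg μ k ρ (mpd l f) := by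
  induction l using midx_induction generalizing f with
  | h0 => simp [mpd_zero]
  | h1 l i ih =>
    rw [mpd_add_single (h.contDiff_avg hf), mpd_add_single hf.smooth, h.pd_avg hf,
      ih (UT.pd hf i)]

/-- All derivatives fall on `F`, and the moments of the average control the growth. Nothing beyond
these moments is asked of the kernel. -/
lemma ut_avg (h : IsAvg μ k ρ) {Θ : Type*} {F : Θ → Space d → ℝ} (hF : UT F) :
    UT (fun θ => avg μ k ρ (F θ)) where
  smooth θ := h.contDiff_avg (hF.tg θ)
  bound l := by
    obtain ⟨C, N, hb⟩ := hF.bound l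
    refine ⟨C * (∫ w, |k w| * (1 + ‖ρ w‖) ^ N ∂μ), N, fun θ z => ?_⟩
    rw [h.mpd_avg (hF.tg θ)]
    exact h.abs_avg_le (hb θ) z

lemma avg_translate (f : Space d → ℝ) (a : Space d) :
    avg μ k ρ (fun z => f (a + z)) = fun z => avg μ k ρ f (a + z) := by
  funext x
  simp [avg, add_assoc]

lemma avg_sum (h : IsAvg μ k ρ) {ι : Type*} (s : Finset ι) (a : ι → ℝ) {f : ι → Space d → ℝ}
    (hf : ∀ j ∈ s, TG (f j)) (x : Space d) :
    avg μ k ρ (fun z => ∑ j ∈ s, a j * f j z) x = ∑ j ∈ s, a j * avg μ k ρ (f j) x := by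
  simp only [avg]
  simp_rw [← integral_const_mul]
  rw [← integral_finsetSum]
  · congr 1
    funext w
    rw [Finset.mul_sum]
    exact Finset.sum_congr rfl fun j _ => by ring
  · exact fun j hj => (h.integrable_TG (hf j hj) x).const_mul _

lemma integrable_avg_prod (h : IsAvg μ k ρ) [SFinite μ] {f : Space d → ℝ} (hf : TG f)
    (φ : 𝓢(Space d, ℝ)) :
    Integrable (Function.uncurry fun (x : Space d) (w : Ω) => k w * f (x + ρ w) * φ x)
      (volume.prod μ) := by
  obtain ⟨C, N, hC, hb⟩ := UT.bound_zero hf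
  have hφ := integrable_weight_schwartz φ N
  refine ((hφ.mul_prod (h.integrable N)).const_mul C).mono ?_
    (Filter.Eventually.of_forall fun p => ?_)
  · refine Measurable.aestronglyMeasurable ?_
    exact ((h.meas_k.comp measurable_snd).mul (hf.continuous.measurable.comp
      (measurable_fst.add (h.meas_ρ.comp measurable_snd)))).mul
        (φ.continuous.measurable.comp measurable_fst)
  · obtain ⟨x, w⟩ := p
    simp only [Function.uncurry, norm_mul, norm_norm, norm_pow, Real.norm_of_nonneg hC]
    rw [Real.norm_of_nonneg (show 0 ≤ 1 + ‖x‖ by positivity),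
      Real.norm_of_nonneg (show 0 ≤ 1 + ‖ρ w‖ by positivity)]
    calc ‖k w‖ * ‖f (x + ρ w)‖ * ‖φ x‖ ≤
          ‖k w‖ * (C * ((1 + ‖x‖) ^ N * (1 + ‖ρ w‖) ^ N)) * ‖φ x‖ := by
          gcongr
          refine (hb () _).trans ?_
          gcongr
          exact weight_add_le _ _ _
      _ = _ := by ring

lemma integral_mul_mul (f : Space d → ℝ) (φ : Space d → ℝ) (w : Ω) :
    ∫ x, k w * f (x + ρ w) * φ x = k w * ∫ x, f (x + ρ w) * φ x := by
  rw [← integral_const_mul]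
  congr 1
  funext x
  ring

lemma integrable_avg_mul (h : IsAvg μ k ρ) [SFinite μ] {f : Space d → ℝ} (hf : TG f)
    (φ : 𝓢(Space d, ℝ)) : Integrable (fun w => k w * ∫ x, f (x + ρ w) * φ x) μ := by
  refine (h.integrable_avg_prod hf φ).integral_prod_right.congr
    (Filter.Eventually.of_forall fun w => ?_)
  exact integral_mul_mul f φ w

/-- The transpose of an average. -/
lemma integral_avg_mul (h : IsAvg μ k ρ) [SFinite μ] {f : Space d → ℝ} (hf : TG f)
    (φ : 𝓢(Space d, ℝ)) :
    ∫ x, avg μ k ρ f x * φ x = ∫ w, k w * (∫ x, f (x + ρ w) * φ x) ∂μ := by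
  calc ∫ x, avg μ k ρ f x * φ x = ∫ x, ∫ w, k w * f (x + ρ w) * φ x ∂μ := by
        congr 1
        funext x
        rw [avg, integral_mul_const]
    _ = ∫ w, (∫ x, k w * f (x + ρ w) * φ x) ∂μ :=
        integral_integral_swap (h.integrable_avg_prod hf φ)
    _ = _ := by
        congr 1
        funext w
        exact integral_mul_mul f φ w

end IsAvg

end Temperate

/-! ## The heat kernel and parabolic scaling -/

namespace Temperate

variable {d : ℕ}

lemma space_inner (x y : Space d) : inner ℝ x y = ∑ i, x i * y i := by
  simp [PiLp.inner_apply, mul_comm]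

/-- The parabolic dilation `(c² v₀, c v')`. -/
def dil (c : ℝ) : Space d →ₗ[ℝ] Space d where
  toFun v := WithLp.toLp 2 fun i => c ^ sdeg (Pi.single i 1 : MIdx d) * v i
  map_add' v w := by ext i; simp [mul_add]
  map_smul' a v := by ext i; simp; ring

lemma dil_apply (c : ℝ) (v : Space d) (i : Fin (d + 1)) :
    dil c v i = c ^ sdeg (Pi.single i 1 : MIdx d) * v i := rfl

lemma inner_dil (c : ℝ) (v w : Space d) : inner ℝ v (dil c w) = inner ℝ (dil c v) w := by
  simp [space_inner, dil_apply]
  exact Finset.sum_congr rfl fun i _ => by ring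

lemma spaceNormSq_dil (c : ℝ) (v : Space d) : spaceNormSq (dil c v) = c ^ 2 * spaceNormSq v := by
  simp [spaceNormSq, dil_apply, sdeg_single_succ, Finset.mul_sum, mul_pow]

lemma pn_dil {c : ℝ} (hc : 0 ≤ c) (v : Space d) : pn (dil c v) = c * pn v := by
  unfold pn
  rw [spaceNormSq_dil, Real.sqrt_mul (sq_nonneg c), Real.sqrt_sq hc, dil_apply, sdeg_single_zero,
    abs_mul, abs_of_nonneg (sq_nonneg c), Real.sqrt_mul (sq_nonneg c), Real.sqrt_sq hc]
  ring

lemma norm_dil_le {c : ℝ} (hc : 0 ≤ c) (h1 : c ≤ 1) (v : Space d) : ‖dil c v‖ ≤ ‖v‖ := by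
  rw [EuclideanSpace.norm_eq, EuclideanSpace.norm_eq]
  refine Real.sqrt_le_sqrt (Finset.sum_le_sum fun i _ => ?_)
  rw [dil_apply, norm_mul, mul_pow]
  refine mul_le_of_le_one_left (sq_nonneg _) (pow_le_one₀ (norm_nonneg _) ?_)
  rw [Real.norm_of_nonneg (by positivity)]
  exact pow_le_one₀ hc h1

lemma norm_dil_le_mul {c : ℝ} (hc : 0 ≤ c) (h1 : c ≤ 1) (v : Space d) : ‖dil c v‖ ≤ c * ‖v‖ := by
  have : dil c v = c • WithLp.toLp 2 fun i => c ^ (sdeg (Pi.single i 1 : MIdx d) - 1) * v i := by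
    ext i
    simp only [dil_apply, PiLp.smul_apply, smul_eq_mul]
    rw [← mul_assoc, ← pow_succ']
    congr 2
    refine Fin.cases ?_ (fun j => ?_) i
    · rw [sdeg_single_zero]
    · rw [sdeg_single_succ]
  rw [this, norm_smul, Real.norm_of_nonneg hc]
  gcongr
  rw [EuclideanSpace.norm_eq, EuclideanSpace.norm_eq]
  refine Real.sqrt_le_sqrt (Finset.sum_le_sum fun i _ => ?_)
  rw [norm_mul, mul_pow]
  refine mul_le_of_le_one_left (sq_nonneg _) (pow_le_one₀ (norm_nonneg _) ?_)
  rw [Real.norm_of_nonneg (by positivity)]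
  exact pow_le_one₀ hc h1

lemma dil_dil_inv {c : ℝ} (hc : c ≠ 0) (v : Space d) : dil c (dil c⁻¹ v) = v := by
  ext i
  simp only [dil_apply]
  rw [← mul_assoc, ← mul_pow, mul_inv_cancel₀ hc, one_pow, one_mul]

lemma det_dil_ne_zero {c : ℝ} (hc : c ≠ 0) : LinearMap.det (dil c : Space d →ₗ[ℝ] Space d) ≠ 0 := by
  have : (dil c : Space d →ₗ[ℝ] Space d) ∘ₗ dil c⁻¹ = LinearMap.id :=
    LinearMap.ext fun v => dil_dil_inv hc v
  have h2 := congrArg LinearMap.det this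
  rw [LinearMap.det_comp, LinearMap.det_id] at h2
  exact left_ne_zero_of_mul (h2.trans_ne one_ne_zero)

lemma continuous_dil (c : ℝ) : Continuous (dil c : Space d → Space d) :=
  LinearMap.continuous_of_finiteDimensional _

lemma injective_dil {c : ℝ} (hc : c ≠ 0) : Function.Injective (dil c : Space d → Space d) :=
  Function.LeftInverse.injective (g := dil c⁻¹) fun v => by
    simpa using dil_dil_inv (inv_ne_zero hc) v

lemma integral_dil {E : Type*} [NormedAddCommGroup E] [NormedSpace ℝ E] {c : ℝ} (hc : c ≠ 0)
    (f : Space d → E) :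
    |LinearMap.det (dil c : Space d →ₗ[ℝ] Space d)| • ∫ v, f (dil c v) = ∫ v, f v := by
  have h := Measure.map_linearMap_addHaar_eq_smul_addHaar (volume : Measure (Space d))
    (det_dil_ne_zero (d := d) hc)
  have hm : MeasurableEmbedding (dil c : Space d → Space d) :=
    (LinearMap.isClosedEmbedding_of_injective
      (LinearMap.ker_eq_bot.2 (injective_dil hc))).measurableEmbedding
  have h2 := hm.integral_map (μ := volume) f
  rw [h, integral_smul_measure] at h2
  rw [← h2, smul_smul, ENNReal.toReal_ofReal (abs_nonneg _), abs_inv, mul_inv_cancel₀, one_smul]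
  exact abs_ne_zero.2 (det_dil_ne_zero hc)

lemma ellSymbol_zero_dil (c : ℝ) (ξ : Space d) : ellSymbol 0 (dil c ξ) = c ^ 4 * ellSymbol 0 ξ := by
  unfold ellSymbol
  rw [spaceNormSq_dil, dil_apply, sdeg_single_zero]
  ring

lemma ellSymbol_neg (m : ℝ) (ξ : Space d) : ellSymbol m (-ξ) = ellSymbol m ξ := by
  simp [ellSymbol, spaceNormSq]

/-- The kernel `p_t`, as a complex function. -/
def heatC (d : ℕ) (t : ℝ) (ht : 0 < t) : 𝓢(Space d, ℂ) :=
  𝓕⁻ (realToComplex d (heatSymbol d t ht))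

lemma heatC_apply {t : ℝ} (ht : 0 < t) (v : Space d) :
    heatC d t ht v = ∫ ξ, Complex.exp ((2 * Real.pi * inner ℝ ξ v : ℝ) * Complex.I) *
      (Real.exp (-(t * ellSymbol 0 ξ)) : ℝ) := by
  unfold heatC
  rw [SchwartzMap.fourierInv_coe, Real.fourierInv_eq']
  rfl

/-- The symbol is real and even, so the kernel is real, and the real part in the definition of the
heat kernel loses nothing. -/
lemma heatC_conj {t : ℝ} (ht : 0 < t) (v : Space d) :
    (starRingEnd ℂ) (heatC d t ht v) = heatC d t ht v := by
  rw [heatC_apply, ← integral_conj, ← integral_neg_eq_self]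
  congr 1
  funext ξ
  rw [map_mul, ← Complex.exp_conj, Complex.conj_ofReal, map_mul, Complex.conj_ofReal,
    Complex.conj_I, ellSymbol_neg, inner_neg_left]
  congr 2
  push_cast
  ring

/-- The kernel `p_1`. -/
def pker (d : ℕ) : 𝓢(Space d, ℝ) := complexToReal d (heatC d 1 one_pos)

lemma ofReal_re_heatC {t : ℝ} (ht : 0 < t) (v : Space d) :
    (((heatC d t ht v).re : ℝ) : ℂ) = heatC d t ht v :=
  Complex.conj_eq_iff_re.1 (heatC_conj ht v)

lemma pker_apply (v : Space d) : pker d v = (heatC d 1 one_pos v).re := rfl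

lemma integral_exp_pker (ξ : Space d) :
    ∫ v, Complex.exp ((2 * Real.pi * inner ℝ ξ v : ℝ) * Complex.I) * (pker d v : ℂ) =
      (Real.exp (-ellSymbol 0 ξ) : ℝ) := by
  have h : 𝓕 (heatC d 1 one_pos) = realToComplex d (heatSymbol d 1 one_pos) :=
    FourierTransform.fourier_fourierInv_eq _
  have h2 : 𝓕 (heatC d 1 one_pos : Space d → ℂ) (-ξ) =
      (Real.exp (-(1 * ellSymbol 0 (-ξ))) : ℝ) := by
    rw [← SchwartzMap.fourier_coe, h]
    rfl
  rw [Real.fourier_eq', ellSymbol_neg, one_mul] at h2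
  rw [← h2]
  congr 1
  funext v
  rw [pker_apply, ofReal_re_heatC, smul_eq_mul, inner_neg_right, real_inner_comm]
  congr 2
  push_cast
  ring

lemma integral_pker : ∫ v, pker d v = 1 := by
  have := integral_exp_pker (0 : Space d)
  simp only [inner_zero_left, mul_zero, Complex.ofReal_zero, zero_mul, Complex.exp_zero,
    one_mul, integral_complex_ofReal] at this
  have h0 : ellSymbol 0 (0 : Space d) = 0 := by simp [ellSymbol, spaceNormSq]
  rw [h0, neg_zero, Real.exp_zero] at this
  exact_mod_cast this

lemma heatKernel_apply {t : ℝ} (ht : 0 < t) (x y : Space d) :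
    heatKernel t ht x y = (heatC d t ht (y - x)).re := rfl

/-- `ellSymbol 0` is homogeneous of degree four under parabolic dilations, so `p_t` is `p_1`
rescaled by `t^{1/4}`. This is the origin of the exponent `|σ|/4` in the bounds of a model. -/
lemma heatC_dil {c t : ℝ} (hc : 0 < c) (hct : c ^ 4 = t) (ht : 0 < t) (v : Space d) :
    |LinearMap.det (dil c : Space d →ₗ[ℝ] Space d)| * (heatC d t ht (dil c v)).re = pker d v := by
  have key := integral_dil (d := d) hc.ne' (fun ξ : Space d =>
    Complex.exp ((2 * Real.pi * inner ℝ ξ v : ℝ) * Complex.I) *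
      (Real.exp (-(1 * ellSymbol 0 ξ)) : ℝ))
  rw [← heatC_apply one_pos] at key
  rw [pker_apply, ← key, heatC_apply, Complex.real_smul, Complex.re_ofReal_mul]
  congr 2
  congr 1
  funext ξ
  rw [inner_dil, ellSymbol_zero_dil, hct, one_mul]

/-- Integration against `p_t(x, ·)` is an average at the parabolic scale `c = t^{1/4}`. -/
lemma integral_heatKernel {c t : ℝ} (hc : 0 < c) (hct : c ^ 4 = t) (ht : 0 < t) (x : Space d)
    (u : Space d → ℝ) :
    ∫ y, u y * heatKernel t ht x y = avg volume (pker d) (dil c) u x := by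
  simp_rw [heatKernel_apply]
  rw [← integral_add_left_eq_self _ x]
  simp only [add_sub_cancel_left]
  rw [← integral_dil hc.ne', avg, smul_eq_mul, ← integral_const_mul]
  congr 1
  funext v
  rw [← heatC_dil hc hct ht]
  ring

end Temperate

/-! ## The operator `K` on functions -/

namespace Temperate

open ProbabilityTheory

variable {d : ℕ}

/-- The projection onto the space coordinates. -/
def sp : Space d →ₗ[ℝ] Space d where
  toFun v := WithLp.toLp 2 fun i => if i = 0 then 0 else v i
  map_add' v w := by ext i; by_cases h : i = 0 <;> simp [h]
  map_smul' a v := by ext i; by_cases h : i = 0 <;> simp [h]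

lemma sp_apply (v : Space d) (i : Fin (d + 1)) : sp v i = if i = 0 then 0 else v i := rfl

lemma norm_sq_sp (v : Space d) : ‖sp v‖ ^ 2 = spaceNormSq v := by
  rw [norm_sq_eq]
  simp [sp_apply, spaceNormSq, Fin.succ_ne_zero]

lemma norm_sp_le (v : Space d) : ‖sp v‖ ≤ ‖v‖ := by
  refine abs_le_of_sq_le_sq' ?_ (norm_nonneg v) |>.2
  rw [norm_sq_sp, norm_sq_eq]
  nlinarith [sq_nonneg (v 0)]

lemma inner_sp (v w : Space d) : inner ℝ v (sp w) = inner ℝ (sp v) w := by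
  simp only [space_inner, sp_apply]
  exact Finset.sum_congr rfl fun i _ => by split_ifs <;> simp

lemma continuous_sp : Continuous (sp : Space d → Space d) :=
  LinearMap.continuous_of_finiteDimensional _

/-- The displacement `δ_r v + 2 √r u'`, in terms of `c = r^{1/4}`. -/
def disp (c : ℝ) (p : Space d × Space d) : Space d := dil c p.1 + (2 * c ^ 2) • sp p.2

lemma norm_disp_le {c : ℝ} (hc : 0 ≤ c) (h1 : c ≤ 1) (p : Space d × Space d) :
    1 + ‖disp c p‖ ≤ (1 + ‖p.1‖) * (2 * (1 + ‖p.2‖)) := by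
  have h2 : ‖(2 * c ^ 2) • sp p.2‖ ≤ 2 * ‖p.2‖ := by
    rw [norm_smul, Real.norm_of_nonneg (by positivity)]
    have : c ^ 2 ≤ 1 := pow_le_one₀ hc h1
    have := norm_sp_le p.2
    gcongr
    linarith
  have := norm_add_le (dil c p.1) ((2 * c ^ 2) • sp p.2)
  have h3 := norm_dil_le hc h1 p.1
  unfold disp
  nlinarith [norm_nonneg p.1, norm_nonneg p.2]

/-- The measure `dv dγ(u)`, with `γ` the standard Gaussian. -/
def baseMeasure (d : ℕ) : Measure (Space d × Space d) := volume.prod (stdGaussian (Space d))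

instance : SFinite (baseMeasure d) := by unfold baseMeasure; infer_instance

lemma integrable_weight_gaussian (N : ℕ) :
    Integrable (fun u : Space d => (1 + ‖u‖) ^ N) (stdGaussian (Space d)) := by
  have h : ∀ m : ℕ, Integrable (fun u : Space d => ‖u‖ ^ m) (stdGaussian (Space d)) := fun m => by
    rcases Nat.eq_zero_or_pos m with rfl | hm
    · simp
    · have := (IsGaussian.memLp_id (stdGaussian (Space d)) m (by simp)).integrable_norm_pow hm.ne'
      simpa using this
  have : (fun u : Space d => (1 + ‖u‖) ^ N) =
      fun u => ∑ m ∈ Finset.range (N + 1), (N.choose m : ℝ) * ‖u‖ ^ m := by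
    funext x
    rw [add_comm, add_pow]
    refine Finset.sum_congr rfl fun m _ => ?_
    simp
    ring
  rw [this]
  exact integrable_finsetSum _ fun m _ => (h m).const_mul _

lemma integrable_base_weight (N : ℕ) : Integrable (fun p : Space d × Space d =>
    ((1 + ‖p.1‖) ^ N * ‖pker d p.1‖) * ((2 ^ N) * (1 + ‖p.2‖) ^ N)) (baseMeasure d) :=
  (integrable_weight_schwartz (pker d) N).mul_prod ((integrable_weight_gaussian N).const_mul _)

lemma norm_disp_weight_le {c : ℝ} (hc : 0 ≤ c) (h1 : c ≤ 1) (N : ℕ) (p : Space d × Space d) :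
    (1 + ‖disp c p‖) ^ N ≤ (1 + ‖p.1‖) ^ N * ((2 ^ N) * (1 + ‖p.2‖) ^ N) := by
  rw [← mul_pow, ← mul_pow]
  have := norm_disp_le hc h1 p
  gcongr

lemma continuous_disp : Continuous (fun q : ℝ × (Space d × Space d) => disp q.1 q.2) := by
  unfold disp
  refine Continuous.add ?_ ?_
  · have : (fun q : ℝ × (Space d × Space d) => dil q.1 q.2.1) =
        fun q => WithLp.toLp 2 fun i => q.1 ^ sdeg (Pi.single i 1 : MIdx d) * q.2.1 i := rfl
    rw [this]
    fun_prop
  · exact (by fun_prop : Continuous fun q : ℝ × (Space d × Space d) => 2 * q.1 ^ 2).smul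
      (continuous_sp.comp (by fun_prop))

/-- The weight `e^{-r} p_1(v)`. -/
def wt (r : ℝ) (p : Space d × Space d) : ℝ := Real.exp (-r) * pker d p.1

/-- Expanding `(Δ' - 1)²` gives `e^{r(∂₀² - (Δ' - 1)²)} = e^{-r} e^{rG} e^{2rΔ'}` with `G = ∂₀² -
Δ'²`. With `c = r^{1/4}`, the factor `e^{rG}` averages over `δ_c v` with weight `p_1(v)`, and
`e^{2rΔ'}` over the Gaussian displacement `2 √r u'`. Both have moments of all orders. The base
measure does not depend on `r`, so integrating over `r` gives an average of the same kind. -/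
lemma isAvg_disp {r c : ℝ} (hc : 0 ≤ c) (h1 : c ≤ 1) :
    IsAvg (baseMeasure d) (wt r) (disp c) where
  meas_k := (((pker d).continuous.comp continuous_fst).const_mul _).measurable
  meas_ρ := (continuous_disp.comp (by fun_prop : Continuous fun p : Space d × Space d =>
    (c, p))).measurable
  integrable N := by
    have hcont : Continuous (fun p : Space d × Space d => disp c p) :=
      continuous_disp.comp (by fun_prop : Continuous fun p : Space d × Space d => (c, p))
    refine ((integrable_base_weight N).const_mul (Real.exp (-r))).mono ?_
      (Filter.Eventually.of_forall fun p => ?_)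
    · exact (Continuous.mul (((pker d).continuous.comp continuous_fst).const_mul _)
        ((continuous_const.add hcont.norm).pow N)).aestronglyMeasurable
    · rw [wt, norm_mul, norm_mul, Real.norm_of_nonneg (Real.exp_nonneg _),
        Real.norm_of_nonneg (show 0 ≤ (1 + ‖disp c p‖) ^ N by positivity), norm_mul,
        Real.norm_of_nonneg (Real.exp_nonneg _),
        Real.norm_of_nonneg (show 0 ≤ (1 + ‖p.1‖) ^ N * ‖pker d p.1‖ *
          (2 ^ N * (1 + ‖p.2‖) ^ N) by positivity)]
      calc _ ≤ Real.exp (-r) * ‖pker d p.1‖ *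
            ((1 + ‖p.1‖) ^ N * ((2 ^ N) * (1 + ‖p.2‖) ^ N)) := by
            gcongr
            exact norm_disp_weight_le hc h1 N p
        _ = _ := by ring

/-- The fourth root. -/
def root4 (r : ℝ) : ℝ := r ^ (1 / 4 : ℝ)

lemma continuous_root4 : Continuous root4 :=
  continuous_id.rpow_const fun _ => Or.inr (by norm_num)

lemma root4_nonneg {r : ℝ} (hr : 0 ≤ r) : 0 ≤ root4 r := Real.rpow_nonneg hr _

lemma root4_pos {r : ℝ} (hr : 0 < r) : 0 < root4 r := Real.rpow_pos_of_pos hr _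

lemma root4_le_one {r : ℝ} (hr : 0 ≤ r) (h1 : r ≤ 1) : root4 r ≤ 1 :=
  Real.rpow_le_one hr h1 (by norm_num)

lemma root4_pow {r : ℝ} (hr : 0 ≤ r) : root4 r ^ 4 = r := by
  unfold root4
  rw [← Real.rpow_natCast, ← Real.rpow_mul hr]
  norm_num

/-- The measure `1_{[0,1]}(r) dr dv dγ(u)`. -/
def timeMeasure (d : ℕ) : Measure (ℝ × (Space d × Space d)) :=
  (volume.restrict (Set.Ioc 0 1)).prod (baseMeasure d)

instance : SFinite (timeMeasure d) := by unfold timeMeasure; infer_instance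

lemma ae_timeMeasure {p : ℝ × (Space d × Space d) → Prop}
    (h : ∀ q, 0 ≤ q.1 → q.1 ≤ 1 → p q) : ∀ᵐ q ∂(timeMeasure d), p q := by
  have h1 : ∀ᵐ r ∂(volume.restrict (Set.Ioc (0 : ℝ) 1)), r ∈ Set.Ioc (0 : ℝ) 1 :=
    ae_restrict_mem measurableSet_Ioc
  have h2 : ∀ᵐ q ∂(timeMeasure d), q.1 ∈ Set.Ioc (0 : ℝ) 1 :=
    Measure.quasiMeasurePreserving_fst.ae h1
  filter_upwards [h2] with q hq using h q hq.1.le hq.2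

lemma isAvg_time : IsAvg (timeMeasure d) (fun q => wt q.1 q.2) (fun q => disp (root4 q.1) q.2) where
  meas_k := by
    have : Continuous fun q : ℝ × (Space d × Space d) => wt q.1 q.2 :=
      (Real.continuous_exp.comp continuous_fst.neg).mul ((pker d).continuous.comp (by fun_prop))
    exact this.measurable
  meas_ρ := by
    have : Continuous fun q : ℝ × (Space d × Space d) => disp (root4 q.1) q.2 :=
      continuous_disp.comp ((continuous_root4.comp continuous_fst).prodMk continuous_snd)
    exact this.measurable
  integrable N := by
    have c1 : Continuous fun q : ℝ × (Space d × Space d) => wt q.1 q.2 :=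
      (Real.continuous_exp.comp continuous_fst.neg).mul ((pker d).continuous.comp (by fun_prop))
    have c2 : Continuous fun q : ℝ × (Space d × Space d) => disp (root4 q.1) q.2 :=
      continuous_disp.comp ((continuous_root4.comp continuous_fst).prodMk continuous_snd)
    have h1 : Integrable (fun _ : ℝ => (1 : ℝ)) (volume.restrict (Set.Ioc (0 : ℝ) 1)) := by
      simp
    refine (h1.mul_prod (integrable_base_weight (d := d) N)).mono
      (c1.mul ((continuous_const.add c2.norm).pow N)).aestronglyMeasurable
      (ae_timeMeasure fun q h0 h1 => ?_)
    rw [wt, norm_mul, norm_mul, Real.norm_of_nonneg (Real.exp_nonneg _), one_mul,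
      Real.norm_of_nonneg (show 0 ≤ (1 + ‖disp (root4 q.1) q.2‖) ^ N by positivity),
      Real.norm_of_nonneg (show 0 ≤ (1 + ‖q.2.1‖) ^ N * ‖pker d q.2.1‖ *
        (2 ^ N * (1 + ‖q.2.2‖) ^ N) by positivity)]
    calc _ ≤ 1 * ‖pker d q.2.1‖ * ((1 + ‖q.2.1‖) ^ N * ((2 ^ N) * (1 + ‖q.2.2‖) ^ N)) := by
          gcongr
          · exact Real.exp_le_one_iff.2 (by linarith)
          · exact norm_disp_weight_le (root4_nonneg h0) (root4_le_one h0 h1) N q.2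
      _ = _ := by ring

/-- The operator `-∂₀ - Δ' + 1`. -/
def diffL (f : Space d → ℝ) (x : Space d) : ℝ :=
  f x - pd 0 f x - ∑ j : Fin d, pd j.succ (pd j.succ f) x

/-- The average representing `e^{r(∂₀² - (Δ' - 1)²)}`. -/
def avgAt (r : ℝ) (f : Space d → ℝ) : Space d → ℝ := avg (baseMeasure d) (wt r) (disp (root4 r)) f

/-- The average representing `∫₀¹ e^{r(∂₀² - (Δ' - 1)²)} dr`. -/
def avgTime (f : Space d → ℝ) : Space d → ℝ :=
  avg (timeMeasure d) (fun q => wt q.1 q.2) (fun q => disp (root4 q.1) q.2) f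

/-- The operator `K` on functions. -/
def kOp (f : Space d → ℝ) (x : Space d) : ℝ :=
  avgTime (diffL f) x - (Real.exp 1 - 1) * avgAt 1 (diffL f) x

lemma isAvg_one : IsAvg (baseMeasure d) (wt 1) (disp (root4 1)) :=
  isAvg_disp (root4_nonneg zero_le_one) (root4_le_one zero_le_one le_rfl)

lemma isAvg_at {r : ℝ} (h0 : 0 ≤ r) (h1 : r ≤ 1) :
    IsAvg (baseMeasure d) (wt r) (disp (root4 r)) :=
  isAvg_disp (root4_nonneg h0) (root4_le_one h0 h1)

lemma UT.diffL {Θ : Type*} {F : Θ → Space d → ℝ} (hF : UT F) : UT (fun θ => diffL (F θ)) :=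
  (hF.sub (hF.pd 0)).sub (UT.sum _ fun j _ => (hF.pd j.succ).pd j.succ)

/-- The differential operator in `K` is applied to `F` instead of to the kernel; the remaining
averages preserve temperate families. The singularity of `∫₀¹ K_r dr` thus plays no role. -/
lemma UT.kOp {Θ : Type*} {F : Θ → Space d → ℝ} (hF : UT F) : UT (fun θ => kOp (F θ)) :=
  (isAvg_time.ut_avg hF.diffL).sub ((isAvg_one.ut_avg hF.diffL).smul_const _)

lemma diffL_translate (f : Space d → ℝ) (a : Space d) :
    diffL (fun z => f (a + z)) = fun z => diffL f (a + z) := by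
  funext x
  simp [diffL, pd_translate]

lemma kOp_translate (f : Space d → ℝ) (a : Space d) :
    kOp (fun z => f (a + z)) = fun z => kOp f (a + z) := by
  funext x
  simp only [kOp, avgTime, avgAt, diffL_translate, IsAvg.avg_translate]

lemma TG.sum {ι : Type*} (s : Finset ι) (a : ι → ℝ) {f : ι → Space d → ℝ}
    (hf : ∀ j ∈ s, TG (f j)) : TG (fun z => ∑ j ∈ s, a j * f j z) :=
  UT.sum (Θ := Unit) s (F := fun j _ z => a j * f j z) fun j hj => UT.smul_const _ (hf j hj)

lemma pd_sum {ι : Type*} (s : Finset ι) (a : ι → ℝ) {f : ι → Space d → ℝ}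
    (hf : ∀ j ∈ s, TG (f j)) (i : Fin (d + 1)) :
    pd i (fun z => ∑ j ∈ s, a j * f j z) = fun z => ∑ j ∈ s, a j * pd i (f j) z := by
  have h := mpd_sum s (f := fun j => a j • f j) (fun j hj => (hf j hj).smooth.const_smul (a j))
    (Pi.single i 1)
  have e : (∑ j ∈ s, a j • f j) = fun z => ∑ j ∈ s, a j * f j z := by
    funext z; simp
  rw [e, mpd_single (TG.sum s a hf).smooth] at h
  rw [h]
  funext z
  rw [Finset.sum_apply]
  refine Finset.sum_congr rfl fun j hj => ?_
  rw [mpd_smul (hf j hj).smooth, mpd_single (hf j hj).smooth]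
  rfl

lemma diffL_sum {ι : Type*} (s : Finset ι) (a : ι → ℝ) {f : ι → Space d → ℝ}
    (hf : ∀ j ∈ s, TG (f j)) :
    diffL (fun z => ∑ j ∈ s, a j * f j z) = fun z => ∑ j ∈ s, a j * diffL (f j) z := by
  funext x
  unfold diffL
  rw [pd_sum s a hf]
  have : ∀ i : Fin d, pd i.succ (pd i.succ fun z => ∑ j ∈ s, a j * f j z) x =
      ∑ j ∈ s, a j * pd i.succ (pd i.succ (f j)) x := fun i => by
    rw [pd_sum s a hf, pd_sum s a fun j hj => UT.pd (hf j hj) _]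
  simp_rw [this]
  rw [Finset.sum_comm, ← Finset.sum_sub_distrib, ← Finset.sum_sub_distrib]
  refine Finset.sum_congr rfl fun j _ => ?_
  rw [mul_sub, mul_sub, Finset.mul_sum]

lemma TG.diffL {f : Space d → ℝ} (hf : TG f) : TG (diffL f) := UT.diffL hf

lemma TG.kOp {f : Space d → ℝ} (hf : TG f) : TG (kOp f) := UT.kOp hf

lemma kOp_sum {ι : Type*} (s : Finset ι) (a : ι → ℝ) {f : ι → Space d → ℝ}
    (hf : ∀ j ∈ s, TG (f j)) (x : Space d) :
    kOp (fun z => ∑ j ∈ s, a j * f j z) x = ∑ j ∈ s, a j * kOp (f j) x := by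
  unfold kOp avgTime avgAt
  rw [diffL_sum s a hf, isAvg_time.avg_sum s a fun j hj => (hf j hj).diffL,
    isAvg_one.avg_sum s a fun j hj => (hf j hj).diffL, Finset.mul_sum, ← Finset.sum_sub_distrib]
  exact Finset.sum_congr rfl fun j _ => by ring

end Temperate

/-! ## The operator `K` on distributions -/

namespace Temperate

open ProbabilityTheory
open scoped LineDeriv

variable {d : ℕ}

lemma TG.integrable_mul {f : Space d → ℝ} (hf : TG f) (φ : 𝓢(Space d, ℝ)) :
    Integrable (fun x => f x * φ x) := by
  obtain ⟨C, N, hC, hb⟩ := UT.bound_zero hf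
  refine ((integrable_weight_schwartz φ N).const_mul C).mono
    (hf.continuous.mul φ.continuous).aestronglyMeasurable
    (Filter.Eventually.of_forall fun x => ?_)
  rw [norm_mul, norm_mul, norm_mul, norm_norm, Real.norm_of_nonneg hC, norm_pow,
    Real.norm_of_nonneg (show 0 ≤ 1 + ‖x‖ by positivity), ← mul_assoc]
  gcongr
  exact hb () x

/-- Integration by parts. -/
lemma TG.integral_mul_lineDeriv {f : Space d → ℝ} (hf : TG f) (φ : 𝓢(Space d, ℝ))
    (i : Fin (d + 1)) :
    ∫ x, f x * (∂_{(unitVec i : Space d)} φ) x = -∫ x, pd i f x * φ x :=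
  integral_mul_fderiv_eq_neg_fderiv_mul_of_integrable
    (TG.integrable_mul (UT.pd hf i) φ) (hf.integrable_mul (∂_{(unitVec i : Space d)} φ))
    (hf.integrable_mul φ) (fun x _ => diffAt hf.smooth x) (fun _ _ => φ.differentiableAt)

/-- A bound by powers for Schwartz functions, with an integrable weight to spare. -/
lemma abs_schwartz_le (φ : 𝓢(Space d, ℝ)) (N : ℕ) (x : Space d) :
    (1 + ‖x‖) ^ N * |φ x| ≤ 2 ^ N * ((Finset.Iic (N, 0)).sup
      (schwartzSeminormFamily ℝ (Space d) ℝ)) φ := by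
  have := one_add_le_sup_seminorm_apply (𝕜 := ℝ) (m := (N, 0)) le_rfl le_rfl φ x
  rw [norm_iteratedFDeriv_zero] at this
  exact this

lemma integrable_weight_neg : Integrable (fun x : Space d => ((1 + ‖x‖) ^ (d + 2))⁻¹) := by
  -- The exponent `d + 2` exceeds the dimension `d + 1`.
  have := integrable_one_add_norm (E := Space d) (μ := volume) (r := (d + 2 : ℕ))
    (by simp)
  refine this.congr (Filter.Eventually.of_forall fun x => ?_)
  dsimp only
  rw [Real.rpow_neg (by positivity), Real.rpow_natCast]

/-- The distribution given by integration against `f`. -/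
lemma exists_tdist {f : Space d → ℝ} (hf : TG f) :
    ∃ Λ : TDist d, ∀ φ : 𝓢(Space d, ℝ), Λ φ = ∫ x, f x * φ x := by
  obtain ⟨C, N, hC, hb⟩ := UT.bound_zero hf
  refine ⟨mkCLMtoNormedSpace (σ := RingHom.id ℝ) (fun φ : 𝓢(Space d, ℝ) => ∫ x, f x * φ x)
    (fun φ ψ => ?_) (fun a φ => ?_) ⟨Finset.Iic (N + (d + 2), 0),
      C * 2 ^ (N + (d + 2)) * ∫ x : Space d, ((1 + ‖x‖) ^ (d + 2))⁻¹, ?_, fun φ => ?_⟩,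
    fun φ => rfl⟩
  · rw [← integral_add (hf.integrable_mul φ) (hf.integrable_mul ψ)]
    congr 1
    funext x
    simp [mul_add]
  · rw [RingHom.id_apply, smul_eq_mul, ← integral_const_mul]
    congr 1
    funext x
    simp
    ring
  · have : 0 ≤ ∫ x : Space d, ((1 + ‖x‖) ^ (d + 2))⁻¹ := integral_nonneg fun x => by positivity
    positivity
  · set A := ((Finset.Iic (N + (d + 2), 0)).sup (schwartzSeminormFamily ℝ (Space d) ℝ)) φ with hA
    calc ‖∫ x, f x * φ x‖ ≤ ∫ x : Space d, C * 2 ^ (N + (d + 2)) * A * ((1 + ‖x‖) ^ (d + 2))⁻¹ := by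
          refine norm_integral_le_of_norm_le (integrable_weight_neg.const_mul _)
            (Filter.Eventually.of_forall fun x => ?_)
          have h1 := abs_schwartz_le φ (N + (d + 2)) x
          rw [← hA] at h1
          have hp : (0 : ℝ) < (1 + ‖x‖) ^ (d + 2) := by positivity
          rw [← div_eq_mul_inv, le_div_iff₀ hp, Real.norm_eq_abs, abs_mul]
          calc |f x| * |φ x| * (1 + ‖x‖) ^ (d + 2) ≤
                C * (1 + ‖x‖) ^ N * |φ x| * (1 + ‖x‖) ^ (d + 2) := by gcongr; exact hb () x
            _ = C * ((1 + ‖x‖) ^ (N + (d + 2)) * |φ x|) := by rw [pow_add]; ring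
            _ ≤ C * (2 ^ (N + (d + 2)) * A) := by gcongr
            _ = _ := by ring
      _ = _ := by
          rw [integral_const_mul]
          ring

open Classical in
/-- The distribution given by integration against `f`. -/
def tdist (f : Space d → ℝ) : TDist d := if h : TG f then (exists_tdist h).choose else 0

lemma tdist_apply {f : Space d → ℝ} (hf : TG f) (φ : 𝓢(Space d, ℝ)) :
    tdist f φ = ∫ x, f x * φ x := by
  rw [tdist, dif_pos hf]
  exact (exists_tdist hf).choose_spec φ

/-- The operator `∂₀ - Δ' + 1` on Schwartz functions. -/
def adjL (φ : 𝓢(Space d, ℝ)) : 𝓢(Space d, ℝ) :=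
  φ + ∂_{(unitVec 0 : Space d)} φ -
    ∑ j : Fin d, ∂_{(unitVec j.succ : Space d)} (∂_{(unitVec j.succ : Space d)} φ)

lemma adjL_apply (φ : 𝓢(Space d, ℝ)) (x : Space d) : adjL φ x =
    φ x + (∂_{(unitVec 0 : Space d)} φ) x -
      ∑ j : Fin d, (∂_{(unitVec j.succ : Space d)} (∂_{(unitVec j.succ : Space d)} φ)) x := by
  simp [adjL]

lemma integral_mul_adjL {f : Space d → ℝ} (hf : TG f) (φ : 𝓢(Space d, ℝ)) :
    ∫ x, f x * adjL φ x = ∫ x, diffL f x * φ x := by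
  have h2 : ∀ j : Fin d, ∫ x, f x *
      (∂_{(unitVec j.succ : Space d)} (∂_{(unitVec j.succ : Space d)} φ)) x =
      ∫ x, pd j.succ (pd j.succ f) x * φ x := fun j => by
    rw [hf.integral_mul_lineDeriv, TG.integral_mul_lineDeriv (UT.pd hf _), neg_neg]
  have hi := fun j : Fin d => hf.integrable_mul
    (∂_{(unitVec j.succ : Space d)} (∂_{(unitVec j.succ : Space d)} φ))
  have hi' := fun j : Fin d => TG.integrable_mul (UT.pd (UT.pd hf j.succ) j.succ) φ
  simp_rw [adjL_apply, diffL, mul_sub, mul_add, Finset.mul_sum, sub_mul, Finset.sum_mul]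
  have h0 := TG.integrable_mul (UT.pd hf 0) φ
  have e0 := hf.integrable_mul φ
  have e1 := hf.integrable_mul (∂_{(unitVec 0 : Space d)} φ)
  rw [integral_sub (by exact e0.add e1) (integrable_finsetSum _ fun j _ => hi j),
    integral_add e0 e1, integral_finsetSum _ fun j _ => hi j,
    integral_sub (by exact e0.sub h0) (integrable_finsetSum _ fun j _ => hi' j),
    integral_sub e0 h0, integral_finsetSum _ fun j _ => hi' j, hf.integral_mul_lineDeriv]
  simp_rw [h2]
  ring

lemma realToComplex_lineDeriv (φ : 𝓢(Space d, ℝ)) (m : Space d) :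
    realToComplex d (∂_{m} φ) = ∂_{m} (realToComplex d φ) := by
  ext x
  have h : HasFDerivAt (realToComplex d φ : Space d → ℂ)
      (Complex.ofRealCLM.comp (fderiv ℝ φ x)) x :=
    Complex.ofRealCLM.hasFDerivAt.comp x φ.differentiableAt.hasFDerivAt
  rw [lineDerivOp_apply_eq_fderiv, h.fderiv]
  rfl

lemma fourier_lineDeriv_apply (Φ : 𝓢(Space d, ℂ)) (i : Fin (d + 1)) (ξ : Space d) :
    𝓕 (∂_{(unitVec i : Space d)} Φ) ξ = (2 * Real.pi * ξ i : ℝ) * Complex.I * 𝓕 Φ ξ := by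
  have ht : Function.HasTemperateGrowth (fun x : Space d => inner ℝ x (unitVec i)) := by fun_prop
  rw [SchwartzMap.fourier_lineDerivOp_eq, smul_apply,
    smulLeftCLM_apply_apply ht]
  have : inner ℝ ξ (unitVec i : Space d) = ξ i := by
    rw [unitVec, EuclideanSpace.inner_single_right]
    simp
  rw [this, smul_eq_mul, Complex.real_smul]
  push_cast
  ring

lemma fourier_adjL (φ : 𝓢(Space d, ℝ)) (ξ : Space d) :
    𝓕 (realToComplex d (adjL φ)) ξ =
      ((4 * Real.pi ^ 2 * spaceNormSq ξ + 1 : ℝ) + (2 * Real.pi * ξ 0 : ℝ) * Complex.I) *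
        𝓕 (realToComplex d φ) ξ := by
  have h1 : realToComplex d (adjL φ) = realToComplex d φ +
      ∂_{(unitVec 0 : Space d)} (realToComplex d φ) - ∑ j : Fin d,
        ∂_{(unitVec j.succ : Space d)} (∂_{(unitVec j.succ : Space d)} (realToComplex d φ)) := by
    simp only [adjL, ← realToComplex_lineDeriv]
    simp only [realToComplex, map_sub, map_add, map_sum]
  have h2 : 𝓕 (realToComplex d (adjL φ)) = 𝓕 (realToComplex d φ) +
      𝓕 (∂_{(unitVec 0 : Space d)} (realToComplex d φ)) - ∑ j : Fin d,
        𝓕 (∂_{(unitVec j.succ : Space d)} (∂_{(unitVec j.succ : Space d)}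
          (realToComplex d φ))) := by
    rw [h1]
    simp only [← FourierTransform.fourierCLM_apply (R := ℂ), map_sub, map_add, map_sum]
  rw [h2]
  simp only [sub_apply, add_apply, sum_apply,
    fourier_lineDeriv_apply]
  have h3 : ∀ j : Fin d, ((2 * Real.pi * ξ j.succ : ℝ) : ℂ) * Complex.I *
      (((2 * Real.pi * ξ j.succ : ℝ) : ℂ) * Complex.I * 𝓕 (realToComplex d φ) ξ) =
      ((-(4 * Real.pi ^ 2) * ξ j.succ ^ 2 : ℝ) : ℂ) * 𝓕 (realToComplex d φ) ξ := fun j => by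
    push_cast
    linear_combination (4 * (Real.pi : ℂ) ^ 2 * (ξ j.succ : ℂ) ^ 2 *
      𝓕 (realToComplex d φ) ξ) * Complex.I_sq
  simp_rw [h3]
  rw [← Finset.sum_mul, ← Complex.ofReal_sum, ← Finset.mul_sum]
  change _ - ((-(4 * Real.pi ^ 2) * spaceNormSq ξ : ℝ) : ℂ) * _ = _
  push_cast
  ring

lemma integral_exp_gaussian (η : Space d) :
    ∫ u, Complex.exp ((inner ℝ η u : ℝ) * Complex.I) ∂(stdGaussian (Space d)) =
      (Real.exp (-‖η‖ ^ 2 / 2) : ℝ) := by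
  have := charFun_stdGaussian η
  rw [charFun_apply] at this
  simp_rw [real_inner_comm η] at this
  rw [this]
  push_cast
  rfl

/-- The Fourier transform of the averages. -/
lemma integral_exp_disp {r c : ℝ} (hc : c ^ 4 = r) (ξ : Space d) :
    ∫ p, Complex.exp ((2 * Real.pi * inner ℝ ξ (disp c p) : ℝ) * Complex.I) * (wt r p : ℂ)
      ∂(baseMeasure d) = (Real.exp (-(r * ellSymbol 1 ξ)) : ℝ) := by
  have h1 : ∀ p : Space d × Space d,
      Complex.exp ((2 * Real.pi * inner ℝ ξ (disp c p) : ℝ) * Complex.I) * (wt r p : ℂ) =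
      (Complex.exp ((2 * Real.pi * inner ℝ (dil c ξ) p.1 : ℝ) * Complex.I) * (pker d p.1 : ℂ)) *
      ((Real.exp (-r) : ℝ) *
        Complex.exp ((inner ℝ ((4 * Real.pi * c ^ 2) • sp ξ) p.2 : ℝ) * Complex.I)) := fun p => by
    have : 2 * Real.pi * inner ℝ ξ (disp c p) = 2 * Real.pi * inner ℝ (dil c ξ) p.1 +
        inner ℝ ((4 * Real.pi * c ^ 2) • sp ξ) p.2 := by
      rw [disp, inner_add_right, inner_dil, inner_smul_right, inner_sp, real_inner_smul_left]
      ring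
    rw [this, wt]
    push_cast
    rw [add_mul, Complex.exp_add]
    ring
  simp_rw [h1]
  rw [baseMeasure, integral_prod_mul
    (fun v : Space d => Complex.exp ((2 * Real.pi * inner ℝ (dil c ξ) v : ℝ) * Complex.I) *
      (pker d v : ℂ))
    (fun u : Space d => ((Real.exp (-r) : ℝ) : ℂ) *
      Complex.exp ((inner ℝ ((4 * Real.pi * c ^ 2) • sp ξ) u : ℝ) * Complex.I)),
    integral_exp_pker, integral_const_mul, integral_exp_gaussian, ellSymbol_zero_dil, hc,
    ← Complex.ofReal_mul, ← Complex.ofReal_mul, ← Real.exp_add, ← Real.exp_add]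
  -- What remains is `ellSymbol 1 = ellSymbol 0 + 8π²|ξ'|² + 1`: the Gaussian contributes
  -- `‖4πc²ξ'‖²/2 = 8π²r|ξ'|²`, and the weight contributes `r`.
  congr 2
  rw [norm_smul, mul_pow, norm_sq_sp, ← hc]
  simp only [ellSymbol, Real.norm_eq_abs, sq_abs]
  ring

lemma integrable_wt {r : ℝ} : Integrable (wt r : Space d × Space d → ℝ) (baseMeasure d) := by
  have := (isAvg_disp (d := d) (r := r) le_rfl zero_le_one).integrable 0
  simpa using this

/-- The transpose of `K_r` in terms of averages. -/
lemma KrAdj_eq {r : ℝ} (h0 : 0 ≤ r) (φ : 𝓢(Space d, ℝ)) (y : Space d) :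
    KrAdj r φ y = ∫ p, wt r p * adjL φ (y - disp (root4 r) p) ∂(baseMeasure d) := by
  set Ψ := realToComplex d (adjL φ) with hΨ
  have hcd : Continuous fun p : Space d × Space d => disp (root4 r) p :=
    continuous_disp.comp (by fun_prop : Continuous fun p : Space d × Space d => (root4 r, p))
  have hinv : ∀ z : Space d, Ψ z = ∫ ξ, Complex.exp ((2 * Real.pi * inner ℝ ξ z : ℝ) * Complex.I) *
      𝓕 Ψ ξ := fun z => by
    have h : 𝓕⁻ (𝓕 Ψ) = Ψ := FourierTransform.fourierInv_fourier_eq _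
    conv_lhs => rw [← h, SchwartzMap.fourierInv_coe, Real.fourierInv_eq']
    rfl
  have hF : Integrable (Function.uncurry fun (ξ : Space d) (p : Space d × Space d) =>
      Complex.exp ((2 * Real.pi * inner ℝ ξ (y - disp (root4 r) p) : ℝ) * Complex.I) *
        (𝓕 Ψ ξ * (wt r p : ℂ))) (volume.prod (baseMeasure d)) := by
    have h1 : Integrable (fun q : Space d × (Space d × Space d) => 𝓕 Ψ q.1 * (wt r q.2 : ℂ))
        (volume.prod (baseMeasure d)) :=
      Integrable.mul_prod (𝓕 Ψ).integrable (integrable_wt.ofReal (𝕜 := ℂ))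
    refine h1.mono ?_ (Filter.Eventually.of_forall fun q => ?_)
    · refine AEStronglyMeasurable.mul ?_ h1.aestronglyMeasurable
      refine Continuous.aestronglyMeasurable ?_
      refine Complex.continuous_exp.comp ((Complex.continuous_ofReal.comp
        (continuous_const.mul ?_)).mul continuous_const)
      exact continuous_fst.inner (continuous_const.sub (hcd.comp continuous_snd))
    · simp only [Function.uncurry]
      rw [norm_mul, Complex.norm_exp_ofReal_mul_I, one_mul]
  have hK : (SchwartzMap.fourierMultiplierCLM ℂ (kernelSymbol r) (realToComplex d φ)) y =
      ∫ p, (wt r p : ℂ) * Ψ (y - disp (root4 r) p) ∂(baseMeasure d) := by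
    rw [fourierMultiplierCLM_apply, SchwartzMap.fourierInv_coe, Real.fourierInv_eq']
    calc _ = ∫ ξ, ∫ p, Complex.exp ((2 * Real.pi * inner ℝ ξ (y - disp (root4 r) p) : ℝ) *
            Complex.I) * (𝓕 Ψ ξ * (wt r p : ℂ)) ∂(baseMeasure d) := by
          congr 1
          funext ξ
          -- The polynomial factor of the symbol turns the transform of `φ` into that of `adjL φ`.
          -- The exponential factor is even, and it is written as a Fourier integral at `-ξ` so that
          -- the phases combine to the point `y - disp`.
          rw [smulLeftCLM_apply_apply (kernelSymbol_temperate h0), smul_eq_mul, smul_eq_mul,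
            kernelSymbol, ← ellSymbol_neg, ← integral_exp_disp (root4_pow h0) (-ξ)]
          have h4 := fourier_adjL φ ξ
          rw [← hΨ] at h4
          rw [mul_right_comm ((_ : ℂ) + _), ← h4, ← integral_const_mul, ← integral_const_mul]
          congr 1
          funext p
          have h5 : Complex.exp ((2 * Real.pi * inner ℝ ξ (y - disp (root4 r) p) : ℝ) *
              Complex.I) = Complex.exp ((2 * Real.pi * inner ℝ ξ y : ℝ) * Complex.I) *
              Complex.exp ((2 * Real.pi * inner ℝ (-ξ) (disp (root4 r) p) : ℝ) * Complex.I) := by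
            rw [← Complex.exp_add, ← add_mul, ← Complex.ofReal_add]
            congr 3
            rw [inner_sub_right, inner_neg_left]
            ring
          rw [h5]
          ring
      _ = ∫ p, (∫ ξ, Complex.exp ((2 * Real.pi * inner ℝ ξ (y - disp (root4 r) p) : ℝ) *
            Complex.I) * (𝓕 Ψ ξ * (wt r p : ℂ))) ∂(baseMeasure d) :=
          integral_integral_swap hF
      _ = _ := by
          congr 1
          funext p
          rw [hinv, ← integral_const_mul]
          congr 1
          funext ξ
          ring
  have h6 : ∀ p : Space d × Space d, (wt r p : ℂ) * Ψ (y - disp (root4 r) p) =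
      ((wt r p * adjL φ (y - disp (root4 r) p) : ℝ) : ℂ) := fun p => by
    rw [Complex.ofReal_mul]
    rfl
  simp_rw [h6] at hK
  rw [integral_complex_ofReal] at hK
  change ((SchwartzMap.fourierMultiplierCLM ℂ (kernelSymbol r) (realToComplex d φ)) y).re = _
  rw [hK, Complex.ofReal_re]

/-- The transpose of an average, with the average on the Schwartz function. -/
lemma IsAvg.integral_mul_avg {Ω : Type*} [MeasurableSpace Ω] {μ : Measure Ω} [SFinite μ]
    {k : Ω → ℝ} {ρ : Ω → Space d} (h : IsAvg μ k ρ) {f : Space d → ℝ} (hf : TG f)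
    (ψ : 𝓢(Space d, ℝ)) :
    ∫ y, f y * (∫ w, k w * ψ (y - ρ w) ∂μ) = ∫ x, avg μ k ρ f x * ψ x := by
  obtain ⟨C, N, hC, hb⟩ := UT.bound_zero hf
  set A := (2 ^ (N + (d + 2)) : ℝ) * ((Finset.Iic (N + (d + 2), 0)).sup
    (schwartzSeminormFamily ℝ (Space d) ℝ)) ψ with hA
  have hi : Integrable (Function.uncurry fun (y : Space d) (w : Ω) =>
      k w * f y * ψ (y - ρ w)) (volume.prod μ) := by
    refine ((integrable_weight_neg.mul_prod (h.integrable (N + (d + 2)))).const_mul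
      (C * A)).mono ?_ (Filter.Eventually.of_forall fun q => ?_)
    · refine Measurable.aestronglyMeasurable ?_
      exact ((h.meas_k.comp measurable_snd).mul (hf.continuous.measurable.comp measurable_fst)).mul
        (ψ.continuous.measurable.comp (measurable_fst.sub (h.meas_ρ.comp measurable_snd)))
    · obtain ⟨y, w⟩ := q
      have hA0 : 0 ≤ A := by
        rw [hA]
        exact mul_nonneg (by positivity) (apply_nonneg _ _)
      have h1 := abs_schwartz_le ψ (N + (d + 2)) (y - ρ w)
      rw [← hA] at h1
      have h2 := weight_add_le (y - ρ w) (ρ w) (N + (d + 2))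
      rw [sub_add_cancel] at h2
      -- The weight at `y` is distributed over `y - ρ w` and `ρ w`. Of its exponent, `N` compensates
      -- the growth of `f`, and `d + 2` gives integrability in `y`.
      have h3 : (1 + ‖y‖) ^ N * |ψ (y - ρ w)| ≤
          A * (((1 + ‖y‖) ^ (d + 2))⁻¹ * (1 + ‖ρ w‖) ^ (N + (d + 2))) := by
        have hp : (0 : ℝ) < (1 + ‖y‖) ^ (d + 2) := by positivity
        rw [← mul_assoc, mul_right_comm, ← div_eq_mul_inv, le_div_iff₀ hp]
        calc (1 + ‖y‖) ^ N * |ψ (y - ρ w)| * (1 + ‖y‖) ^ (d + 2) =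
              (1 + ‖y‖) ^ (N + (d + 2)) * |ψ (y - ρ w)| := by rw [pow_add]; ring
          _ ≤ ((1 + ‖y - ρ w‖) ^ (N + (d + 2)) * (1 + ‖ρ w‖) ^ (N + (d + 2))) *
              |ψ (y - ρ w)| := by gcongr
          _ = ((1 + ‖y - ρ w‖) ^ (N + (d + 2)) * |ψ (y - ρ w)|) *
              (1 + ‖ρ w‖) ^ (N + (d + 2)) := by ring
          _ ≤ _ := by gcongr
      simp only [Function.uncurry, Real.norm_eq_abs, abs_mul]
      rw [abs_of_nonneg hC, abs_of_nonneg hA0,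
        abs_of_nonneg (show 0 ≤ ((1 + ‖y‖) ^ (d + 2))⁻¹ by positivity),
        abs_of_nonneg (show 0 ≤ (1 + ‖ρ w‖) ^ (N + (d + 2)) by positivity)]
      calc |k w| * |f y| * |ψ (y - ρ w)| ≤ |k w| * (C * (1 + ‖y‖) ^ N) * |ψ (y - ρ w)| := by
            gcongr
            exact hb () y
        _ = |k w| * C * ((1 + ‖y‖) ^ N * |ψ (y - ρ w)|) := by ring
        _ ≤ |k w| * C * (A * (((1 + ‖y‖) ^ (d + 2))⁻¹ * (1 + ‖ρ w‖) ^ (N + (d + 2)))) := by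
            gcongr
        _ = _ := by ring
  rw [h.integral_avg_mul hf]
  calc _ = ∫ y, ∫ w, k w * f y * ψ (y - ρ w) ∂μ := by
        congr 1
        funext y
        rw [← integral_const_mul]
        congr 1
        funext w
        ring
    _ = ∫ w, (∫ y, k w * f y * ψ (y - ρ w)) ∂μ := integral_integral_swap hi
    _ = _ := by
        congr 1
        funext w
        rw [← integral_add_right_eq_self _ (ρ w), ← integral_const_mul]
        congr 1
        funext x
        rw [add_sub_cancel_right]
        ring

lemma IsAvg.diffL_avg {Ω : Type*} [MeasurableSpace Ω] {μ : Measure Ω}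
    {k : Ω → ℝ} {ρ : Ω → Space d} (h : IsAvg μ k ρ) {f : Space d → ℝ} (hf : TG f) :
    diffL (avg μ k ρ f) = avg μ k ρ (diffL f) := by
  funext x
  have h2 : ∀ j : Fin d, pd j.succ (pd j.succ (avg μ k ρ f)) =
      avg μ k ρ (pd j.succ (pd j.succ f)) := fun j => by
    rw [h.pd_avg hf, h.pd_avg (UT.pd hf _)]
  have h3 := fun j : Fin d => h.integrable_TG (UT.pd (UT.pd hf j.succ) j.succ) x
  have e0 := h.integrable_TG hf x
  have e1 := h.integrable_TG (UT.pd hf 0) x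
  simp only [diffL, h2, h.pd_avg hf 0]
  simp only [avg, diffL.eq_def f, mul_sub, Finset.mul_sum]
  rw [integral_sub (by exact e0.sub e1) (integrable_finsetSum _ fun j _ => h3 j),
    integral_sub e0 e1, integral_finsetSum _ fun j _ => h3 j]

lemma tdist_KrAdj {f : Space d → ℝ} (hf : TG f) {r : ℝ} (h0 : 0 ≤ r) (h1 : r ≤ 1)
    (φ : 𝓢(Space d, ℝ)) : tdist f (KrAdj r φ) = ∫ x, avgAt r (diffL f) x * φ x := by
  rw [tdist_apply hf]
  simp_rw [KrAdj_eq h0]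
  rw [(isAvg_at h0 h1).integral_mul_avg hf, integral_mul_adjL ((isAvg_at h0 h1).ut_avg hf),
    (isAvg_at h0 h1).diffL_avg hf]
  rfl

/-- `K` acts on functions as `kOp`. -/
lemma Kapply_tdist {f : Space d → ℝ} (hf : TG f) (φ : 𝓢(Space d, ℝ)) :
    Kapply (tdist f) φ = ∫ x, kOp f x * φ x := by
  have ht : TG (avgTime (diffL f)) := isAvg_time.ut_avg hf.diffL
  have ha : TG (avgAt 1 (diffL f)) := isAvg_one.ut_avg hf.diffL
  -- Fubini: the average over `timeMeasure` is the integral over `r` of the averages at fixed `r`.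
  have h1 : (∫ r in (0 : ℝ)..1, tdist f (KrAdj r φ)) = ∫ x, avgTime (diffL f) x * φ x := by
    rw [intervalIntegral.integral_of_le zero_le_one, avgTime,
      isAvg_time.integral_avg_mul hf.diffL, timeMeasure,
      integral_prod _ (isAvg_time.integrable_avg_mul hf.diffL φ)]
    refine setIntegral_congr_fun measurableSet_Ioc fun r hr => ?_
    dsimp only
    rw [tdist_KrAdj hf hr.1.le hr.2, avgAt, (isAvg_at hr.1.le hr.2).integral_avg_mul hf.diffL]
  rw [Kapply, h1, tdist_KrAdj hf zero_le_one le_rfl, ← integral_const_mul,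
    ← integral_sub (ht.integrable_mul φ) ((ha.integrable_mul φ).const_mul _)]
  congr 1
  funext x
  rw [kOp]
  ring

end Temperate

/-! ## Distributions that vanish when tested against the heat kernel -/

namespace Temperate

open scoped LineDeriv BoundedContinuousFunction

variable {d : ℕ}

/-- The translate `φ(· - x)`. -/
abbrev tr (x : Space d) (φ : 𝓢(Space d, ℝ)) : 𝓢(Space d, ℝ) := SchwartzMap.compSubConstCLM ℝ x φ

lemma iteratedFDeriv_tr (x : Space d) (φ : 𝓢(Space d, ℝ)) (n : ℕ) (y : Space d) :
    iteratedFDeriv ℝ n (tr x φ) y = iteratedFDeriv ℝ n φ (y - x) :=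
  iteratedFDeriv_comp_sub n x y

/-- Mean value inequality along the segment from `y - x'` to `y - x`, at the price of one more
derivative of `φ`. The segment stays within `‖x‖ + ‖x'‖` of `y`, so the weight on it is comparable
with the weight at `y`. This yields both continuity and polynomial growth of translates. -/
lemma seminorm_tr_sub_le (φ : 𝓢(Space d, ℝ)) (k n : ℕ) : ∃ C : ℝ, 0 ≤ C ∧ ∀ x x' : Space d,
    SchwartzMap.seminorm ℝ k n (tr x φ - tr x' φ) ≤ C * (1 + (‖x‖ + ‖x'‖)) ^ k * ‖x - x'‖ := by
  refine ⟨(2 : ℝ) ^ k * ((Finset.Iic (k, n + 1)).sup (schwartzSeminormFamily ℝ (Space d) ℝ)) φ,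
    mul_nonneg (by positivity) (apply_nonneg _ _), fun x x' => ?_⟩
  set A := (2 : ℝ) ^ k * ((Finset.Iic (k, n + 1)).sup (schwartzSeminormFamily ℝ (Space d) ℝ)) φ
    with hA
  have hA0 : 0 ≤ A := mul_nonneg (by positivity) (apply_nonneg _ _)
  have hb : ∀ z, (1 + ‖z‖) ^ k * ‖iteratedFDeriv ℝ (n + 1) φ z‖ ≤ A := fun z =>
    one_add_le_sup_seminorm_apply (𝕜 := ℝ) (m := (k, n + 1)) le_rfl le_rfl φ z
  set R := ‖x‖ + ‖x'‖ with hR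
  have hR0 : 0 ≤ R := by positivity
  refine seminorm_le_bound ℝ k n _ (by positivity) fun y => ?_
  have hp : (0 : ℝ) < (1 + ‖y‖) ^ k := by positivity
  have e1 : iteratedFDeriv ℝ n (⇑(tr x φ - tr x' φ)) y =
      iteratedFDeriv ℝ n φ (y - x) - iteratedFDeriv ℝ n φ (y - x') := by
    have : (⇑(tr x φ - tr x' φ) : Space d → ℝ) = ⇑(tr x φ) - ⇑(tr x' φ) := rfl
    rw [this, iteratedFDeriv_sub_apply ((tr x φ).smooth n).contDiffAt
      ((tr x' φ).smooth n).contDiffAt, iteratedFDeriv_tr, iteratedFDeriv_tr]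
  have e2 : ‖iteratedFDeriv ℝ n φ (y - x) - iteratedFDeriv ℝ n φ (y - x')‖ ≤
      A * (1 + R) ^ k / (1 + ‖y‖) ^ k * ‖(y - x) - (y - x')‖ := by
    refine Convex.norm_image_sub_le_of_norm_fderiv_le (𝕜 := ℝ) (s := segment ℝ (y - x') (y - x))
      (fun z _ => ?_) (fun z hz => ?_) (convex_segment _ _) (left_mem_segment _ _ _)
      (right_mem_segment _ _ _)
    · exact ((φ.smooth ⊤).differentiable_iteratedFDeriv (by exact_mod_cast ENat.natCast_lt_top n)) z
    · rw [norm_fderiv_iteratedFDeriv, le_div_iff₀ hp]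
      have hz' : ‖y - z‖ ≤ R := by
        have hball : segment ℝ (y - x') (y - x) ⊆ Metric.closedBall y R :=
          (convex_closedBall y R).segment_subset
            (by rw [mem_closedBall_iff_norm, sub_sub_cancel_left, norm_neg, hR]
                linarith [norm_nonneg x])
            (by rw [mem_closedBall_iff_norm, sub_sub_cancel_left, norm_neg, hR]
                linarith [norm_nonneg x'])
        have := hball hz
        rwa [mem_closedBall_iff_norm, norm_sub_rev] at this
      have hy : 1 + ‖y‖ ≤ (1 + R) * (1 + ‖z‖) := by
        have : ‖y‖ ≤ ‖y - z‖ + ‖z‖ := by simpa using norm_add_le (y - z) z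
        nlinarith [norm_nonneg z]
      calc ‖iteratedFDeriv ℝ (n + 1) φ z‖ * (1 + ‖y‖) ^ k ≤
            ‖iteratedFDeriv ℝ (n + 1) φ z‖ * ((1 + R) * (1 + ‖z‖)) ^ k := by gcongr
        _ = (1 + R) ^ k * ((1 + ‖z‖) ^ k * ‖iteratedFDeriv ℝ (n + 1) φ z‖) := by
            rw [mul_pow]; ring
        _ ≤ (1 + R) ^ k * A := by gcongr; exact hb z
        _ = _ := mul_comm _ _
  rw [e1]
  calc ‖y‖ ^ k * _ ≤ (1 + ‖y‖) ^ k * (A * (1 + R) ^ k / (1 + ‖y‖) ^ k * ‖(y - x) - (y - x')‖) := by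
        gcongr
        linarith
    _ = A * (1 + R) ^ k * ‖x - x'‖ := by
        rw [show (y - x) - (y - x') = -(x - x') by abel, norm_neg]
        field_simp

/-- The Banach space in which a finite set of Schwartz seminorms is a norm. -/
def SemiSpace (d : ℕ) (s : Finset (ℕ × ℕ)) : Type :=
  (i : s) → (Space d →ᵇ ContinuousMultilinearMap ℝ (fun _ : Fin i.1.2 => Space d) ℝ)

instance (s : Finset (ℕ × ℕ)) : NormedAddCommGroup (SemiSpace d s) :=
  inferInstanceAs (NormedAddCommGroup ((i : s) →
    (Space d →ᵇ ContinuousMultilinearMap ℝ (fun _ : Fin i.1.2 => Space d) ℝ)))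

instance (s : Finset (ℕ × ℕ)) : NormedSpace ℝ (SemiSpace d s) :=
  inferInstanceAs (NormedSpace ℝ ((i : s) →
    (Space d →ᵇ ContinuousMultilinearMap ℝ (fun _ : Fin i.1.2 => Space d) ℝ)))

instance (s : Finset (ℕ × ℕ)) : CompleteSpace (SemiSpace d s) :=
  inferInstanceAs (CompleteSpace ((i : s) →
    (Space d →ᵇ ContinuousMultilinearMap ℝ (fun _ : Fin i.1.2 => Space d) ℝ)))

/-- The map `φ ↦ (‖y‖^k D^n φ(y))_{(k, n)}`. -/
def semiMap (d : ℕ) (s : Finset (ℕ × ℕ)) : 𝓢(Space d, ℝ) →ₗ[ℝ] SemiSpace d s where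
  toFun φ i := BoundedContinuousFunction.ofNormedAddCommGroup
    (fun y => ‖y‖ ^ i.1.1 • iteratedFDeriv ℝ i.1.2 φ y)
    ((continuous_norm.pow _).smul ((φ.smooth ⊤).continuous_iteratedFDeriv
      (by exact_mod_cast le_top)))
    (SchwartzMap.seminorm ℝ i.1.1 i.1.2 φ) (fun y => by
      rw [norm_smul, norm_pow, norm_norm]
      exact le_seminorm ℝ _ _ φ y)
  map_add' φ ψ := by
    funext i
    ext y : 1
    have : (⇑(φ + ψ) : Space d → ℝ) = ⇑φ + ⇑ψ := rfl
    change ‖y‖ ^ i.1.1 • iteratedFDeriv ℝ i.1.2 (⇑(φ + ψ)) y =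
      ‖y‖ ^ i.1.1 • iteratedFDeriv ℝ i.1.2 φ y + ‖y‖ ^ i.1.1 • iteratedFDeriv ℝ i.1.2 ψ y
    rw [this, iteratedFDeriv_add_apply (φ.smooth _).contDiffAt (ψ.smooth _).contDiffAt, smul_add]
  map_smul' a φ := by
    funext i
    ext y : 1
    have : (⇑(a • φ) : Space d → ℝ) = a • ⇑φ := rfl
    change ‖y‖ ^ i.1.1 • iteratedFDeriv ℝ i.1.2 (⇑(a • φ)) y =
      a • (‖y‖ ^ i.1.1 • iteratedFDeriv ℝ i.1.2 φ y)
    rw [this, iteratedFDeriv_const_smul_apply (φ.smooth _).contDiffAt, smul_comm]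

lemma semiMap_apply (s : Finset (ℕ × ℕ)) (φ : 𝓢(Space d, ℝ)) (i : s) (y : Space d) :
    semiMap d s φ i y = ‖y‖ ^ i.1.1 • iteratedFDeriv ℝ i.1.2 φ y := rfl

lemma norm_semiMap_le (s : Finset (ℕ × ℕ)) (φ : 𝓢(Space d, ℝ)) {M : ℝ} (hM : 0 ≤ M)
    (h : ∀ i ∈ s, SchwartzMap.seminorm ℝ i.1 i.2 φ ≤ M) : ‖semiMap d s φ‖ ≤ M := by
  refine (pi_norm_le_iff_of_nonneg (G := fun i : s => Space d →ᵇ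
    ContinuousMultilinearMap ℝ (fun _ : Fin i.1.2 => Space d) ℝ) hM).2 fun i => (BoundedContinuousFunction.norm_le hM).2
    fun y => ?_
  rw [semiMap_apply, norm_smul, norm_pow, norm_norm]
  exact (le_seminorm ℝ _ _ φ y).trans (h i i.2)

lemma seminorm_le_semiMap (s : Finset (ℕ × ℕ)) (φ : 𝓢(Space d, ℝ)) :
    (s.sup (schwartzSeminormFamily ℝ (Space d) ℝ)) φ ≤ ‖semiMap d s φ‖ := by
  refine Seminorm.finset_sup_apply_le (norm_nonneg _) fun i hi => ?_
  refine seminorm_le_bound ℝ _ _ φ (norm_nonneg _) fun y => ?_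
  have h1 := norm_le_pi_norm (G := fun i : s => Space d →ᵇ
    ContinuousMultilinearMap ℝ (fun _ : Fin i.1.2 => Space d) ℝ) (semiMap d s φ) ⟨i, hi⟩
  have h2 := (semiMap d s φ ⟨i, hi⟩).norm_coe_le_norm y
  rw [semiMap_apply, norm_smul, norm_pow, norm_norm] at h2
  exact h2.trans h1

/-- A tempered distribution factors through finitely many seminorms. -/
lemma exists_factor (Λ : TDist d) : ∃ (s : Finset (ℕ × ℕ)) (L : SemiSpace d s →L[ℝ] ℝ),
    ∀ φ, Λ φ = L (semiMap d s φ) := by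
  obtain ⟨s, C, -, hC⟩ := Seminorm.bound_of_continuous (schwartz_withSeminorms ℝ (Space d) ℝ)
    ((normSeminorm ℝ ℝ).comp Λ.toLinearMap) (continuous_norm.comp Λ.continuous)
  have hb : ∀ φ, ‖Λ φ‖ ≤ C * ‖semiMap d s φ‖ := fun φ =>
    (hC φ).trans (mul_le_mul_of_nonneg_left (seminorm_le_semiMap s φ) C.2)
  -- A linear choice of preimages, with no continuity of its own. By `hb`, the distribution is
  -- nevertheless bounded on the range in the Banach norm, so Hahn–Banach applies.
  obtain ⟨h, hh⟩ := LinearMap.exists_rightInverse_of_surjective (semiMap d s).rangeRestrict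
    (LinearMap.range_rangeRestrict _)
  have hh' : ∀ v : LinearMap.range (semiMap d s), semiMap d s (h v) = v := fun v => by
    have := LinearMap.congr_fun hh v
    exact congrArg Subtype.val this
  obtain ⟨L, hL, -⟩ := exists_extension_norm_eq (LinearMap.range (semiMap d s))
    ((Λ.toLinearMap ∘ₗ h).mkContinuous C fun v => by
      have := hb (h v)
      rw [hh' v] at this
      exact this)
  refine ⟨s, L, fun φ => ?_⟩
  have h1 := hL ⟨semiMap d s φ, LinearMap.mem_range_self _ φ⟩
  rw [h1]
  change Λ φ = Λ (h _)
  -- The choice of preimage is immaterial: `hb` makes the distribution vanish on the kernel of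
  -- `semiMap`.
  have h2 := hb (φ - h ⟨semiMap d s φ, LinearMap.mem_range_self _ φ⟩)
  rw [map_sub, map_sub, hh', sub_self, norm_zero, mul_zero] at h2
  exact sub_eq_zero.1 (norm_le_zero_iff.1 h2)

lemma exists_semiMap_tr_bound (s : Finset (ℕ × ℕ)) (φ : 𝓢(Space d, ℝ)) :
    ∃ (C : ℝ) (N : ℕ), 0 ≤ C ∧ ∀ x x' : Space d,
      ‖semiMap d s (tr x φ) - semiMap d s (tr x' φ)‖ ≤ C * (1 + (‖x‖ + ‖x'‖)) ^ N * ‖x - x'‖ := by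
  choose C hC hb using fun i : ℕ × ℕ => seminorm_tr_sub_le φ i.1 i.2
  refine ⟨∑ i ∈ s, C i, s.sup Prod.fst, Finset.sum_nonneg fun i _ => hC i, fun x x' => ?_⟩
  have h0 : 0 ≤ ∑ i ∈ s, C i := Finset.sum_nonneg fun i _ => hC i
  rw [← map_sub]
  refine norm_semiMap_le s _ (by positivity) fun i hi => (hb i x x').trans ?_
  have h1 : C i ≤ ∑ i ∈ s, C i := Finset.single_le_sum (fun i _ => hC i) hi
  have h2 : i.1 ≤ s.sup Prod.fst := Finset.le_sup (f := Prod.fst) hi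
  have h3 : 1 ≤ 1 + (‖x‖ + ‖x'‖) := by linarith [norm_nonneg x, norm_nonneg x']
  gcongr

lemma continuous_semiMap_tr (s : Finset (ℕ × ℕ)) (φ : 𝓢(Space d, ℝ)) :
    Continuous fun x => semiMap d s (tr x φ) := by
  obtain ⟨C, N, hC, hb⟩ := exists_semiMap_tr_bound s φ
  refine continuous_iff_continuousAt.2 fun x' => ?_
  rw [ContinuousAt, tendsto_iff_norm_sub_tendsto_zero]
  refine squeeze_zero (fun _ => norm_nonneg _) (fun x => hb x x') ?_
  have : Continuous fun x : Space d => C * (1 + (‖x‖ + ‖x'‖)) ^ N * ‖x - x'‖ := by fun_prop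
  have h := this.tendsto x'
  simpa using h

lemma exists_semiMap_tr_weight (s : Finset (ℕ × ℕ)) (φ : 𝓢(Space d, ℝ)) :
    ∃ (C : ℝ) (N : ℕ), 0 ≤ C ∧ ∀ x : Space d, ‖semiMap d s (tr x φ)‖ ≤ C * (1 + ‖x‖) ^ N := by
  obtain ⟨C, N, hC, hb⟩ := exists_semiMap_tr_bound s φ
  refine ⟨C + ‖semiMap d s (tr 0 φ)‖, N + 1, by positivity, fun x => ?_⟩
  have h1 := hb x 0
  rw [norm_zero, add_zero, sub_zero] at h1
  have h2 : ‖semiMap d s (tr x φ)‖ ≤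
      ‖semiMap d s (tr x φ) - semiMap d s (tr 0 φ)‖ + ‖semiMap d s (tr 0 φ)‖ := by
    simpa using norm_add_le (semiMap d s (tr x φ) - semiMap d s (tr 0 φ)) (semiMap d s (tr 0 φ))
  have h3 : 1 ≤ (1 + ‖x‖) ^ (N + 1) := UT.one_le_weight x _
  calc _ ≤ C * (1 + ‖x‖) ^ N * ‖x‖ + ‖semiMap d s (tr 0 φ)‖ * 1 := by linarith
    _ ≤ C * (1 + ‖x‖) ^ N * (1 + ‖x‖) + ‖semiMap d s (tr 0 φ)‖ * (1 + ‖x‖) ^ (N + 1) := by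
        gcongr
        linarith
    _ = _ := by rw [pow_succ]; ring

lemma integrable_smul_semiMap (s : Finset (ℕ × ℕ)) (a φ : 𝓢(Space d, ℝ)) :
    Integrable fun x => a x • semiMap d s (tr x φ) := by
  obtain ⟨C, N, hC, hb⟩ := exists_semiMap_tr_weight s φ
  refine ((integrable_weight_schwartz a N).const_mul C).mono'
    (a.continuous.smul (continuous_semiMap_tr s φ)).aestronglyMeasurable
    (Filter.Eventually.of_forall fun x => ?_)
  rw [norm_smul]
  calc _ ≤ ‖a x‖ * (C * (1 + ‖x‖) ^ N) := by gcongr; exact hb x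
    _ = _ := by ring

/-- The reflection `φ(y - ·)`. -/
lemma exists_reflect (φ : 𝓢(Space d, ℝ)) (y : Space d) :
    ∃ ψ : 𝓢(Space d, ℝ), ∀ x, ψ x = φ (y - x) := by
  refine ⟨SchwartzMap.compCLMOfContinuousLinearEquiv ℝ (ContinuousLinearEquiv.neg ℝ)
    (tr (-y) φ), fun x => ?_⟩
  simp [tr]
  congr 1
  abel

/-- The sign from the integration by parts cancels against the one from the reflection `x ↦ y - x`.
-/
lemma integral_mul_lineDeriv_comm (a φ : 𝓢(Space d, ℝ)) (m y : Space d) :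
    ∫ x, a x * (∂_{m} φ) (y - x) = ∫ x, (∂_{m} a) x * φ (y - x) := by
  obtain ⟨ψ, hψ⟩ := exists_reflect φ y
  have h1 : ∀ x, (∂_{m} ψ) x = -(∂_{m} φ) (y - x) := fun x => by
    have h2 : (ψ : Space d → ℝ) = fun x => φ (y - x) := funext hψ
    have h3 : HasFDerivAt (fun x => φ (y - x)) ((fderiv ℝ φ (y - x)).comp
        (-ContinuousLinearMap.id ℝ (Space d))) x :=
      (φ.differentiableAt (x := y - x)).hasFDerivAt.comp x ((hasFDerivAt_id x).const_sub y)
    rw [lineDerivOp_apply_eq_fderiv, h2, h3.fderiv]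
    simp [lineDerivOp_apply_eq_fderiv]
  have h4 := integral_mul_lineDerivOp_right_eq_neg_left (μ := volume) a ψ m
  simp_rw [h1, hψ, mul_neg, integral_neg, neg_inj] at h4
  exact h4

lemma lineDeriv_comm (φ : 𝓢(Space d, ℝ)) (u v : Space d) :
    ∂_{u} (∂_{v} φ) = ∂_{v} (∂_{u} φ) := by
  have h : ∀ (u v x : Space d), (∂_{u} (∂_{v} φ)) x = fderiv ℝ (fderiv ℝ φ) x u v := fun u v x => by
    have h1 : DifferentiableAt ℝ (fderiv ℝ φ) x :=
      (((φ.smooth 2).fderiv_right (m := 1) (by norm_num)).differentiable (by norm_num)) x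
    have h2 : ((∂_{v} φ : 𝓢(Space d, ℝ)) : Space d → ℝ) = fun y => fderiv ℝ φ y v := rfl
    rw [lineDerivOp_apply_eq_fderiv, h2, fderiv_clm_apply h1 (differentiableAt_const v)]
    simp
  ext x
  rw [h, h]
  exact (φ.smooth 2).contDiffAt.isSymmSndFDerivAt (by simp) u v

lemma iteratedLineDeriv_comm (n : ℕ) (φ : 𝓢(Space d, ℝ)) (m : Fin n → Space d) (u : Space d) :
    ∂^{m} (∂_{u} φ) = ∂_{u} (∂^{m} φ) := by
  induction n with
  | zero => rfl
  | succ n ih =>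
    rw [LineDeriv.iteratedLineDerivOp_succ_left, ih, lineDeriv_comm,
      ← LineDeriv.iteratedLineDerivOp_succ_left]

lemma integral_mul_iteratedLineDeriv_comm (n : ℕ) : ∀ (a φ : 𝓢(Space d, ℝ)) (m : Fin n → Space d)
    (y : Space d), ∫ x, a x * (∂^{m} φ) (y - x) = ∫ x, (∂^{m} a) x * φ (y - x) := by
  induction n with
  | zero => intro a φ m y; simp
  | succ n ih =>
    intro a φ m y
    rw [LineDeriv.iteratedLineDerivOp_succ_left m φ, integral_mul_lineDeriv_comm, ih,
      LineDeriv.iteratedLineDerivOp_succ_left m a, iteratedLineDeriv_comm]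

/-- The Banach space makes both sides Bochner integrals, which may be compared after evaluation at a
point and at a tuple of directions. There they become derivatives of the two convolutions of `a` and
`φ`, and a derivative may be moved from one factor to the other. -/
lemma integral_semiMap_comm (s : Finset (ℕ × ℕ)) (a φ : 𝓢(Space d, ℝ)) :
    ∫ x, a x • semiMap d s (tr x φ) = ∫ w, φ w • semiMap d s (tr w a) := by
  have hev : ∀ (a φ : 𝓢(Space d, ℝ)) (i : s) (y : Space d) (m : Fin i.1.2 → Space d),
      (∫ x, a x • semiMap d s (tr x φ)) i y m =
        ‖y‖ ^ i.1.1 * ∫ x, a x * (∂^{m} φ) (y - x) := fun a φ i y m => by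
    let E : SemiSpace d s →L[ℝ] ℝ := (ContinuousMultilinearMap.apply ℝ _ ℝ m).comp
      ((BoundedContinuousFunction.evalCLM ℝ y).comp (ContinuousLinearMap.proj (R := ℝ)
        (φ := fun i : s => Space d →ᵇ
          ContinuousMultilinearMap ℝ (fun _ : Fin i.1.2 => Space d) ℝ) i))
    change E (∫ x, a x • semiMap d s (tr x φ)) = _
    rw [← E.integral_comp_comm (integrable_smul_semiMap s a φ), ← integral_const_mul]
    congr 1
    funext x
    rw [map_smul]
    change a x * (‖y‖ ^ i.1.1 * iteratedFDeriv ℝ i.1.2 (tr x φ) y m) = _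
    rw [iteratedFDeriv_tr, ← iteratedLineDerivOp_eq_iteratedFDeriv]
    ring
  refine funext fun i => ?_
  ext y m
  rw [hev, hev, integral_mul_iteratedLineDeriv_comm, ← integral_sub_left_eq_self _ volume y]
  congr 2
  funext x
  rw [sub_sub_cancel, mul_comm]

/-- The two ways of testing a distribution against a convolution. -/
lemma integral_tdist_tr_comm (Λ : TDist d) (a φ : 𝓢(Space d, ℝ)) :
    ∫ x, a x * Λ (tr x φ) = ∫ w, φ w * Λ (tr w a) := by
  obtain ⟨s, L, hL⟩ := exists_factor Λ
  have h : ∀ a φ : 𝓢(Space d, ℝ), ∫ x, a x * Λ (tr x φ) =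
      L (∫ x, a x • semiMap d s (tr x φ)) := fun a φ => by
    rw [← L.integral_comp_comm (integrable_smul_semiMap s a φ)]
    congr 1
    funext x
    rw [hL, map_smul, smul_eq_mul]
  rw [h, h, integral_semiMap_comm]

lemma continuous_tdist_tr (Λ : TDist d) (a : 𝓢(Space d, ℝ)) : Continuous fun x => Λ (tr x a) := by
  obtain ⟨s, L, hL⟩ := exists_factor Λ
  simp_rw [hL]
  exact L.continuous.comp (continuous_semiMap_tr s a)

lemma exists_tdist_tr_bound (Λ : TDist d) (a : 𝓢(Space d, ℝ)) :
    ∃ (C : ℝ) (N : ℕ), 0 ≤ C ∧ ∀ x, |Λ (tr x a)| ≤ C * (1 + ‖x‖) ^ N := by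
  obtain ⟨s, L, hL⟩ := exists_factor Λ
  obtain ⟨C, N, hC, hb⟩ := exists_semiMap_tr_weight s a
  refine ⟨‖L‖ * C, N, by positivity, fun x => ?_⟩
  rw [hL, mul_assoc]
  exact (L.le_opNorm _).trans (by gcongr; exact hb x)

/-- Averages against the heat kernel converge as the time tends to zero. -/
lemma tendsto_avg_pker {u : Space d → ℝ} (hu : Continuous u) {C : ℝ} {N : ℕ}
    (hb : ∀ x, |u x| ≤ C * (1 + ‖x‖) ^ N) (x : Space d) {c : ℕ → ℝ} (hc0 : ∀ n, 0 ≤ c n)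
    (hc1 : ∀ n, c n ≤ 1) (hc : Filter.Tendsto c Filter.atTop (nhds 0)) :
    Filter.Tendsto (fun n => avg volume (pker d) (dil (c n)) u x) Filter.atTop (nhds (u x)) := by
  have h0 : u x = ∫ v, pker d v * u x := by rw [integral_mul_const, integral_pker, one_mul]
  have hC : 0 ≤ C := by simpa using (abs_nonneg _).trans (hb 0)
  rw [h0]
  refine tendsto_integral_of_dominated_convergence
    (fun v => C * (1 + ‖x‖) ^ N * ((1 + ‖v‖) ^ N * ‖pker d v‖)) (fun n => ?_) ?_ (fun n => ?_) ?_
  · exact ((pker d).continuous.mul (hu.comp (continuous_const.add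
      (continuous_dil _)))).aestronglyMeasurable
  · exact (integrable_weight_schwartz (pker d) N).const_mul _
  · refine Filter.Eventually.of_forall fun v => ?_
    rw [norm_mul, Real.norm_eq_abs (u _)]
    calc ‖pker d v‖ * |u (x + dil (c n) v)| ≤
          ‖pker d v‖ * (C * ((1 + ‖x‖) ^ N * (1 + ‖v‖) ^ N)) := by
          gcongr
          refine (hb _).trans ?_
          gcongr
          refine (weight_add_le _ _ _).trans ?_
          gcongr
          exact norm_dil_le (hc0 n) (hc1 n) v
      _ = _ := by ring
  · refine Filter.Eventually.of_forall fun v => Filter.Tendsto.const_mul _ ?_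
    refine hu.continuousAt.tendsto.comp ?_
    have h1 : Filter.Tendsto (fun n => dil (c n) v) Filter.atTop (nhds 0) := by
      refine squeeze_zero_norm (fun n => norm_dil_le_mul (hc0 n) (hc1 n) v) ?_
      simpa using hc.mul_const ‖v‖
    simpa using h1.const_add x

lemma heatKernel_eq_tr {t : ℝ} (ht : 0 < t) (x : Space d) :
    heatKernel t ht x = tr x (heatKernel t ht 0) := by
  ext y
  simp [heatKernel, tr]

/-- A sequence of scales that tends to zero. -/
lemma tendsto_scale : Filter.Tendsto (fun n : ℕ => (1 : ℝ) / (n + 1)) Filter.atTop (nhds 0) :=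
  tendsto_one_div_add_atTop_nhds_zero_nat

lemma scale_pos (n : ℕ) : (0 : ℝ) < 1 / (n + 1) := by positivity

lemma scale_le_one (n : ℕ) : (1 : ℝ) / (n + 1) ≤ 1 := by
  rw [div_le_one (by positivity)]
  linarith [(Nat.cast_nonneg n : (0 : ℝ) ≤ n)]

/-- Compactly supported functions are dense. -/
lemma exists_cutoff (a : 𝓢(Space d, ℝ)) (s : Finset (ℕ × ℕ)) : ∃ C : ℝ, ∀ n : ℕ,
    ∃ b : 𝓢(Space d, ℝ), HasCompactSupport b ∧ ‖semiMap d s (a - b)‖ ≤ C * (1 / (n + 1)) := by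
  let f : ContDiffBump (0 : Space d) := ⟨1, 2, one_pos, one_lt_two⟩
  have hf : HasCompactSupport (f : Space d → ℝ) := f.hasCompactSupport
  have hfs : ContDiff ℝ ∞ (f : Space d → ℝ) := f.contDiff
  let fS := hf.toSchwartzMap hfs
  have hfb : ∀ i, ∃ D : ℝ, 0 ≤ D ∧ ∀ z, ‖iteratedFDeriv ℝ i (fun z => 1 - f z) z‖ ≤ D := fun i => by
    refine ⟨‖iteratedFDeriv ℝ i (fun _ : Space d => (1 : ℝ)) 0‖ +
      SchwartzMap.seminorm ℝ 0 i fS, add_nonneg (norm_nonneg _) (apply_nonneg _ _), fun z => ?_⟩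
    have h1 : (fun z => 1 - f z) = (fun _ : Space d => (1 : ℝ)) - (f : Space d → ℝ) := rfl
    rw [h1, iteratedFDeriv_sub_apply contDiffAt_const (hfs.of_le (by exact_mod_cast le_top)).contDiffAt]
    refine (norm_sub_le _ _).trans (add_le_add (le_of_eq ?_) ?_)
    · rcases i with _ | i
      · simp
      · rw [iteratedFDeriv_const_of_ne (by simp)]
        rfl
    · have := le_seminorm ℝ 0 i fS z
      rw [pow_zero, one_mul] at this
      exact this
  choose D hD0 hD using hfb
  set A : ℕ × ℕ → ℝ := fun i => ∑ j ∈ Finset.range (i.2 + 1), (i.2.choose j : ℝ) * D j *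
    SchwartzMap.seminorm ℝ (i.1 + 1) (i.2 - j) a with hA
  have hA0 : ∀ i, 0 ≤ A i := fun i => Finset.sum_nonneg fun j _ =>
    mul_nonneg (mul_nonneg (by positivity) (hD0 j)) (apply_nonneg _ _)
  refine ⟨∑ i ∈ s, A i, fun n => ?_⟩
  set r : ℝ := 1 / (n + 1) with hr
  have hr0 : 0 < r := scale_pos n
  have hr1 : r ≤ 1 := scale_le_one n
  have hfr : ContDiff ℝ ∞ (fun z : Space d => f (r • z)) := hfs.comp (contDiff_const_smul r)
  have hcs : HasCompactSupport (fun z : Space d => f (r • z)) :=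
    hf.comp_smul hr0.ne'
  have hbs : HasCompactSupport (fun z => f (r • z) * a z) := hcs.mul_right
  let b := hbs.toSchwartzMap (hfr.mul (a.smooth ⊤))
  refine ⟨b, hbs, norm_semiMap_le s _
    (mul_nonneg (Finset.sum_nonneg fun i _ => hA0 i) hr0.le) fun i hi => ?_⟩
  have h1 : A i ≤ ∑ i ∈ s, A i := Finset.single_le_sum (fun i _ => hA0 i) hi
  refine le_trans ?_ (mul_le_mul_of_nonneg_right h1 hr0.le)
  refine seminorm_le_bound ℝ _ _ _ (mul_nonneg (hA0 i) hr0.le) fun y => ?_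
  have hg : (⇑(a - b) : Space d → ℝ) = fun z => (1 - f (r • z)) * a z := by
    funext z
    change a z - f (r • z) * a z = _
    ring
  by_cases hy : ‖r • y‖ < 1
  · have hev : (⇑(a - b) : Space d → ℝ) =ᶠ[nhds y] fun _ => 0 := by
      have hopen : IsOpen {z : Space d | ‖r • z‖ < 1} :=
        isOpen_lt (by fun_prop) continuous_const
      filter_upwards [hopen.mem_nhds hy] with z hz
      rw [hg]
      have : f (r • z) = 1 := f.one_of_mem_closedBall (by
        rw [mem_closedBall_zero_iff]
        exact (le_of_lt hz : ‖r • z‖ ≤ 1))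
      simp [this]
    rw [(hev.iteratedFDeriv ℝ i.2).eq_of_nhds]
    have h0 : iteratedFDeriv ℝ i.2 (fun _ : Space d => (0 : ℝ)) y = 0 := by
      have := iteratedFDeriv_fun_zero (𝕜 := ℝ) (E := Space d) (F := ℝ) (n := i.2)
      exact congrFun this y
    rw [h0, norm_zero, mul_zero]
    exact mul_nonneg (hA0 i) hr0.le
  -- Where the cutoff may differ from one, `r * ‖y‖ ≥ 1`. Inserting this factor produces the rate
  -- `r` at the cost of one more power of `‖y‖`, whence the seminorms of index `i.1 + 1` in `A`.
  · rw [not_lt, norm_smul, Real.norm_of_nonneg hr0.le] at hy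
    have hm := norm_iteratedFDeriv_mul_le (𝕜 := ℝ) (N := ∞)
      (f := fun z : Space d => 1 - f (r • z)) (g := a)
      (contDiff_const.sub hfr) (a.smooth ⊤) y (n := i.2) (by exact_mod_cast le_top)
    rw [hg]
    calc ‖y‖ ^ i.1 * _ ≤ ‖y‖ ^ i.1 * ∑ j ∈ Finset.range (i.2 + 1), (i.2.choose j : ℝ) * D j *
            ‖iteratedFDeriv ℝ (i.2 - j) a y‖ := by
          refine mul_le_mul_of_nonneg_left (hm.trans ?_) (by positivity)
          gcongr with j hj
          have := congrFun (iteratedFDeriv_comp_const_smul (𝕜 := ℝ)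
            (f := fun z : Space d => 1 - f z) (i := j) r
            ((contDiff_const.sub hfs).of_le (by exact_mod_cast le_top))) y
          rw [this, norm_smul, norm_pow, Real.norm_of_nonneg hr0.le]
          calc _ ≤ 1 * D j := by
                gcongr
                · exact pow_le_one₀ hr0.le hr1
                · exact hD j _
            _ = D j := one_mul _
      _ ≤ (r * ‖y‖) * (‖y‖ ^ i.1 * ∑ j ∈ Finset.range (i.2 + 1), (i.2.choose j : ℝ) * D j *
            ‖iteratedFDeriv ℝ (i.2 - j) a y‖) := by
          refine le_mul_of_one_le_left (mul_nonneg (by positivity) ?_) hy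
          exact Finset.sum_nonneg fun j _ => mul_nonneg (mul_nonneg (by positivity) (hD0 j))
            (norm_nonneg _)
      _ = (∑ j ∈ Finset.range (i.2 + 1), (i.2.choose j : ℝ) * D j *
            (‖y‖ ^ (i.1 + 1) * ‖iteratedFDeriv ℝ (i.2 - j) a y‖)) * r := by
          rw [Finset.mul_sum, Finset.mul_sum, Finset.sum_mul]
          refine Finset.sum_congr rfl fun j _ => ?_
          ring
      _ ≤ _ := by
          refine mul_le_mul_of_nonneg_right (Finset.sum_le_sum fun j _ => ?_) hr0.le
          exact mul_le_mul_of_nonneg_left (le_seminorm ℝ _ _ a y)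
            (mul_nonneg (by positivity) (hD0 j))

/-- A distribution whose heat averages tend to zero locally uniformly vanishes. -/
lemma tdist_eq_zero (Λ : TDist d) {β : ℝ} (hβ : 0 < β)
    (h : ∀ Q : Set (Space d), IsCompact Q → ∃ C : ℝ, ∀ x ∈ Q, ∀ (t : ℝ) (ht : 0 < t), t ≤ 1 →
      |Λ (heatKernel t ht x)| ≤ C * t ^ β) : Λ = 0 := by
  have hcomp : ∀ a : 𝓢(Space d, ℝ), HasCompactSupport a → Λ a = 0 := fun a ha => by
    obtain ⟨C, hC⟩ := h (tsupport a) ha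
    -- By `integral_tdist_tr_comm` at time `c n ^ 4`, the integral of `a(x) Λ(p_t(x, ·))` equals the
    -- heat average at `0` of the continuous function `x ↦ Λ(a(· - x))`. The latter tends to `Λ a`.
    -- The former tends to zero by hypothesis, used on the compact support of `a`.
    set c : ℕ → ℝ := fun n => 1 / (n + 1) with hc
    have hc4 : ∀ n, 0 < c n ^ 4 := fun n => pow_pos (scale_pos n) 4
    obtain ⟨D, N, hD, hb⟩ := exists_tdist_tr_bound Λ a
    have h1 := tendsto_avg_pker (continuous_tdist_tr Λ a) hb 0 (fun n => (scale_pos n).le)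
      scale_le_one tendsto_scale
    have h2 : ∀ n, avg volume (pker d) (dil (c n)) (fun x => Λ (tr x a)) 0 =
        ∫ x, a x * Λ (heatKernel (c n ^ 4) (hc4 n) x) := fun n => by
      rw [← integral_heatKernel (scale_pos n) rfl (hc4 n)]
      have h3 : (fun x => a x * Λ (heatKernel (c n ^ 4) (hc4 n) x)) =
          fun x => a x * Λ (tr x (heatKernel (c n ^ 4) (hc4 n) 0)) := funext fun x => by
        rw [heatKernel_eq_tr (hc4 n)]
      rw [h3, integral_tdist_tr_comm]
      congr 1
      funext y
      rw [mul_comm]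
    have h3 : ∀ n, ‖∫ x, a x * Λ (heatKernel (c n ^ 4) (hc4 n) x)‖ ≤
        (|C| * ∫ x, ‖a x‖) * (c n ^ 4) ^ β := fun n => by
      have hle : ∀ x, ‖a x * Λ (heatKernel (c n ^ 4) (hc4 n) x)‖ ≤
          (|C| * (c n ^ 4) ^ β) * ‖a x‖ := fun x => by
        rw [norm_mul, mul_comm]
        by_cases hx : x ∈ tsupport a
        · gcongr
          refine (hC x hx _ (hc4 n) (pow_le_one₀ (scale_pos n).le (scale_le_one n))).trans ?_
          exact mul_le_mul_of_nonneg_right (le_abs_self C) (Real.rpow_nonneg (hc4 n).le _)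
        · simp [image_eq_zero_of_notMem_tsupport hx]
      calc _ ≤ ∫ x, (|C| * (c n ^ 4) ^ β) * ‖a x‖ :=
            norm_integral_le_of_norm_le (a.integrable.norm.const_mul _)
              (Filter.Eventually.of_forall hle)
        _ = _ := by rw [integral_const_mul]; ring
    have h4 : Filter.Tendsto (fun n => (|C| * ∫ x, ‖a x‖) * (c n ^ 4) ^ β) Filter.atTop
        (nhds 0) := by
      have h5 : Filter.Tendsto (fun n => c n ^ 4) Filter.atTop (nhds 0) := by
        have := tendsto_scale.pow 4
        rwa [zero_pow (by norm_num)] at this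
      have h6 := (Real.continuousAt_rpow_const 0 β (Or.inr hβ.le)).tendsto.comp h5
      rw [Real.zero_rpow hβ.ne'] at h6
      simpa using h6.const_mul (|C| * ∫ x, ‖a x‖)
    have h7 := squeeze_zero_norm h3 h4
    have h8 := tendsto_nhds_unique (h1.congr h2) h7
    rwa [tr, compSubConstCLM_zero] at h8
  obtain ⟨s, L, hL⟩ := exists_factor Λ
  ext a
  obtain ⟨C, hC⟩ := exists_cutoff a s
  -- The hypothesis is local, so a general `a` is approximated by compactly supported functions in
  -- the seminorms that control `Λ`.
  have h1 : ∀ n : ℕ, ‖Λ a‖ ≤ ‖L‖ * C * (1 / (n + 1)) := fun n => by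
    obtain ⟨b, hb, hab⟩ := hC n
    have : Λ a = L (semiMap d s (a - b)) := by rw [← hL, map_sub, hcomp b hb, sub_zero]
    rw [this, mul_assoc]
    exact (L.le_opNorm _).trans (by gcongr)
  have h2 : Filter.Tendsto (fun n : ℕ => ‖L‖ * C * ((1 : ℝ) / (n + 1))) Filter.atTop (nhds 0) := by
    simpa using tendsto_scale.const_mul (‖L‖ * C)
  have h3 := ge_of_tendsto' h2 h1
  simpa using h3

end Temperate

/-! ## Expansions of the coaction -/

namespace RegStructure

variable {B T Tp : Type*} [AddCommGroup T] [Module ℝ T] [CommRing Tp] [Bialgebra ℝ Tp]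

lemma pairRight_tmul {V W U : Type*} [AddCommGroup V] [Module ℝ V] [AddCommGroup W] [Module ℝ W]
    [AddCommGroup U] [Module ℝ U] (f : V →ₗ[ℝ] U) (h : W →ₗ[ℝ] ℝ) (v : V) (w : W) :
    pairRight f h (v ⊗ₜ[ℝ] w) = h w • f v := by
  simp [pairRight]

lemma pairRight_comp {V W U U' : Type*} [AddCommGroup V] [Module ℝ V] [AddCommGroup W]
    [Module ℝ W] [AddCommGroup U] [Module ℝ U] [AddCommGroup U'] [Module ℝ U'] (f : V →ₗ[ℝ] U)
    (e : U →ₗ[ℝ] U') (h : W →ₗ[ℝ] ℝ) (z : V ⊗[ℝ] W) :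
    pairRight (e ∘ₗ f) h z = e (pairRight f h z) := by
  induction z with
  | zero => simp
  | tmul v w => simp [pairRight_tmul]
  | add x y hx hy => rw [map_add, map_add, map_add, hx, hy]

variable (S : RegStructure B T Tp)

/-- The basis elements of homogeneity at most `c`. -/
def fin (c : ℝ) : Finset B := (S.finite_deg_le c).toFinset

lemma mem_fin {c : ℝ} {b : B} : b ∈ S.fin c ↔ S.deg b ≤ c := by simp [fin]

/-- Only finitely many basis elements lie below any level, and their number strictly decreases with
the homogeneity. This founds every recursion on homogeneity below. -/
lemma wf_deg : WellFounded fun σ τ : B => S.deg σ < S.deg τ := by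
  refine Subrelation.wf (r := InvImage (· < ·) fun b => (S.fin (S.deg b)).card) (fun {σ τ} h => ?_)
    (InvImage.wf _ wellFounded_lt)
  refine Finset.card_lt_card ⟨fun b hb => ?_, fun hsub => ?_⟩
  · exact S.mem_fin.2 ((S.mem_fin.1 hb).trans h.le)
  · exact absurd (S.mem_fin.1 (hsub (S.mem_fin.2 le_rfl))) (not_le.2 h)

lemma deg_induction {p : B → Prop} (h : ∀ τ, (∀ σ, S.deg σ < S.deg τ → p σ) → p τ) (τ : B) : p τ :=
  S.wf_deg.induction τ h

lemma exists_rec {V : Type*} (F : (τ : B) → ((σ : B) → S.deg σ < S.deg τ → V) → V) :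
    ∃ f : B → V, ∀ τ, f τ = F τ fun σ _ => f σ :=
  ⟨S.wf_deg.fix F, fun τ => S.wf_deg.fix_eq F τ⟩

/-- The coefficient of `σ` in an element of `T ⊗ T⁺`. -/
def coeff (σ : B) : T ⊗[ℝ] Tp →ₗ[ℝ] Tp :=
  (TensorProduct.lid ℝ Tp).toLinearMap ∘ₗ (S.basis.coord σ).rTensor Tp

lemma coeff_tmul (σ : B) (v : T) (u : Tp) : S.coeff σ (v ⊗ₜ[ℝ] u) = S.basis.repr v σ • u := by
  simp [coeff]

/-- Both claims are linear in the element of `T ⊗ T⁺`, so they need only be checked on pure tensors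
of homogeneous elements. The vanishing of `T⁺` in negative degrees confines `σ` to a finite set. -/
lemma expansion (τ : B) : S.Δ (S.basis τ) =
      ∑ σ ∈ S.fin (S.deg τ), S.basis σ ⊗ₜ[ℝ] S.coeff σ (S.Δ (S.basis τ)) ∧
    ∀ σ, S.coeff σ (S.Δ (S.basis τ)) ∈ S.gradeP (S.deg τ - S.deg σ) := by
  classical
  refine Submodule.iSup_induction
    (motive := fun z => z = ∑ σ ∈ S.fin (S.deg τ), S.basis σ ⊗ₜ[ℝ] S.coeff σ z ∧
      ∀ σ, S.coeff σ z ∈ S.gradeP (S.deg τ - S.deg σ)) _ (S.graded τ) ?_ ?_ ?_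
  · rintro α z ⟨w, rfl⟩
    induction w with
    | zero => simp
    | add x y hx hy =>
      rw [map_add]
      refine ⟨?_, fun σ => by rw [map_add]; exact Submodule.add_mem _ (hx.2 σ) (hy.2 σ)⟩
      conv_lhs => rw [hx.1, hy.1, ← Finset.sum_add_distrib]
      exact Finset.sum_congr rfl fun σ _ => by rw [map_add, TensorProduct.tmul_add]
    | tmul v u =>
      obtain ⟨v, hv⟩ := v
      obtain ⟨u, hu⟩ := u
      simp only [TensorProduct.map_tmul, Submodule.subtype_apply]
      induction hv using Submodule.span_induction with
      | zero => simp
      | add x y _ _ hx hy =>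
        rw [TensorProduct.add_tmul]
        refine ⟨?_, fun σ => by rw [map_add]; exact Submodule.add_mem _ (hx.2 σ) (hy.2 σ)⟩
        conv_lhs => rw [hx.1, hy.1, ← Finset.sum_add_distrib]
        exact Finset.sum_congr rfl fun σ _ => by rw [map_add, TensorProduct.tmul_add]
      | smul a x _ hx =>
        rw [← TensorProduct.smul_tmul']
        refine ⟨?_, fun σ => by rw [map_smul]; exact Submodule.smul_mem _ _ (hx.2 σ)⟩
        conv_lhs => rw [hx.1, Finset.smul_sum]
        exact Finset.sum_congr rfl fun σ _ => by rw [map_smul, TensorProduct.tmul_smul]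
      | mem x hx =>
        obtain ⟨b, hb, rfl⟩ := hx
        have hc : ∀ σ, S.coeff σ (S.basis b ⊗ₜ[ℝ] u) = if b = σ then u else 0 := fun σ => by
          rw [coeff_tmul, Module.Basis.repr_self, Finsupp.single_apply]
          split_ifs <;> simp
        simp_rw [hc]
        refine ⟨?_, fun σ => ?_⟩
        · by_cases hα : α < 0
          · have : u = 0 := by
              rw [S.gradeP_neg α hα] at hu
              exact hu
            simp [this]
          · have hmem : b ∈ S.fin (S.deg τ) := S.mem_fin.2 (by
              rw [show S.deg b = S.deg τ - α from hb]
              linarith)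
            rw [Finset.sum_eq_single b (fun σ _ hσ => by rw [if_neg (Ne.symm hσ)]; simp)
              (fun h => absurd hmem h), if_pos rfl]
        · split_ifs with h
          · subst h
            rw [show S.deg b = S.deg τ - α from hb, sub_sub_cancel]
            exact hu
          · exact Submodule.zero_mem _
  · simp
  · intro x y hx hy
    refine ⟨?_, fun σ => by rw [map_add]; exact Submodule.add_mem _ (hx.2 σ) (hy.2 σ)⟩
    conv_lhs => rw [hx.1, hy.1, ← Finset.sum_add_distrib]
    exact Finset.sum_congr rfl fun σ _ => by rw [map_add, TensorProduct.tmul_add]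

lemma Δ_basis (τ : B) :
    S.Δ (S.basis τ) = ∑ σ ∈ S.fin (S.deg τ), S.basis σ ⊗ₜ[ℝ] S.quot τ σ :=
  (S.expansion τ).1

lemma quot_mem (τ σ : B) : S.quot τ σ ∈ S.gradeP (S.deg τ - S.deg σ) := (S.expansion τ).2 σ

-- Connectedness makes `τ/σ` a multiple of `1`, and the counit axiom finds the multiple. So `Δ` is
-- unipotent with respect to homogeneity.
open Classical in
lemma quot_of_deg_eq {τ σ : B} (h : S.deg σ = S.deg τ) :
    S.quot τ σ = if σ = τ then 1 else 0 := by
  have h1 := S.quot_mem τ σ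
  rw [h, sub_self, S.gradeP_zero, Submodule.mem_span_singleton] at h1
  obtain ⟨c, hc⟩ := h1
  have h2 := LinearMap.congr_fun S.counit (S.basis τ)
  simp only [LinearMap.coe_comp, Function.comp_apply, S.Δ_basis, map_sum, LinearMap.lTensor_tmul,
    LinearEquiv.coe_coe, TensorProduct.rid_tmul, LinearMap.id_apply] at h2
  have h3 := congrArg (fun v => S.basis.repr v σ) h2
  simp only [map_sum, map_smul, Module.Basis.repr_self, Finsupp.coe_finsetSum,
    Finset.sum_apply, Finsupp.smul_single, smul_eq_mul, mul_one, Finsupp.single_apply] at h3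
  rw [Finset.sum_ite_eq', if_pos (S.mem_fin.2 h.le), ← hc, map_smul, Bialgebra.counit_one,
    smul_eq_mul, mul_one] at h3
  rw [← hc, h3]
  by_cases hστ : σ = τ
  · simp [hστ]
  · simp [hστ, Ne.symm hστ]

lemma quot_self (τ : B) : S.quot τ τ = 1 := by
  rw [S.quot_of_deg_eq rfl, if_pos rfl]

/-- The basis elements of homogeneity smaller than that of `τ`. -/
def low (τ : B) : Finset B := (S.fin (S.deg τ)).filter fun σ => S.deg σ < S.deg τ

lemma mem_low {τ σ : B} : σ ∈ S.low τ ↔ S.deg σ < S.deg τ := by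
  simp only [low, Finset.mem_filter, mem_fin, and_iff_right_iff_imp]
  exact le_of_lt

/-- A sum over the basis elements that occur in `Δ τ`, with the diagonal term apart. -/
lemma sum_fin_eq {M : Type*} [AddCommMonoid M] (τ : B) (F : B → Tp → M)
    (hF : ∀ σ, F σ 0 = 0) :
    ∑ σ ∈ S.fin (S.deg τ), F σ (S.quot τ σ) = F τ 1 + ∑ σ ∈ S.low τ, F σ (S.quot τ σ) := by
  classical
  rw [← Finset.sum_filter_add_sum_filter_not (S.fin (S.deg τ)) fun σ => S.deg σ < S.deg τ,
    add_comm]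
  congr 1
  rw [Finset.sum_eq_single τ]
  · rw [quot_self]
  · intro σ hσ hne
    rw [Finset.mem_filter, mem_fin, not_lt] at hσ
    rw [S.quot_of_deg_eq (le_antisymm hσ.1 hσ.2), if_neg hne, hF]
  · intro h
    exact absurd (by simp [mem_fin]) h

/-- The action `(Id ⊗ h) Δ` of a linear functional on `T`. -/
def act (h : Tp →ₗ[ℝ] ℝ) : T →ₗ[ℝ] T := pairRight LinearMap.id h ∘ₗ S.Δ

lemma pairRight_Δ {U : Type*} [AddCommGroup U] [Module ℝ U] (f : T →ₗ[ℝ] U) (h : Tp →ₗ[ℝ] ℝ)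
    (v : T) : pairRight f h (S.Δ v) = f (S.act h v) := by
  rw [act, LinearMap.comp_apply, ← pairRight_comp, LinearMap.comp_id]

lemma act_basis (h : Tp →ₗ[ℝ] ℝ) (τ : B) :
    S.act h (S.basis τ) = ∑ σ ∈ S.fin (S.deg τ), h (S.quot τ σ) • S.basis σ := by
  rw [act, LinearMap.comp_apply, Δ_basis, map_sum]
  exact Finset.sum_congr rfl fun σ _ => by rw [pairRight_tmul, LinearMap.id_apply]

lemma act_eq_add_low {h : Tp →ₗ[ℝ] ℝ} (h1 : h 1 = 1) (τ : B) :
    S.act h (S.basis τ) = S.basis τ + ∑ σ ∈ S.low τ, h (S.quot τ σ) • S.basis σ := by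
  rw [act_basis, S.sum_fin_eq τ (fun σ u => h u • S.basis σ) (by simp), h1, one_smul]

/-- Characters of `T⁺`, with the convolution product. -/
abbrev Chr (Tp : Type*) [CommRing Tp] [Bialgebra ℝ Tp] : Type _ := WithConv (Tp →ₐ[ℝ] ℝ)

/-- The linear functional of a character. -/
abbrev lin (h : Chr Tp) : Tp →ₗ[ℝ] ℝ := h.ofConv.toLinearMap

lemma mul_apply (h k : Chr Tp) (u : Tp) :
    (h * k).ofConv u = LinearMap.mul' ℝ ℝ (TensorProduct.map (lin h) (lin k)
      (Coalgebra.comul (R := ℝ) u)) := rfl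

/-- Coassociativity: pairing the two copies of `T⁺` with `h ⊗ k` can be done at once or one after
the other. A right comodule thus becomes a left module over the characters. -/
lemma act_mul (h k : Chr Tp) (v : T) : S.act (lin (h * k)) v = S.act (lin h) (S.act (lin k) v) := by
  let m : Tp ⊗[ℝ] Tp →ₗ[ℝ] ℝ := LinearMap.mul' ℝ ℝ ∘ₗ TensorProduct.map (lin h) (lin k)
  have h1 : ∀ (u : Tp) (z : T ⊗[ℝ] Tp), pairRight LinearMap.id m
      (TensorProduct.assoc ℝ T Tp Tp (z ⊗ₜ[ℝ] u)) = lin k u • pairRight LinearMap.id (lin h) z := by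
    intro u z
    induction z with
    | zero => simp
    | tmul t w => simp [pairRight_tmul, m, smul_smul, mul_comm]
    | add x y hx hy => rw [TensorProduct.add_tmul, map_add, map_add, hx, hy, map_add, smul_add]
  have h2 : ∀ z : T ⊗[ℝ] Tp, pairRight LinearMap.id m
      (TensorProduct.assoc ℝ T Tp Tp (S.Δ.rTensor Tp z)) = pairRight (S.act (lin h)) (lin k) z := by
    intro z
    induction z with
    | zero => simp
    | tmul t w => rw [LinearMap.rTensor_tmul, h1, pairRight_tmul]; rfl
    | add x y hx hy => simp only [map_add, hx, hy]
  have h3 : ∀ z : T ⊗[ℝ] Tp, pairRight LinearMap.id m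
      ((Coalgebra.comul (R := ℝ) (A := Tp)).lTensor T z) =
        pairRight LinearMap.id (lin (h * k)) z := by
    intro z
    induction z with
    | zero => simp
    | tmul t w => rw [LinearMap.lTensor_tmul, pairRight_tmul, pairRight_tmul]; rfl
    | add x y hx hy => simp only [map_add, hx, hy]
  have h4 := congrArg (pairRight LinearMap.id m) (LinearMap.congr_fun S.coassoc v)
  simp only [LinearMap.comp_apply] at h4
  rw [h3] at h4
  have h5 := h2 (S.Δ v)
  rw [← pairRight_Δ]
  rw [← h5]
  exact h4.symm

lemma act_one (v : T) : S.act (lin (1 : Chr Tp)) v = v := by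
  have h1 := LinearMap.congr_fun S.counit v
  simp only [LinearMap.comp_apply, LinearMap.id_apply] at h1
  have h2 : ∀ z : T ⊗[ℝ] Tp, pairRight LinearMap.id (lin (1 : Chr Tp)) z =
      (TensorProduct.rid ℝ T).toLinearMap ((Coalgebra.counit (R := ℝ) (A := Tp)).lTensor T z) := by
    intro z
    induction z with
    | zero => simp
    | tmul t w => rw [pairRight_tmul]; simp
    | add x y hx hy => simp only [map_add, hx, hy]
  rw [act, LinearMap.comp_apply, h2, h1]

/-- A property of pairs of degrees and elements that passes from homogeneous generators to the
homogeneous elements of the algebra that they generate. -/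
lemma graded_adjoin {p : ℝ → Tp → Prop} (h0 : ∀ α, p α 0)
    (hadd : ∀ α u v, p α u → p α v → p α (u + v)) (hsmul : ∀ α (c : ℝ) u, p α u → p α (c • u))
    (hone : p 0 1) (hmul : ∀ α β u v, 0 ≤ α → 0 ≤ β → p α u → p β v → p (α + β) (u * v))
    {s : Set Tp} (hs : ∀ u ∈ s, ∃ α, u ∈ S.gradeP α ∧ p α u) {u : Tp}
    (hu : u ∈ Algebra.adjoin ℝ s) {α : ℝ} (hα : u ∈ S.gradeP α) : p α u := by
  classical
  -- The sum of the `N α` is closed under products and contains `1` and `s`, hence `u`. As the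
  -- grading is direct, the homogeneous `u` equals its component of degree `α`, which lies in `N α`.
  let N : ℝ → Submodule ℝ Tp := fun α =>
    { carrier := {u | u ∈ S.gradeP α ∧ p α u}
      zero_mem' := ⟨Submodule.zero_mem _, h0 α⟩
      add_mem' := fun {u v} hu hv => ⟨Submodule.add_mem _ hu.1 hv.1, hadd α u v hu.2 hv.2⟩
      smul_mem' := fun c u hu => ⟨Submodule.smul_mem _ c hu.1, hsmul α c u hu.2⟩ }
  have hN : ∀ α u, u ∈ N α ↔ u ∈ S.gradeP α ∧ p α u := fun α u => Iff.rfl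
  have hone' : (1 : Tp) ∈ ⨆ α, N α := Submodule.mem_iSup_of_mem 0 ((hN _ _).2
    ⟨by rw [S.gradeP_zero]; exact Submodule.mem_span_singleton_self 1, hone⟩)
  have hmul' : ∀ u ∈ ⨆ α, N α, ∀ v ∈ ⨆ α, N α, u * v ∈ ⨆ α, N α := by
    intro u hu v hv
    refine Submodule.iSup_induction (motive := fun u => u * v ∈ ⨆ α, N α) N hu ?_ (by simp)
      fun x y hx hy => by rw [add_mul]; exact Submodule.add_mem _ hx hy
    intro α u hu
    refine Submodule.iSup_induction (motive := fun v => u * v ∈ ⨆ α, N α) N hv ?_ (by simp)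
      fun x y hx hy => by rw [mul_add]; exact Submodule.add_mem _ hx hy
    intro β v hv
    rcases lt_or_ge α 0 with hα | hα
    · have : u = 0 := by simpa [S.gradeP_neg α hα] using hu.1
      simp [this]
    rcases lt_or_ge β 0 with hβ | hβ
    · have : v = 0 := by simpa [S.gradeP_neg β hβ] using hv.1
      simp [this]
    exact Submodule.mem_iSup_of_mem (α + β) ((hN _ _).2
      ⟨S.gradeP_mul α β u hu.1 v hv.1, hmul α β u v hα hβ hu.2 hv.2⟩)
  have hsup : u ∈ ⨆ α, N α := by
    clear hα
    induction hu using Algebra.adjoin_induction with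
    | mem x hx =>
      obtain ⟨α, h1, h2⟩ := hs x hx
      exact Submodule.mem_iSup_of_mem α ((hN _ _).2 ⟨h1, h2⟩)
    | algebraMap r =>
      rw [Algebra.algebraMap_eq_smul_one]
      exact Submodule.smul_mem _ _ hone'
    | add x y _ _ hx hy => exact Submodule.add_mem _ hx hy
    | mul x y _ _ hx hy => exact hmul' _ hx _ hy
  obtain ⟨f, hf, rfl⟩ := (Submodule.mem_iSup_iff_exists_finsupp N u).1 hsup
  have hsplit := Finsupp.add_sum_erase' f α (fun _ x => x) fun _ => rfl
  have hmem : (f.erase α).sum (fun _ x => x) ∈ ⨆ j, ⨆ (_ : j ≠ α), S.gradeP j := by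
    refine Submodule.sum_mem _ fun j hj => ?_
    have hj' : j ≠ α := fun h => by simp [h] at hj
    refine Submodule.mem_iSup_of_mem j (Submodule.mem_iSup_of_mem hj' ?_)
    rw [Finsupp.erase_ne hj']
    exact (hf j).1
  have hzero : (f.erase α).sum (fun _ x => x) = 0 := by
    refine Submodule.disjoint_def.1 (S.gradeP_internal.submodule_iSupIndep α) _ ?_ hmem
    rw [← eq_sub_iff_add_eq'] at hsplit
    rw [hsplit]
    exact Submodule.sub_mem _ hα (hf α).1
  rw [← hsplit, hzero, add_zero]
  exact (hf α).2

end RegStructure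

/-! ## Characters -/

namespace IntSector

open RegStructure Temperate

variable {d : ℕ} {B T Tp : Type*} [AddCommGroup T] [Module ℝ T] [CommRing Tp]
  [Bialgebra ℝ Tp] {S : RegStructure B T Tp} {P : PolySector d S} (J : IntSector S P)

/-- The character with given values on the generators. -/
def mkChar (f : Fin (d + 1) → ℝ) (v : MIdx d → B → ℝ) : Chr Tp :=
  WithConv.toConv ((MvPolynomial.aeval (Sum.elim f fun p => v p.1.2 p.1.1)).comp
    (AlgEquiv.ofBijective _ J.free).symm.toAlgHom)

lemma mkChar_gen (f : Fin (d + 1) → ℝ) (v : MIdx d → B → ℝ) (i : GenIdx d S) :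
    (J.mkChar f v).ofConv (genP P J.Ip i) = Sum.elim f (fun p => v p.1.2 p.1.1) i := by
  have h : (AlgEquiv.ofBijective _ J.free).symm (genP P J.Ip i) = MvPolynomial.X i := by
    rw [AlgEquiv.symm_apply_eq]
    simp
  change MvPolynomial.aeval (Sum.elim f fun p => v p.1.2 p.1.1)
    ((AlgEquiv.ofBijective _ J.free).symm (genP P J.Ip i)) = _
  rw [h, MvPolynomial.aeval_X]

lemma mkChar_Xp (f : Fin (d + 1) → ℝ) (v : MIdx d → B → ℝ) (i : Fin (d + 1)) :
    (J.mkChar f v).ofConv (P.Xp i) = f i := J.mkChar_gen f v (Sum.inl i)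

lemma mkChar_Ip (f : Fin (d + 1) → ℝ) (v : MIdx d → B → ℝ) {n : MIdx d} {b : B}
    (h : (sdeg n : ℝ) < S.deg b + 2) : (J.mkChar f v).ofConv (J.Ip n (S.basis b)) = v n b :=
  J.mkChar_gen f v (Sum.inr ⟨(b, n), h⟩)

lemma adjoin_gen : Algebra.adjoin ℝ
    (Set.range P.Xp ∪ {u | ∃ n b, u = J.Ip n (S.basis b)}) = ⊤ := by
  refine top_le_iff.1 ?_
  have h1 : Algebra.adjoin ℝ (Set.range (genP P J.Ip)) = ⊤ := by
    rw [Algebra.adjoin_range_eq_range_aeval]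
    exact AlgHom.range_eq_top _ |>.2 J.free.2
  rw [← h1]
  refine Algebra.adjoin_mono ?_
  rintro _ ⟨i | p, rfl⟩
  · exact Or.inl ⟨i, rfl⟩
  · exact Or.inr ⟨p.1.2, p.1.1, rfl⟩

lemma Ip_zero_of_le {n : MIdx d} {b : B} (h : ¬(sdeg n : ℝ) < S.deg b + 2) :
    J.Ip n (S.basis b) = 0 := J.Ip_eq_zero n b (not_lt.1 h)

lemma chr_ext {h k : Chr Tp} (hX : ∀ i, h.ofConv (P.Xp i) = k.ofConv (P.Xp i))
    (hI : ∀ n b, (sdeg n : ℝ) < S.deg b + 2 →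
      h.ofConv (J.Ip n (S.basis b)) = k.ofConv (J.Ip n (S.basis b))) : h = k := by
  refine WithConv.ofConv_injective (AlgHom.ext_of_adjoin_eq_top J.adjoin_gen ?_)
  rintro _ (⟨i, rfl⟩ | ⟨n, b, rfl⟩)
  · exact hX i
  · by_cases hn : (sdeg n : ℝ) < S.deg b + 2
    · exact hI n b hn
    · rw [J.Ip_zero_of_le hn]
      simp

/-- Characters that agree on the generators below `τ` agree on all `τ/σ`. -/
lemma quot_congr (hJ : J.IsInductive) {h k : Chr Tp} {τ : B}
    (hX : ∀ i, h.ofConv (P.Xp i) = k.ofConv (P.Xp i))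
    (hI : ∀ η, S.deg η < S.deg τ → ∀ n,
      h.ofConv (J.Ip n (S.basis η)) = k.ofConv (J.Ip n (S.basis η))) (σ : B) :
    h.ofConv (S.quot τ σ) = k.ofConv (S.quot τ σ) := by
  refine AlgHom.eqOn_adjoin_iff.2 ?_ (hJ τ σ)
  rintro _ (⟨i, rfl⟩ | ⟨n, η, hη, rfl⟩)
  · exact hX i
  · exact hI η hη n

lemma mul_Xp (P : PolySector d S) (h k : Chr Tp) (i : Fin (d + 1)) :
    (h * k).ofConv (P.Xp i) = h.ofConv (P.Xp i) + k.ofConv (P.Xp i) := by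
  rw [mul_apply, P.comul_Xp]
  simp

lemma one_Xp (P : PolySector d S) (i : Fin (d + 1)) : (1 : Chr Tp).ofConv (P.Xp i) = 0 := by
  have := mul_Xp P 1 1 i
  rw [one_mul] at this
  linarith

lemma chr_XpPow (P : PolySector d S) {h : Chr Tp} {x : Space d}
    (hx : ∀ i, h.ofConv (P.Xp i) = x i) (l : MIdx d) :
    h.ofConv (P.XpPow l) = monomialFun l x := by
  simp [PolySector.XpPow, monomialFun, map_prod, hx]

lemma mul_Ip {h : Chr Tp} {x : Space d} (hx : ∀ i, h.ofConv (P.Xp i) = x i) (k : Chr Tp)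
    (n : MIdx d) (b : B) : (h * k).ofConv (J.Ip n (S.basis b)) =
      h.ofConv (J.Ip n (S.act (lin k) (S.basis b))) +
        ∑ l ∈ lowDeg d (S.deg b + 2 - sdeg n), nmon l x * k.ofConv (J.Ip (n + l) (S.basis b)) := by
  have h1 : ∀ z : T ⊗[ℝ] Tp, LinearMap.mul' ℝ ℝ (TensorProduct.map (lin h) (lin k)
      ((J.Ip n).rTensor Tp z)) = h.ofConv (J.Ip n (pairRight LinearMap.id (lin k) z)) := by
    intro z
    induction z with
    | zero => simp
    | tmul t w => simp [pairRight_tmul, mul_comm]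
    | add x y hx hy => simp only [map_add, hx, hy]
  rw [mul_apply, J.comul_Ip, map_add, map_add, h1, map_sum, map_sum]
  congr 1
  refine Finset.sum_congr rfl fun l _ => ?_
  rw [map_smul, map_smul, TensorProduct.map_tmul, LinearMap.mul'_apply, smul_eq_mul, nmon,
    ← chr_XpPow P hx, mul_assoc]
  rfl

lemma nmon_zero_right (l : MIdx d) : nmon l (0 : Space d) = if l = 0 then 1 else 0 := by
  have := mpd_nmon_zero (0 : MIdx d) l
  rwa [mpd_zero] at this

lemma zero_mem_lowDeg {n : MIdx d} {b : B} :
    (0 : MIdx d) ∈ lowDeg d (S.deg b + 2 - sdeg n) ↔ (sdeg n : ℝ) < S.deg b + 2 := by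
  rw [mem_lowDeg, sdeg_zero, Nat.cast_zero, sub_pos]

lemma sum_nmon_zero (k : Chr Tp) (n : MIdx d) (b : B) :
    ∑ l ∈ lowDeg d (S.deg b + 2 - sdeg n), nmon l (0 : Space d) *
      k.ofConv (J.Ip (n + l) (S.basis b)) = k.ofConv (J.Ip n (S.basis b)) := by
  classical
  simp_rw [nmon_zero_right, ite_mul, one_mul, zero_mul]
  rw [Finset.sum_ite_eq', add_zero]
  split_ifs with h
  · rfl
  · rw [zero_mem_lowDeg] at h
    rw [J.Ip_zero_of_le h, map_zero]

/-- The product formula if the first factor vanishes on the polynomials. -/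
lemma mul_Ip_zero {h : Chr Tp} (hx : ∀ i, h.ofConv (P.Xp i) = 0) (k : Chr Tp)
    (n : MIdx d) (b : B) : (h * k).ofConv (J.Ip n (S.basis b)) =
      h.ofConv (J.Ip n (S.act (lin k) (S.basis b))) + k.ofConv (J.Ip n (S.basis b)) := by
  rw [J.mul_Ip (x := 0) (by simpa using hx), J.sum_nmon_zero]

lemma one_Ip (n : MIdx d) (b : B) : (1 : Chr Tp).ofConv (J.Ip n (S.basis b)) = 0 := by
  have := J.mul_Ip_zero (h := 1) (one_Xp P) 1 n b
  rw [one_mul, act_one] at this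
  linarith

/-- The character `transChar`. -/
def tc (x : Space d) : Chr Tp := J.mkChar (fun i => x i) 0

lemma tc_ofConv (x : Space d) : (J.tc x).ofConv = J.transChar x := rfl

lemma tc_Xp (x : Space d) (i : Fin (d + 1)) : (J.tc x).ofConv (P.Xp i) = x i := J.mkChar_Xp _ _ i

lemma tc_Ip (x : Space d) (n : MIdx d) (b : B) : (J.tc x).ofConv (J.Ip n (S.basis b)) = 0 := by
  by_cases h : (sdeg n : ℝ) < S.deg b + 2
  · exact J.mkChar_Ip _ _ h
  · rw [J.Ip_zero_of_le h, map_zero]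

lemma tc_Ip' (x : Space d) (n : MIdx d) (v : T) : (J.tc x).ofConv (J.Ip n v) = 0 := by
  have : (lin (J.tc x)) ∘ₗ J.Ip n = 0 := S.basis.ext fun b => J.tc_Ip x n b
  exact LinearMap.congr_fun this v

lemma tc_mul_Ip (x : Space d) (k : Chr Tp) (n : MIdx d) (b : B) :
    (J.tc x * k).ofConv (J.Ip n (S.basis b)) =
      ∑ l ∈ lowDeg d (S.deg b + 2 - sdeg n), nmon l x * k.ofConv (J.Ip (n + l) (S.basis b)) := by
  rw [J.mul_Ip (J.tc_Xp x), tc_Ip', zero_add]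

lemma tc_add (x y : Space d) : J.tc (x + y) = J.tc x * J.tc y := by
  refine J.chr_ext (fun i => ?_) fun n b _ => ?_
  · rw [mul_Xp, tc_Xp, tc_Xp, tc_Xp]
    rfl
  · rw [tc_mul_Ip, tc_Ip, Finset.sum_eq_zero]
    intro l _
    rw [tc_Ip, mul_zero]

lemma tc_zero : J.tc 0 = 1 := by
  refine J.chr_ext (fun i => ?_) fun n b _ => ?_
  · rw [tc_Xp, one_Xp]
    rfl
  · rw [tc_Ip, one_Ip]

lemma tc_neg_mul (x : Space d) : J.tc (-x) * J.tc x = 1 := by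
  rw [← tc_add, neg_add_cancel, tc_zero]

lemma tc_mul_neg (x : Space d) : J.tc x * J.tc (-x) = 1 := by
  rw [← tc_add, add_neg_cancel, tc_zero]

/-- `T⁺` is free, so values on generators may be prescribed. The equation `(h * g)(I⁺ₙ τ) = 0`
contains `h(I⁺ₙ τ)` with coefficient one and otherwise only values of `h` on `X₊` and on `I⁺ₙ σ`
with `|σ| < |τ|`; it is solved recursively. The conditional drops those `σ` for which `I⁺ₙ σ = 0`.
-/
lemma exists_left_inv (J : IntSector S P) (g : Chr Tp) : ∃ h : Chr Tp, h * g = 1 := by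
  obtain ⟨v, hv⟩ := S.exists_rec (V := MIdx d → ℝ) fun τ w n =>
    -(∑ σ ∈ (S.low τ).attach, (if (sdeg n : ℝ) < S.deg σ.1 + 2 then
        g.ofConv (S.quot τ σ) * w σ.1 (S.mem_low.1 σ.2) n else 0)) -
      ∑ l ∈ lowDeg d (S.deg τ + 2 - sdeg n),
        nmon l (WithLp.toLp 2 fun i => -g.ofConv (P.Xp i) : Space d) *
          g.ofConv (J.Ip (n + l) (S.basis τ))
  set x : Space d := WithLp.toLp 2 fun i => -g.ofConv (P.Xp i) with hxdef
  have hv' : ∀ τ n, v τ n = -(∑ σ ∈ S.low τ, (if (sdeg n : ℝ) < S.deg σ + 2 then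
      g.ofConv (S.quot τ σ) * v σ n else 0)) - ∑ l ∈ lowDeg d (S.deg τ + 2 - sdeg n),
        nmon l x * g.ofConv (J.Ip (n + l) (S.basis τ)) := fun τ n => by
    rw [hv]
    dsimp only
    rw [Finset.sum_attach (S.low τ) (fun σ => if (sdeg n : ℝ) < S.deg σ + 2 then
        g.ofConv (S.quot τ σ) * v σ n else 0)]
  obtain ⟨h, hX, hI⟩ : ∃ h : Chr Tp, (∀ i, h.ofConv (P.Xp i) = x i) ∧
      ∀ n τ, (sdeg n : ℝ) < S.deg τ + 2 → h.ofConv (J.Ip n (S.basis τ)) = v τ n :=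
    ⟨J.mkChar (fun i => x i) fun n τ => v τ n, J.mkChar_Xp _ _, fun n τ hn => J.mkChar_Ip _ _ hn⟩
  refine ⟨h, J.chr_ext (fun i => ?_) fun n τ hn => ?_⟩
  · rw [mul_Xp, hX, one_Xp, hxdef]
    exact neg_add_cancel _
  · have h1 : ∀ σ, h.ofConv (J.Ip n (lin g (S.quot τ σ) • S.basis σ)) =
        if (sdeg n : ℝ) < S.deg σ + 2 then g.ofConv (S.quot τ σ) * v σ n else 0 := fun σ => by
      rw [map_smul, map_smul, smul_eq_mul]
      split_ifs with hσ
      · rw [hI n σ hσ]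
        rfl
      · rw [J.Ip_zero_of_le hσ, map_zero, mul_zero]
    rw [J.mul_Ip hX, one_Ip, S.act_eq_add_low (by simp), map_add, map_add, hI n τ hn, hv',
      map_sum, map_sum]
    simp_rw [h1]
    ring

/-- The inverse character. -/
def cinv (g : Chr Tp) : Chr Tp := (J.exists_left_inv g).choose

lemma cinv_mul (g : Chr Tp) : J.cinv g * g = 1 := (J.exists_left_inv g).choose_spec

/-- The left inverse has a left inverse in turn, which must be `g`. -/
lemma mul_cinv (g : Chr Tp) : g * J.cinv g = 1 := by
  have h := J.cinv_mul (J.cinv g)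
  rw [left_inv_eq_right_inv h (J.cinv_mul g)] at h
  exact h

/-- The inverse of a character for the convolution of linear functionals. -/
lemma ring_inverse (g : Chr Tp) :
    Ring.inverse (WithConv.toConv (lin g)) = WithConv.toConv (lin (J.cinv g)) := by
  have h1 : WithConv.toConv (lin (J.cinv g)) * WithConv.toConv (lin g) = 1 := by
    have := J.cinv_mul g
    rw [← AlgHom.toLinearMap_convMul, this]
    rfl
  have h2 : WithConv.toConv (lin g) * WithConv.toConv (lin (J.cinv g)) = 1 := by
    have := J.mul_cinv g
    rw [← AlgHom.toLinearMap_convMul, this]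
    rfl
  exact Ring.inverse_unit (⟨_, _, h2, h1⟩ : (WithConv (Tp →ₗ[ℝ] ℝ))ˣ)

lemma gInv_eq (M : PreModel d T Tp) (x : Space d) :
    M.gInv x = lin (J.cinv (WithConv.toConv (M.g x))) := by
  have := J.ring_inverse (WithConv.toConv (M.g x))
  rw [PreModel.gInv]
  exact congrArg WithConv.ofConv this

lemma gyx_eq (M : PreModel d T Tp) (y x : Space d) : M.gyx y x =
    lin (WithConv.toConv (M.g y) * J.cinv (WithConv.toConv (M.g x))) := by
  rw [PreModel.gyx, J.gInv_eq]
  rfl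

lemma Pix_eq (M : PreModel d T Tp) (x : Space d) (v : T) :
    M.Pix S x v = M.Pi (S.act (lin (J.cinv (WithConv.toConv (M.g x)))) v) := by
  rw [PreModel.Pix, J.gInv_eq, LinearMap.comp_apply, pairRight_Δ]

lemma cinv_Xp (P : PolySector d S) (J : IntSector S P) (g : Chr Tp) (i : Fin (d + 1)) :
    (J.cinv g).ofConv (P.Xp i) = -g.ofConv (P.Xp i) := by
  have h := mul_Xp P (J.cinv g) g i
  rw [cinv_mul, one_Xp] at h
  linarith

/-- The action on `I₀ τ`. -/
lemma act_I₀ (g : Chr Tp) (b : B) : S.act (lin g) (J.I₀ (S.basis b)) =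
    J.I₀ (S.act (lin g) (S.basis b)) + ∑ l ∈ lowDeg d (S.deg b + 2),
      ((midxFactorial l : ℝ)⁻¹ * g.ofConv (J.Ip l (S.basis b))) • S.basis (P.X l) := by
  have h0 : sdeg (0 : MIdx d) ≤ 1 := by simp [sdeg]
  have h := J.Δ_I ⟨0, h0⟩ b
  have h1 : ∀ z : T ⊗[ℝ] Tp, pairRight LinearMap.id (lin g) ((J.I ⟨0, h0⟩).rTensor Tp z) =
      J.I ⟨0, h0⟩ (pairRight LinearMap.id (lin g) z) := by
    intro z
    induction z with
    | zero => simp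
    | tmul t w => simp [pairRight_tmul]
    | add x y hx hy => simp only [map_add, hx, hy]
  change pairRight LinearMap.id (lin g) (S.Δ (J.I ⟨0, h0⟩ (S.basis b))) = _
  rw [h, map_add, h1, map_sum]
  congr 1
  simp only [sdeg_zero, Nat.cast_zero, sub_zero, zero_add]
  refine Finset.sum_congr rfl fun l _ => ?_
  rw [map_smul, pairRight_tmul, smul_smul]
  rfl

lemma act_X (P : PolySector d S) {g : Chr Tp} {x : Space d}
    (hx : ∀ i, g.ofConv (P.Xp i) = x i) (n : MIdx d) : S.act (lin g) (S.basis (P.X n)) =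
      ∑ k ∈ Finset.Iic n, ((midxChoose n k : ℝ) * monomialFun (n - k) x) • S.basis (P.X k) := by
  rw [act, LinearMap.comp_apply, P.Δ_X, map_sum]
  refine Finset.sum_congr rfl fun k _ => ?_
  rw [map_smul, pairRight_tmul, smul_smul, LinearMap.id_apply, ← chr_XpPow P hx]
  rfl

lemma act_mulX (P : PolySector d S) {g : Chr Tp} {x : Space d}
    (hx : ∀ i, g.ofConv (P.Xp i) = x i) (n : MIdx d) (v : T) : S.act (lin g) (P.mulX n v) =
      ∑ k ∈ Finset.Iic n, ((midxChoose n k : ℝ) * monomialFun (n - k) x) •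
        P.mulX k (S.act (lin g) v) := by
  have h1 : ∀ (k : MIdx d) (z : T ⊗[ℝ] Tp), pairRight LinearMap.id (lin g)
      (TensorProduct.map (P.mulX k) (LinearMap.mulLeft ℝ (∏ i, P.Xp i ^ (n i - k i))) z) =
        monomialFun (n - k) x • P.mulX k (pairRight LinearMap.id (lin g) z) := by
    intro k z
    induction z with
    | zero => simp
    | tmul t w =>
      rw [TensorProduct.map_tmul, pairRight_tmul, pairRight_tmul, LinearMap.mulLeft_apply,
        ← chr_XpPow P hx]
      change g.ofConv (P.XpPow (n - k) * w) • _ = _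
      rw [map_mul, map_smul, smul_smul]
      rfl
    | add x y hx hy => simp only [map_add, hx, hy, smul_add]
  rw [act, LinearMap.comp_apply, P.Δ_mulX, map_sum]
  refine Finset.sum_congr rfl fun k _ => ?_
  rw [map_smul, h1, smul_smul]
  rfl

lemma I₀_mem (b : B) : J.I₀ (S.basis b) ∈ S.gradeT (S.deg b + 2) := by
  have := J.I_mem ⟨0, by simp [sdeg]⟩ b
  simp only [sdeg_zero, Nat.cast_zero, sub_zero] at this
  exact this

end IntSector

/-! ## Construction of the model -/

namespace IntSector

open RegStructure Temperate

variable {d : ℕ} {B T Tp : Type*} [AddCommGroup T] [Module ℝ T] [CommRing Tp]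
  [Bialgebra ℝ Tp] {S : RegStructure B T Tp} {P : PolySector d S}

lemma ut_adjoin {Θ : Type*} {χ : Θ → Space d → Chr Tp} {s : Set Tp}
    (hs : ∀ u ∈ s, UT fun θ z => (χ θ z).ofConv u) {u : Tp} (hu : u ∈ Algebra.adjoin ℝ s) :
    UT fun θ z => (χ θ z).ofConv u := by
  induction hu using Algebra.adjoin_induction with
  | mem x hx => exact hs x hx
  | algebraMap r =>
    refine UT.congr (UT.const (a := fun _ : Θ => r) (C := |r|) fun _ => le_rfl) fun θ z => ?_
    rw [AlgHom.commutes]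
    rfl
  | add x y _ _ hx hy => exact (hx.add hy).congr fun θ z => map_add _ _ _
  | mul x y _ _ hx hy => exact (hx.mul hy).congr fun θ z => map_mul _ _ _

lemma ut_quot {J : IntSector S P} (hJ : J.IsInductive) {Θ : Type*} {χ : Θ → Space d → Chr Tp}
    {τ : B} (hX : ∀ i, UT fun θ z => (χ θ z).ofConv (P.Xp i))
    (hI : ∀ η, S.deg η < S.deg τ → ∀ n, UT fun θ z => (χ θ z).ofConv (J.Ip n (S.basis η)))
    (σ : B) : UT fun θ z => (χ θ z).ofConv (S.quot τ σ) := by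
  refine ut_adjoin ?_ (hJ τ σ)
  rintro _ (⟨i, rfl⟩ | ⟨n, η, hη, rfl⟩)
  · exact hX i
  · exact hI η hη n

/-- The functions `Π τ` and the characters `h_x = g_x⁻¹` of the model to be constructed. -/
structure Solution (J : IntSector S P) (fam : {b : B // S.deg b < 0} → Space d → ℝ) where
  /-- the function `Π τ` -/
  f : B → Space d → ℝ
  /-- the inverse of the character `g_x` -/
  h : Space d → Chr Tp
  f_neg : ∀ b (hb : S.deg b < 0), f b = fam ⟨b, hb⟩
  f_zero : ∀ b, S.deg b = 0 → f b = fun _ => 1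
  -- That is, `(Π_y b)(y) = 0`.
  f_pos : ∀ b, 0 < S.deg b → ∀ y,
    f b y = -∑ σ ∈ S.low b, (h y).ofConv (S.quot b σ) * f σ y
  h_Xp : ∀ x i, (h x).ofConv (P.Xp i) = -x i
  -- The bracket is `∂^{n+l}(K Π_x b)(x)`, so this says `h_x = t_{-x} * a_x` with `a_x(I⁺ₘ b) =
  -- -∂ᵐ(K Π_x b)(x)`; see `h_eq`.
  h_Ip : ∀ x n b, (h x).ofConv (J.Ip n (S.basis b)) =
    -∑ l ∈ lowDeg d (S.deg b + 2 - sdeg n), nmon l (-x) * (mpd (n + l) (kOp (f b)) x +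
      ∑ σ ∈ S.low b, (h x).ofConv (S.quot b σ) * mpd (n + l) (kOp (f σ)) x)

lemma sdeg_pos {k : MIdx d} (hk : k ≠ 0) : 0 < sdeg k := by
  refine Nat.pos_of_ne_zero fun h0 => hk ?_
  funext i
  rw [sdeg, Nat.add_eq_zero_iff, Finset.sum_eq_zero_iff] at h0
  refine Fin.cases ?_ (fun j => ?_) i
  · simpa using h0.1
  · simpa using h0.2 j (Finset.mem_univ j)

lemma lowDeg_eq_empty {n : MIdx d} {b : B} (h : ¬(sdeg n : ℝ) < S.deg b + 2) :
    lowDeg d (S.deg b + 2 - sdeg n) = ∅ := by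
  refine Finset.eq_empty_of_forall_notMem fun l hl => ?_
  rw [mem_lowDeg] at hl
  have : (0 : ℝ) ≤ sdeg l := Nat.cast_nonneg _
  linarith

/-- By `IsInductive`, the values of `h` on `b/σ` depend only on generators strictly below `b`, so
the defining equations of `Solution` are a well-founded recursion for pairs of a function `Π b` and
the values on the `I⁺ₙ b`. -/
theorem exists_solution {J : IntSector S P} (hJ : J.IsInductive)
    (fam : {b : B // S.deg b < 0} → Space d → ℝ) : Nonempty (Solution J fam) := by
  classical
  let V := (Space d → ℝ) × (MIdx d → Space d → ℝ)
  let χ : (B → V) → Space d → Chr Tp := fun w x => J.mkChar (fun i => -x i) fun n η => (w η).2 n x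
  let p : B → (B → V) → Space d → ℝ := fun τ w y => if h : S.deg τ < 0 then fam ⟨τ, h⟩ y else
    if S.deg τ = 0 then 1 else -∑ σ ∈ S.low τ, (χ w y).ofConv (S.quot τ σ) * (w σ).1 y
  let q : B → (B → V) → MIdx d → Space d → ℝ := fun τ w n x =>
    -∑ l ∈ lowDeg d (S.deg τ + 2 - sdeg n), nmon l (-x) * (mpd (n + l) (kOp (p τ w)) x +
      ∑ σ ∈ S.low τ, (χ w x).ofConv (S.quot τ σ) * mpd (n + l) (kOp (w σ).1) x)
  -- The recursion sees only the data below `τ`; they are extended by zero so that a full character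
  -- can be formed. By `hχ` this does not change its values on `τ/σ`.
  let cut : B → (B → V) → B → V := fun τ w σ => if S.deg σ < S.deg τ then w σ else 0
  obtain ⟨w, hw⟩ : ∃ w : B → V, ∀ τ, w τ = (p τ (cut τ w), q τ (cut τ w)) := by
    obtain ⟨w, hw⟩ := S.exists_rec (V := V) fun τ w =>
      (p τ fun σ => if h : S.deg σ < S.deg τ then w σ h else 0,
        q τ fun σ => if h : S.deg σ < S.deg τ then w σ h else 0)
    exact ⟨w, fun τ => by rw [hw τ]; rfl⟩
  have hχ : ∀ τ x σ, (χ (cut τ w) x).ofConv (S.quot τ σ) = (χ w x).ofConv (S.quot τ σ) := by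
    intro τ x σ
    refine J.quot_congr hJ (fun i => by rw [mkChar_Xp, mkChar_Xp]) (fun η hη n => ?_) σ
    by_cases hn : (sdeg n : ℝ) < S.deg η + 2
    · rw [J.mkChar_Ip _ _ hn, J.mkChar_Ip _ _ hn]
      simp only [cut, if_pos hη]
    · rw [J.Ip_zero_of_le hn, map_zero, map_zero]
  have hcut : ∀ τ, ∀ σ ∈ S.low τ, cut τ w σ = w σ := fun τ σ hσ => if_pos (S.mem_low.1 hσ)
  have hp : ∀ τ, (w τ).1 = p τ (cut τ w) := fun τ => congrArg Prod.fst (hw τ)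
  have hq : ∀ τ, (w τ).2 = q τ (cut τ w) := fun τ => congrArg Prod.snd (hw τ)
  refine ⟨⟨fun b => (w b).1, χ w, fun b hb => ?_, fun b hb => ?_, fun b hb y => ?_,
    fun x i => J.mkChar_Xp _ _ i, fun x n b => ?_⟩⟩
  · rw [hp]
    funext y
    exact dif_pos hb
  · rw [hp]
    funext y
    simp only [p]
    rw [dif_neg (by rw [hb]; exact lt_irrefl 0), if_pos hb]
  · rw [hp]
    simp only [p]
    rw [dif_neg hb.not_gt, if_neg hb.ne']
    congr 1
    exact Finset.sum_congr rfl fun σ hσ => by rw [hχ, hcut b σ hσ]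
  · by_cases hn : (sdeg n : ℝ) < S.deg b + 2
    · rw [J.mkChar_Ip _ _ hn, hq]
      simp only [q]
      congr 1
      refine Finset.sum_congr rfl fun l _ => ?_
      rw [← hp]
      congr 2
      exact Finset.sum_congr rfl fun σ hσ => by rw [hχ, hcut b σ hσ]
    · rw [J.Ip_zero_of_le hn, map_zero, lowDeg_eq_empty hn, Finset.sum_empty, neg_zero]

/-! ### Values at the base point, and admissibility -/

namespace Solution

variable {J : IntSector S P} {fam : {b : B // S.deg b < 0} → Space d → ℝ} (D : Solution J fam)

/-- The functions are smooth and temperate. -/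
lemma tg_aux (hJ : J.IsInductive) (hfam : ∀ b, (fam b).HasTemperateGrowth) (b : B) :
    TG (D.f b) ∧ ∀ n, TG fun y => (D.h y).ofConv (J.Ip n (S.basis b)) := by
  induction b using S.deg_induction with
  | h b ih =>
  have hq : ∀ σ, TG fun y => (D.h y).ofConv (S.quot b σ) := fun σ =>
    ut_quot (χ := fun _ : Unit => D.h) hJ
      (fun i => (UT.neg_coord i).congr fun _ z => D.h_Xp z i) (fun η hη n => (ih η hη).2 n) σ
  have hf : TG (D.f b) := by
    rcases lt_trichotomy (S.deg b) 0 with hb | hb | hb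
    · rw [D.f_neg b hb]
      exact UT.of_temperate (hfam _)
    · rw [D.f_zero b hb]
      exact UT.const (a := fun _ : Unit => (1 : ℝ)) (C := 1) (by simp)
    · refine UT.congr (UT.neg (UT.sum (S.low b) (F := fun σ _ y =>
        (D.h y).ofConv (S.quot b σ) * D.f σ y) fun σ hσ =>
          UT.mul (hq σ) (ih σ (S.mem_low.1 hσ)).1)) fun _ y => D.f_pos b hb y
  refine ⟨hf, fun n => ?_⟩
  refine UT.congr (UT.neg (UT.sum (lowDeg d (S.deg b + 2 - sdeg n))
    (F := fun l _ x => nmon l (-x) * (mpd (n + l) (kOp (D.f b)) x +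
      ∑ σ ∈ S.low b, (D.h x).ofConv (S.quot b σ) * mpd (n + l) (kOp (D.f σ)) x))
    fun l _ => UT.mul ?_ (UT.add (UT.mpd hf.kOp _) (UT.sum _ fun σ hσ =>
      UT.mul (hq σ) (UT.mpd (ih σ (S.mem_low.1 hσ)).1.kOp _))))) fun _ x => D.h_Ip x n b
  exact UT.smul_const _ (UT.prod Finset.univ (F := fun i _ z => (-z i) ^ l i)
    fun i _ => (UT.neg_coord i).pow _)

/-- The linear map `τ ↦ Π τ`, with values in functions. -/
def F : T →ₗ[ℝ] Space d → ℝ := S.basis.constr ℝ D.f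

lemma F_basis (b : B) : D.F (S.basis b) = D.f b := S.basis.constr_basis ℝ _ b

/-- The linear map `τ ↦ ∂ⁿ K Π τ`, with values in functions. -/
def G (n : MIdx d) : T →ₗ[ℝ] Space d → ℝ := S.basis.constr ℝ fun b => mpd n (kOp (D.f b))

lemma G_basis (n : MIdx d) (b : B) : D.G n (S.basis b) = mpd n (kOp (D.f b)) :=
  S.basis.constr_basis ℝ _ b

lemma F_eq_sum (v : T) : D.F v =
    fun z => ∑ b ∈ (S.basis.repr v).support, S.basis.repr v b * D.f b z := by
  rw [F, Module.Basis.constr_apply]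
  funext z
  simp [Finsupp.sum]

lemma G_eq_sum (n : MIdx d) (v : T) : D.G n v =
    ∑ b ∈ (S.basis.repr v).support, S.basis.repr v b • mpd n (kOp (D.f b)) := by
  rw [G, Module.Basis.constr_apply]
  rfl

lemma tg_F {D : Solution J fam} (ht : ∀ b, TG (D.f b)) (v : T) : TG (D.F v) := by
  rw [F_eq_sum]
  exact TG.sum _ _ fun b _ => ht b

lemma G_eq {D : Solution J fam} (ht : ∀ b, TG (D.f b)) (n : MIdx d) (v : T) :
    D.G n v = mpd n (kOp (D.F v)) := by
  have : kOp (D.F v) =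
      ∑ b ∈ (S.basis.repr v).support, S.basis.repr v b • kOp (D.f b) := by
    funext x
    rw [F_eq_sum, kOp_sum _ _ fun b _ => ht b]
    simp
  rw [this, G_eq_sum, mpd_sum _ (f := fun b => S.basis.repr v b • kOp (D.f b))
    fun b _ => (ht b).kOp.smooth.const_smul (S.basis.repr v b)]
  exact Finset.sum_congr rfl fun b _ => by rw [mpd_smul (ht b).kOp.smooth]

/-- The distributions `Π τ`. -/
def Pi : T →ₗ[ℝ] TDist d := S.basis.constr ℝ fun b => tdist (D.f b)

lemma Pi_eq {D : Solution J fam} (ht : ∀ b, TG (D.f b)) (v : T) : D.Pi v = tdist (D.F v) := by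
  ext φ
  rw [tdist_apply (tg_F ht v), Pi, Module.Basis.constr_apply, F_eq_sum, Finsupp.sum]
  simp_rw [Finset.sum_mul]
  rw [integral_finsetSum]
  · simp only [sum_apply, smul_apply, smul_eq_mul]
    refine Finset.sum_congr rfl fun b _ => ?_
    rw [tdist_apply (ht b), ← integral_const_mul]
    simp_rw [mul_assoc]
  · intro b _
    simp_rw [mul_assoc]
    exact ((ht b).integrable_mul φ).const_mul _

/-- The functional `v ↦ (Π_x v)(x)`. -/
def eps (x : Space d) : T →ₗ[ℝ] ℝ := LinearMap.proj x ∘ₗ D.F ∘ₗ S.act (lin (D.h x))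

lemma eps_apply (x : Space d) (v : T) : D.eps x v = D.F (S.act (lin (D.h x)) v) x := rfl

lemma F_act (h : Chr Tp) (b : B) (y : Space d) : D.F (S.act (lin h) (S.basis b)) y =
    D.f b y + ∑ σ ∈ S.low b, h.ofConv (S.quot b σ) * D.f σ y := by
  rw [S.act_eq_add_low (by simp)]
  simp [F_basis]

lemma G_act (h : Chr Tp) (n : MIdx d) (b : B) (y : Space d) :
    D.G n (S.act (lin h) (S.basis b)) y =
      mpd n (kOp (D.f b)) y + ∑ σ ∈ S.low b, h.ofConv (S.quot b σ) * mpd n (kOp (D.f σ)) y := by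
  rw [S.act_eq_add_low (by simp)]
  simp [G_basis]

lemma eps_pos {b : B} (hb : 0 < S.deg b) (x : Space d) : D.eps x (S.basis b) = 0 := by
  rw [eps_apply, F_act, D.f_pos b hb, neg_add_cancel]

lemma eps_gradeT {β : ℝ} (hβ : 0 < β) (x : Space d) {v : T} (hv : v ∈ S.gradeT β) :
    D.eps x v = 0 := by
  induction hv using Submodule.span_induction with
  | mem v hv =>
    obtain ⟨b, hb, rfl⟩ := hv
    exact D.eps_pos (by rw [show S.deg b = β from hb]; exact hβ) x
  | zero => simp
  | add u v _ _ hu hv => rw [map_add, hu, hv, add_zero]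
  | smul a v _ hv => rw [map_smul, hv, smul_zero]

lemma deg_X_zero (P : PolySector d S) : S.deg (P.X 0) = 0 := by
  rw [P.deg_X, sdeg_zero, Nat.cast_zero]

lemma act_X_zero (P : PolySector d S) (h : Chr Tp) :
    S.act (lin h) (S.basis (P.X 0)) = S.basis (P.X 0) := by
  rw [act, LinearMap.comp_apply, P.Δ_X]
  have : Finset.Iic (0 : MIdx d) = {0} := by
    ext k
    rw [Finset.mem_Iic, Finset.mem_singleton]
    exact ⟨fun h => le_antisymm h fun i => Nat.zero_le _, fun h => h.le⟩
  rw [this, Finset.sum_singleton, map_smul, pairRight_tmul]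
  simp [midxChoose]

lemma eps_X (x : Space d) (n : MIdx d) :
    D.eps x (S.basis (P.X n)) = if n = 0 then 1 else 0 := by
  split_ifs with hn
  · subst hn
    rw [eps_apply, act_X_zero, F_basis, D.f_zero _ (deg_X_zero P)]
  · refine D.eps_pos ?_ x
    rw [P.deg_X, Nat.cast_pos]
    exact sdeg_pos hn

/-- The character `g_x`. -/
def g (x : Space d) : Chr Tp := J.cinv (D.h x)

lemma g_Xp (x : Space d) (i : Fin (d + 1)) : (D.g x).ofConv (P.Xp i) = x i := by
  rw [g, cinv_Xp, D.h_Xp, neg_neg]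

lemma h_mul_g (x : Space d) : D.h x * D.g x = 1 := J.mul_cinv _

lemma g_mul_h (x : Space d) : D.g x * D.h x = 1 := J.cinv_mul _

lemma act_h_g (x : Space d) (v : T) : S.act (lin (D.h x)) (S.act (lin (D.g x)) v) = v := by
  rw [← act_mul, h_mul_g, act_one]

/-- The device behind all algebraic identities for `Π`: expanding at the point of evaluation itself
discards every term of positive homogeneity. -/
lemma F_eq_eps (x : Space d) (v : T) : D.F v x = D.eps x (S.act (lin (D.g x)) v) := by
  rw [eps_apply, act_h_g]

/-- The character `a_x` with `h_x = t_{-x} * a_x`. -/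
def a (x : Space d) : Chr Tp :=
  J.mkChar 0 fun n b => -D.G n (S.act (lin (D.h x)) (S.basis b)) x

lemma a_Xp (x : Space d) (i : Fin (d + 1)) : (D.a x).ofConv (P.Xp i) = 0 := J.mkChar_Xp _ _ i

lemma a_Ip (x : Space d) {n : MIdx d} {b : B} (h : (sdeg n : ℝ) < S.deg b + 2) :
    (D.a x).ofConv (J.Ip n (S.basis b)) = -D.G n (S.act (lin (D.h x)) (S.basis b)) x :=
  J.mkChar_Ip _ _ h

lemma h_eq (x : Space d) : D.h x = J.tc (-x) * D.a x := by
  refine J.chr_ext (fun i => ?_) fun n b hn => ?_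
  · rw [mul_Xp, D.h_Xp, D.a_Xp, tc_Xp, add_zero]
    rfl
  · rw [tc_mul_Ip, D.h_Ip, ← Finset.sum_neg_distrib]
    refine Finset.sum_congr rfl fun l hl => ?_
    rw [mem_lowDeg] at hl
    rw [D.a_Ip x (by rw [sdeg_add]; push_cast; linarith), G_act]
    ring

lemma a_eq (x : Space d) : D.a x = J.tc x * D.h x := by
  rw [h_eq, ← mul_assoc, tc_mul_neg, one_mul]

/-- Recentring: `a_y * g_{yx} = t_{y-x} * a_x`. -/
lemma a_mul (y x : Space d) : D.a y * (D.g y * D.h x) = J.tc (y - x) * D.a x := by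
  rw [a_eq, mul_assoc, ← mul_assoc (D.h y), h_mul_g, one_mul, h_eq, ← mul_assoc, ← tc_add,
    sub_eq_add_neg]

lemma F_X (n : MIdx d) : D.f (P.X n) = monomialFun n := by
  funext x
  rw [← F_basis, F_eq_eps, act_X P (D.g_Xp x), map_sum, Finset.sum_eq_single 0]
  · rw [map_smul, D.eps_X, if_pos rfl]
    simp [midxChoose]
  · intro k _ hk
    rw [map_smul, D.eps_X, if_neg hk, smul_zero]
  · intro h
    exact absurd (Finset.mem_Iic.2 fun i => Nat.zero_le _) h

/-- From `a_x * g_x = t_x`, which vanishes on every `I⁺`. -/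
lemma G_act_g (x : Space d) (b : B) : (D.g x).ofConv (J.Ip 0 (S.basis b)) =
    -(D.a x).ofConv (J.Ip 0 (S.act (lin (D.g x)) (S.basis b))) := by
  have h1 : D.a x * D.g x = J.tc x := by rw [a_eq, mul_assoc, h_mul_g, mul_one]
  have h2 := J.mul_Ip_zero (D.a_Xp x) (D.g x) 0 b
  rw [h1, tc_Ip] at h2
  linarith

lemma a_Ip_zero {D : Solution J fam} (hβ : ∀ b, -2 < S.deg b) (x : Space d) (v : T) :
    (D.a x).ofConv (J.Ip 0 v) = -D.G 0 (S.act (lin (D.h x)) v) x := by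
  have : lin (D.a x) ∘ₗ J.Ip 0 = -(LinearMap.proj x ∘ₗ D.G 0 ∘ₗ S.act (lin (D.h x))) :=
    S.basis.ext fun b => D.a_Ip x (by
      rw [sdeg_zero, Nat.cast_zero]
      linarith [hβ b])
  exact LinearMap.congr_fun this v

/-- Admissibility. -/
lemma F_I₀ {D : Solution J fam} (hβ : ∀ b, -2 < S.deg b) (b : B) :
    D.F (J.I₀ (S.basis b)) = kOp (D.f b) := by
  funext x
  -- All homogeneities exceed `-2`, so `I₀` takes values in positive homogeneity. Only the term with
  -- `X⁰` is left.
  have hI : ∀ v, D.eps x (J.I₀ v) = 0 := by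
    have : D.eps x ∘ₗ J.I₀ = 0 := S.basis.ext fun σ =>
      D.eps_gradeT (by linarith [hβ σ]) x (J.I₀_mem σ)
    exact fun v => LinearMap.congr_fun this v
  rw [F_eq_eps, act_I₀, map_add, hI, zero_add, map_sum, Finset.sum_eq_single 0]
  · rw [map_smul, D.eps_X, if_pos rfl, G_act_g, a_Ip_zero hβ, act_h_g, G_basis, mpd_zero]
    simp [midxFactorial]
  · intro l _ hl
    rw [map_smul, D.eps_X, if_neg hl, smul_zero]
  · intro h
    rw [mem_lowDeg, sdeg_zero, Nat.cast_zero] at h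
    linarith [hβ b]

end Solution

end IntSector

/-! ## Multiplication by polynomials, and the model -/

namespace IntSector

open RegStructure Temperate

variable {d : ℕ} {B T Tp : Type*} [AddCommGroup T] [Module ℝ T] [CommRing Tp]
  [Bialgebra ℝ Tp] {S : RegStructure B T Tp} {P : PolySector d S}

lemma sum_choose_monomial (n : MIdx d) (x y : Space d) :
    ∑ k ∈ Finset.Iic n, (midxChoose n k : ℝ) * monomialFun (n - k) y * monomialFun k x =
      monomialFun n (x + y) := by
  have h1 : Finset.Iic n = Fintype.piFinset fun i => Finset.Iic (n i) := rfl
  have h2 : monomialFun n (x + y) = ∏ i, ∑ m ∈ Finset.Iic (n i),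
      ((n i).choose m : ℝ) * y i ^ (n i - m) * x i ^ m := by
    refine Finset.prod_congr rfl fun i _ => ?_
    rw [PiLp.add_apply, add_pow, ← Nat.range_succ_eq_Iic]
    exact Finset.sum_congr rfl fun m _ => by ring
  rw [h2, Finset.prod_univ_sum, h1]
  refine Finset.sum_congr rfl fun k _ => ?_
  rw [Finset.prod_mul_distrib, Finset.prod_mul_distrib]
  simp [midxChoose, monomialFun]

lemma repr_gradeT {β : ℝ} {v : T} (hv : v ∈ S.gradeT β) {b : B} (hb : S.deg b ≠ β) :
    S.basis.repr v b = 0 := by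
  induction hv using Submodule.span_induction with
  | mem v hv =>
    obtain ⟨b', hb', rfl⟩ := hv
    have hne : b' ≠ b := fun h => hb (h ▸ hb')
    simp [hne]
  | zero => simp
  | add u v _ _ hu hv => simp [hu, hv]
  | smul a v _ hv => simp [hv]

lemma monomialFun_zero_right {n : MIdx d} (hn : n ≠ 0) : monomialFun n (0 : Space d) = 0 := by
  obtain ⟨i, hi⟩ := Function.ne_iff.1 hn
  exact Finset.prod_eq_zero (Finset.mem_univ i) (by simpa using hi)

/-- Multiplication by a nontrivial monomial never leads to homogeneity zero. -/
lemma deg_add_sdeg_ne_zero (J : IntSector S P) (hβ : ∀ b, -2 < S.deg b) {b : B} {k : MIdx d}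
    (hk : k ≠ 0) : S.deg b + sdeg k ≠ 0 := by
  intro h0
  have h1k : (1 : ℝ) ≤ sdeg k := by exact_mod_cast sdeg_pos hk
  let z : Space d := WithLp.toLp 2 fun _ => 1
  have hz : monomialFun k z = 1 := by simp [monomialFun, z]
  have hone : lin (J.tc z) 1 = 1 := by simp
  -- The coefficient of `b` is computed on both sides. On the right the term `l = 0` gives `1`; the
  -- others give `0`, because `Xˡ ⋆ σ` has homogeneity above `-1` while `|b| = -|k| ≤ -1`. On the
  -- left, `Xᵏ ⋆ b` is a multiple of the invariant element `X⁰`, so the coefficient is `0`.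
  have key := congrArg (fun v => S.basis.repr v b) (act_mulX P (J.tc_Xp z) k (S.basis b))
  simp only [map_sum, Finsupp.coe_finsetSum, Finset.sum_apply, map_smul, Finsupp.smul_apply,
    smul_eq_mul] at key
  have hmul : ∀ l : MIdx d, l ≠ 0 → ∀ v, S.basis.repr (P.mulX l v) b = 0 := by
    intro l hl v
    have h1l : (1 : ℝ) ≤ sdeg l := by exact_mod_cast sdeg_pos hl
    have : S.basis.coord b ∘ₗ P.mulX l = 0 := S.basis.ext fun σ =>
      repr_gradeT (P.mulX_mem l σ) (by have := hβ σ; intro h; linarith)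
    exact LinearMap.congr_fun this v
  rw [Finset.sum_eq_single 0 (fun l _ hl => by rw [hmul l hl, mul_zero])
    (fun h => absurd (Finset.mem_Iic.2 fun i => Nat.zero_le _) h)] at key
  have hself : S.basis.repr (S.act (lin (J.tc z)) (S.basis b)) b = 1 := by
    rw [S.act_eq_add_low hone]
    simp only [map_add, map_sum, map_smul, Finsupp.add_apply, Finsupp.coe_finsetSum,
      Finset.sum_apply, Finsupp.smul_apply, Module.Basis.repr_self, Finsupp.single_eq_same]
    rw [Finset.sum_eq_zero, add_zero]
    intro σ hσ
    have hne : σ ≠ b := fun h => (S.mem_low.1 hσ).ne (by rw [h])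
    simp [hne]
  rw [P.mulX_zero, LinearMap.id_apply, hself, tsub_zero, hz] at key
  have hL : S.basis.repr (S.act (lin (J.tc z)) (P.mulX k (S.basis b))) b = 0 := by
    have hm := P.mulX_mem k b
    rw [h0] at hm
    have : ∀ v ∈ S.gradeT 0, S.act (lin (J.tc z)) v = v := by
      intro v hv
      induction hv using Submodule.span_induction with
      | mem v hv =>
        obtain ⟨b', hb', rfl⟩ := hv
        rw [P.eq_X_zero b' hb', Solution.act_X_zero]
      | zero => simp
      | add u v _ _ hu hv => rw [map_add, hu, hv]
      | smul a v _ hv => rw [map_smul, hv]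
    rw [this _ hm]
    exact repr_gradeT hm (by intro h; linarith)
  rw [hL] at key
  simp [midxChoose] at key

namespace Solution

variable {J : IntSector S P} {fam : {b : B // S.deg b < 0} → Space d → ℝ} (D : Solution J fam)

lemma F_eq_famLin_basis {b : B} (hb : S.deg b < 0) :
    D.F (S.basis b) = famLin S fam (S.basis b) := by
  rw [F_basis, D.f_neg b hb, famLin, Module.Basis.constr_basis, dif_pos hb]

lemma F_eq_famLin {β : ℝ} (hβ : β < 0) {v : T} (hv : v ∈ S.gradeT β) :
    D.F v = famLin S fam v := by
  induction hv using Submodule.span_induction with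
  | mem v hv =>
    obtain ⟨b, hb, rfl⟩ := hv
    exact D.F_eq_famLin_basis (by rw [show S.deg b = β from hb]; exact hβ)
  | zero => simp
  | add u v _ _ hu hv => rw [map_add, map_add, hu, hv]
  | smul a v _ hv => rw [map_smul, map_smul, hv]

lemma F_mulX_neg (hX : IsCompatible P fam) {n : MIdx d} {b : B} (h : S.deg b + sdeg n < 0)
    (x : Space d) :
    D.F (P.mulX n (S.basis b)) x = monomialFun n x * D.F (S.basis b) x := by
  have hb : S.deg b < 0 := lt_of_le_of_lt (le_add_of_nonneg_right (Nat.cast_nonneg _)) h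
  rw [D.F_eq_famLin h (P.mulX_mem n b), hX n b h, D.F_eq_famLin_basis hb]

/-- Formally `Π_x(Xᵏ ⋆ v) = (· - x)ᵏ Π_x v`, which vanishes at `x`. In negative homogeneity this is
the compatibility of the family together with the binomial formula; in positive homogeneity `eps`
vanishes anyway; homogeneity zero is excluded. -/
lemma eps_mulX (hX : IsCompatible P fam) (hβ : ∀ b, -2 < S.deg b) (x : Space d) {k : MIdx d}
    (hk : k ≠ 0) (v : T) : D.eps x (P.mulX k v) = 0 := by
  suffices D.eps x ∘ₗ P.mulX k = 0 from LinearMap.congr_fun this v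
  refine S.basis.ext fun b => ?_
  rw [LinearMap.comp_apply, LinearMap.zero_apply]
  rcases lt_trichotomy (S.deg b + sdeg k) 0 with h | h | h
  · have hx : ∀ i, (D.h x).ofConv (P.Xp i) = (-x) i := D.h_Xp x
    rw [eps_apply, act_mulX P hx, map_sum, Finset.sum_apply]
    have hl : ∀ l ∈ Finset.Iic k, D.F (P.mulX l (S.act (lin (D.h x)) (S.basis b))) x =
        monomialFun l x * D.F (S.act (lin (D.h x)) (S.basis b)) x := by
      intro l hl
      have hlk : (sdeg l : ℝ) ≤ sdeg k := by
        have h1 : sdeg (l + (k - l)) = sdeg k := by rw [add_tsub_cancel_of_le (Finset.mem_Iic.1 hl)]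
        rw [sdeg_add] at h1
        exact_mod_cast (by omega : sdeg l ≤ sdeg k)
      rw [S.act_basis]
      simp only [map_sum, map_smul, Finset.sum_apply, Pi.smul_apply, smul_eq_mul]
      rw [Finset.mul_sum]
      refine Finset.sum_congr rfl fun σ hσ => ?_
      have := S.mem_fin.1 hσ
      rw [D.F_mulX_neg hX (by linarith)]
      ring
    simp only [map_smul, Pi.smul_apply, smul_eq_mul]
    rw [Finset.sum_congr rfl fun l hm => by rw [hl l hm, ← mul_assoc], ← Finset.sum_mul,
      sum_choose_monomial, add_neg_cancel, monomialFun_zero_right hk, zero_mul]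
  · exact absurd h (deg_add_sdeg_ne_zero J hβ hk)
  · exact D.eps_gradeT h x (P.mulX_mem k b)

lemma F_mulX (hX : IsCompatible P fam) (hβ : ∀ b, -2 < S.deg b) (n : MIdx d) (b : B)
    (x : Space d) : D.F (P.mulX n (S.basis b)) x = monomialFun n x * D.f b x := by
  rw [F_eq_eps, act_mulX P (D.g_Xp x), map_sum, Finset.sum_eq_single 0]
  · rw [map_smul, P.mulX_zero, LinearMap.id_apply, ← F_eq_eps, F_basis]
    simp [midxChoose]
  · intro k _ hk
    rw [map_smul, D.eps_mulX hX hβ x hk, smul_zero]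
  · intro h
    exact absurd (Finset.mem_Iic.2 fun i => Nat.zero_le _) h

/-- The model. -/
def model : PreModel d T Tp := ⟨D.Pi, fun x => (D.g x).ofConv⟩

lemma cinv_g (x : Space d) : J.cinv (D.g x) = D.h x :=
  left_inv_eq_right_inv (J.cinv_mul _) (D.g_mul_h x)

lemma model_gyx (y x : Space d) : D.model.gyx y x = lin (D.g y * D.h x) := by
  rw [J.gyx_eq, ← cinv_g]
  rfl

lemma model_Pix {D : Solution J fam} (ht : ∀ b, TG (D.f b)) (x : Space d) (v : T) :
    D.model.Pix S x v = tdist (D.F (S.act (lin (D.h x)) v)) := by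
  rw [J.Pix_eq, ← Pi_eq ht, ← cinv_g]
  rfl

lemma model_canonical {D : Solution J fam} (ht : ∀ b, TG (D.f b)) : D.model.IsCanonical P := by
  refine ⟨fun n φ => ?_, fun x i => D.g_Xp x i⟩
  rw [model, Pi_eq ht, tdist_apply (tg_F ht _), F_basis, F_X]

lemma model_admissible {D : Solution J fam} (ht : ∀ b, TG (D.f b)) (hX : IsCompatible P fam)
    (hβ : ∀ b, -2 < S.deg b) : D.model.IsAdmissible J := by
  refine ⟨fun b φ => ?_, fun n b φ => ?_⟩
  · rw [model, Pi_eq ht, Pi_eq ht, tdist_apply (tg_F ht _), F_I₀ hβ, F_basis,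
      Kapply_tdist (ht b)]
  · rw [model, Pi_eq ht, Pi_eq ht, tdist_apply (tg_F ht _), tdist_apply (tg_F ht _)]
    refine integral_congr_ae (Filter.Eventually.of_forall fun x => ?_)
    simp only
    rw [D.F_mulX hX hβ, F_basis, SchwartzMap.smulLeftCLM_apply_apply (monomialFun_temperate n),
      smul_eq_mul]
    ring

lemma model_extends {D : Solution J fam} (ht : ∀ b, TG (D.f b)) : D.model.Extends S fam := by
  intro b φ
  rw [model, Pi_eq ht, tdist_apply (tg_F ht _), F_basis, D.f_neg b.1 b.2]

end Solution

end IntSector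

/-! ## Uniform smoothness of the recentred model -/

namespace Temperate

variable {d : ℕ} {Θ : Type*}

lemma UT.eval_zero {F : Θ → Space d → ℝ} (hF : UT F) : UT (fun θ (_ : Space d) => F θ 0) := by
  obtain ⟨C, N, -, h⟩ := hF.bound_zero
  exact UT.const (C := C) fun θ => by simpa using h θ 0

lemma UT.nmon (k : MIdx d) : UT (fun (_ : Θ) (z : Space d) => nmon k z) :=
  (UT.monomial k).smul_const _

lemma UT.nmon_neg (k : MIdx d) : UT (fun (_ : Θ) (z : Space d) => Temperate.nmon k (-z)) :=
  UT.smul_const _ (UT.prod Finset.univ (F := fun i _ z => (-z i) ^ k i)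
    fun i _ => (UT.neg_coord i).pow _)

end Temperate

namespace IntSector

open RegStructure Temperate

variable {d : ℕ} {B T Tp : Type*} [AddCommGroup T] [Module ℝ T] [CommRing Tp]
  [Bialgebra ℝ Tp] {S : RegStructure B T Tp} {P : PolySector d S}

lemma map_act {U : Type*} [AddCommGroup U] [Module ℝ U] (L : T →ₗ[ℝ] U) (h : Chr Tp) (b : B) :
    L (S.act (lin h) (S.basis b)) =
      L (S.basis b) + ∑ σ ∈ S.low b, h.ofConv (S.quot b σ) • L (S.basis σ) := by
  rw [S.act_eq_add_low (by simp)]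
  simp

lemma act_of_deg_zero (P : PolySector d S) (h : Chr Tp) {b : B} (hb : S.deg b = 0) :
    S.act (lin h) (S.basis b) = S.basis b := by
  rw [P.eq_X_zero b hb, Solution.act_X_zero]

namespace Solution

variable {J : IntSector S P} {fam : {b : B // S.deg b < 0} → Space d → ℝ} (D : Solution J fam)

/-- The recentring character `g_{x+z,x}`. -/
def up (x z : Space d) : Chr Tp := D.g (x + z) * D.h x

/-- The recentring character `g_{x,x+z}`. -/
def dn (x z : Space d) : Chr Tp := D.g x * D.h (x + z)

lemma up_Xp (x z : Space d) (i : Fin (d + 1)) : (D.up x z).ofConv (P.Xp i) = z i := by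
  rw [up, mul_Xp, g_Xp, D.h_Xp, PiLp.add_apply]
  ring

lemma dn_Xp (x z : Space d) (i : Fin (d + 1)) : (D.dn x z).ofConv (P.Xp i) = -z i := by
  rw [dn, mul_Xp, g_Xp, D.h_Xp, PiLp.add_apply]
  ring

lemma act_up (x z : Space d) (v : T) :
    S.act (lin (D.h (x + z))) (S.act (lin (D.up x z)) v) = S.act (lin (D.h x)) v := by
  rw [← act_mul, up, ← mul_assoc, h_mul_g, one_mul]

lemma act_dn (x z : Space d) (v : T) :
    S.act (lin (D.h x)) (S.act (lin (D.dn x z)) v) = S.act (lin (D.h (x + z))) v := by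
  rw [← act_mul, dn, ← mul_assoc, h_mul_g, one_mul]

/-- This is `a_mul`, solved for the value of the recentring character. The right-hand side involves
that character only on `b/σ`, so it serves as a recursion. -/
lemma up_Ip (x z : Space d) (n : MIdx d) (b : B) : (D.up x z).ofConv (J.Ip n (S.basis b)) =
    ∑ l ∈ lowDeg d (S.deg b + 2 - sdeg n), nmon l z * (D.a x).ofConv (J.Ip (n + l) (S.basis b)) -
      ((D.a (x + z)).ofConv (J.Ip n (S.basis b)) + ∑ σ ∈ S.low b,
        (D.up x z).ofConv (S.quot b σ) * (D.a (x + z)).ofConv (J.Ip n (S.basis σ))) := by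
  have h1 := D.a_mul (x + z) x
  rw [add_sub_cancel_left] at h1
  have h2 := J.mul_Ip_zero (D.a_Xp (x + z)) (D.up x z) n b
  rw [up, h1, tc_mul_Ip, ← up] at h2
  have h3 := map_act (S := S) (lin (D.a (x + z)) ∘ₗ J.Ip n) (D.up x z) b
  simp only [LinearMap.comp_apply, smul_eq_mul, AlgHom.toLinearMap_apply] at h3
  rw [h3] at h2
  linarith

lemma dn_Ip (x z : Space d) (n : MIdx d) (b : B) : (D.dn x z).ofConv (J.Ip n (S.basis b)) =
    ∑ l ∈ lowDeg d (S.deg b + 2 - sdeg n),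
      nmon l (-z) * (D.a (x + z)).ofConv (J.Ip (n + l) (S.basis b)) -
      ((D.a x).ofConv (J.Ip n (S.basis b)) + ∑ σ ∈ S.low b,
        (D.dn x z).ofConv (S.quot b σ) * (D.a x).ofConv (J.Ip n (S.basis σ))) := by
  have h1 := D.a_mul x (x + z)
  rw [show x - (x + z) = -z by abel] at h1
  have h2 := J.mul_Ip_zero (D.a_Xp x) (D.dn x z) n b
  rw [dn, h1, tc_mul_Ip, ← dn] at h2
  have h3 := map_act (S := S) (lin (D.a x) ∘ₗ J.Ip n) (D.dn x z) b
  simp only [LinearMap.comp_apply, smul_eq_mul, AlgHom.toLinearMap_apply] at h3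
  rw [h3] at h2
  linarith

/-- Smoothness, uniform in the base point `x ∈ Q`, of the family recentred polynomially. -/
def RegularOn (Q : Set (Space d)) : Prop := ∀ b, S.deg b < 0 →
  UT fun (x : Q) (z : Space d) => D.F (S.act (lin (J.tc (-(x : Space d)))) (S.basis b)) (x + z)

/-- The function `z ↦ (Π_x b)(x + z)`. -/
def phi (b : B) (x z : Space d) : ℝ := D.F (S.act (lin (D.h x)) (S.basis b)) (x + z)

lemma mpd_kOp_phi {D : Solution J fam} (ht : ∀ b, TG (D.f b)) (n : MIdx d) (b : B)
    (x : Space d) : mpd n (kOp (D.phi b x)) =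
      fun z => D.G n (S.act (lin (D.h x)) (S.basis b)) (x + z) := by
  rw [G_eq ht, show D.phi b x = fun z => D.F (S.act (lin (D.h x)) (S.basis b)) (x + z) from rfl,
    kOp_translate, mpd_translate (tg_F ht _).kOp.smooth]

section

variable {D : Solution J fam} {Q : Set (Space d)}

lemma ut_G (ht : ∀ b, TG (D.f b)) {b : B} (h : UT fun (x : Q) => D.phi b x) (n : MIdx d) :
    UT fun (x : Q) (z : Space d) => D.G n (S.act (lin (D.h x)) (S.basis b)) (x + z) :=
  (h.kOp.mpd n).congr fun x z => by rw [mpd_kOp_phi ht]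

lemma ut_a (ht : ∀ b, TG (D.f b)) {b : B} (h : UT fun (x : Q) => D.phi b x) (n : MIdx d) :
    UT fun (x : Q) (_ : Space d) => (D.a x).ofConv (J.Ip n (S.basis b)) := by
  by_cases hn : (sdeg n : ℝ) < S.deg b + 2
  · refine (ut_G ht h n).eval_zero.neg.congr fun x z => ?_
    rw [D.a_Ip _ hn, add_zero]
  · exact UT.zero.congr fun x z => by rw [J.Ip_zero_of_le hn, map_zero]

/-- Here the base point moves with the argument. Since `Π_{x+z} = Π_x ∘ (Id ⊗ g_{x,x+z}) Δ`, the
dependence on `z` is that of functions with fixed base point and of the characters `dn`. -/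
lemma ut_G_end (ht : ∀ b, TG (D.f b)) {b : B}
    (h : UT fun (x : Q) => D.phi b x) (hl : ∀ σ ∈ S.low b, UT fun (x : Q) => D.phi σ x)
    (hd : ∀ σ, UT fun (x : Q) (z : Space d) => (D.dn x z).ofConv (S.quot b σ)) (n : MIdx d) :
    UT fun (x : Q) (z : Space d) => D.G n (S.act (lin (D.h (x + z))) (S.basis b)) (x + z) := by
  refine ((ut_G ht h n).add (UT.sum (S.low b) fun σ hσ =>
    (hd σ).mul (ut_G ht (hl σ hσ) n))).congr fun x z => ?_
  rw [← D.act_dn, ← LinearMap.comp_apply (D.G n), map_act]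
  simp

lemma ut_F_end {b : B} (h : UT fun (x : Q) => D.phi b x)
    (hl : ∀ σ ∈ S.low b, UT fun (x : Q) => D.phi σ x)
    (hd : ∀ σ, UT fun (x : Q) (z : Space d) => (D.dn x z).ofConv (S.quot b σ)) :
    UT fun (x : Q) (z : Space d) => D.eps (x + z) (S.basis b) := by
  refine (h.add (UT.sum (S.low b) fun σ hσ =>
    (hd σ).mul (hl σ hσ))).congr fun x z => ?_
  rw [eps_apply, ← D.act_dn, ← LinearMap.comp_apply (D.F), map_act]
  simp [phi]

lemma ut_a_end (ht : ∀ b, TG (D.f b)) {b : B}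
    (h : UT fun (x : Q) => D.phi b x) (hl : ∀ σ ∈ S.low b, UT fun (x : Q) => D.phi σ x)
    (hd : ∀ σ, UT fun (x : Q) (z : Space d) => (D.dn x z).ofConv (S.quot b σ)) (n : MIdx d) :
    UT fun (x : Q) (z : Space d) => (D.a (x + z)).ofConv (J.Ip n (S.basis b)) := by
  by_cases hn : (sdeg n : ℝ) < S.deg b + 2
  · exact (ut_G_end ht h hl hd n).neg.congr fun x z => by rw [D.a_Ip _ hn]
  · exact UT.zero.congr fun x z => by rw [J.Ip_zero_of_le hn, map_zero]

/-- The expansion of `Π_x b` at a second point. -/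
lemma phi_eq_eps (b : B) (x z : Space d) : D.phi b x z = D.eps (x + z) (S.basis b) +
    ∑ σ ∈ S.low b, (D.up x z).ofConv (S.quot b σ) * D.eps (x + z) (S.basis σ) := by
  rw [phi, ← D.act_up x z, ← eps_apply, map_act]
  simp

/-- One induction carries all three statements. The characters on `b/σ` need only generators below
`b`; they give `phi b`. Then `phi b` gives `a` on the `I⁺ₙ b`, at the fixed and at the moving base
point, and `a` gives `up` and `dn` there. -/
theorem regular (hJ : J.IsInductive) (ht : ∀ b, TG (D.f b)) (hQ : D.RegularOn Q) (b : B) :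
    (UT fun (x : Q) => D.phi b x) ∧
    (∀ n, UT fun (x : Q) (z : Space d) => (D.up x z).ofConv (J.Ip n (S.basis b))) ∧
    ∀ n, UT fun (x : Q) (z : Space d) => (D.dn x z).ofConv (J.Ip n (S.basis b)) := by
  induction b using S.deg_induction with
  | h b ih =>
  have hup : ∀ σ, UT fun (x : Q) (z : Space d) => (D.up x z).ofConv (S.quot b σ) := fun σ =>
    ut_quot (χ := fun (x : Q) (z : Space d) => D.up x z) hJ
      (fun i => (UT.coord i).congr fun x z => D.up_Xp x z i) (fun η hη n => (ih η hη).2.1 n) σ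
  have hdn : ∀ τ, S.deg τ ≤ S.deg b → ∀ σ,
      UT fun (x : Q) (z : Space d) => (D.dn x z).ofConv (S.quot τ σ) := fun τ hτ σ =>
    ut_quot (χ := fun (x : Q) (z : Space d) => D.dn x z) hJ
      (fun i => (UT.neg_coord i).congr fun x z => D.dn_Xp x z i)
      (fun η hη n => (ih η (hη.trans_le hτ)).2.2 n) σ
  have hphi : UT fun (x : Q) => D.phi b x := by
    rcases lt_trichotomy (S.deg b) 0 with hb | hb | hb
    -- Here `h_x = t_{-x} * a_x`. The factor `t_{-x}` is covered by the assumption on `Q`, and `a_x`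
    -- is uniformly bounded by the induction hypothesis.
    · have ha : ∀ σ, UT fun (x : Q) (_ : Space d) => (D.a x).ofConv (S.quot b σ) := fun σ =>
        ut_quot (χ := fun (x : Q) (_ : Space d) => D.a x) hJ
          (fun i => UT.zero.congr fun x z => D.a_Xp x i)
          (fun η hη n => ut_a ht (ih η hη).1 n) σ
      refine ((hQ b hb).add (UT.sum (S.low b) fun σ hσ => (ha σ).mul
        (hQ σ ((S.mem_low.1 hσ).trans hb)))).congr fun x z => ?_
      have := congrFun (map_act (S := S) (D.F ∘ₗ S.act (lin (J.tc (-(x : Space d))))) (D.a x) b)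
        (x + z)
      rw [LinearMap.comp_apply] at this
      rw [phi, h_eq, act_mul, this]
      simp
    · refine (UT.const (a := fun _ : Q => (1 : ℝ)) (C := 1) (by simp)).congr fun x z => ?_
      rw [phi, act_of_deg_zero P _ hb, F_basis, D.f_zero b hb]
    -- Expanding at `x + z` itself removes the term of `b`, whose value at its own base point is
    -- zero; only lower elements remain.
    · refine (UT.sum (S.low b) fun σ hσ => (hup σ).mul (ut_F_end (b := σ)
        (ih σ (S.mem_low.1 hσ)).1
        (fun ρ hρ => (ih ρ ((S.mem_low.1 hρ).trans (S.mem_low.1 hσ))).1)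
        (hdn σ (S.mem_low.1 hσ).le))).congr fun x z => ?_
      rw [phi_eq_eps, D.eps_pos hb, zero_add]
  have hlow : ∀ σ ∈ S.low b, UT fun (x : Q) => D.phi σ x :=
    fun σ hσ => (ih σ (S.mem_low.1 hσ)).1
  have hend : ∀ n, UT fun (x : Q) (z : Space d) =>
      (D.a (x + z)).ofConv (J.Ip n (S.basis b)) :=
    ut_a_end ht hphi hlow (hdn b le_rfl)
  refine ⟨hphi, fun n => ?_, fun n => ?_⟩
  · refine ((UT.sum (lowDeg d (S.deg b + 2 - sdeg n)) fun l _ => (UT.nmon l).mul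
      (ut_a ht hphi (n + l))).sub ((hend n).add (UT.sum (S.low b) fun σ hσ =>
        (hup σ).mul (ut_a_end (b := σ) ht (hlow σ hσ)
          (fun ρ hρ => (ih ρ ((S.mem_low.1 hρ).trans (S.mem_low.1 hσ))).1)
          (hdn σ (S.mem_low.1 hσ).le) n)))).congr fun x z => D.up_Ip x z n b
  · exact ((UT.sum (lowDeg d (S.deg b + 2 - sdeg n)) fun l _ => (UT.nmon_neg l).mul
      (hend (n + l))).sub ((ut_a ht hphi n).add (UT.sum (S.low b) fun σ hσ =>
        (hdn b le_rfl σ).mul (ut_a ht (hlow σ hσ) n)))).congr fun x z => D.dn_Ip x z n b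

end

end Solution

end IntSector

/-! ## The bounds of the model -/

namespace IntSector

open RegStructure Temperate

variable {d : ℕ} {B T Tp : Type*} [AddCommGroup T] [Module ℝ T] [CommRing Tp]
  [Bialgebra ℝ Tp] {S : RegStructure B T Tp} {P : PolySector d S}

lemma ut_tc (J : IntSector S P) (u : Tp) :
    UT fun (_ : Unit) (z : Space d) => (J.tc z).ofConv u := by
  refine ut_adjoin (χ := fun (_ : Unit) z => J.tc z) (s := _) ?_
    (show u ∈ Algebra.adjoin ℝ _ by rw [J.adjoin_gen]; trivial)
  rintro _ (⟨i, rfl⟩ | ⟨n, b, rfl⟩)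
  · exact (UT.coord i).congr fun _ z => J.tc_Xp z i
  · exact UT.zero.congr fun _ z => J.tc_Ip z n b

namespace Solution

variable {J : IntSector S P} {fam : {b : B // S.deg b < 0} → Space d → ℝ} {D : Solution J fam}

lemma regularOn_of_isCompact (ht : ∀ b, TG (D.f b)) {Q : Set (Space d)} (hQ : IsCompact Q) :
    D.RegularOn Q := by
  intro b _
  obtain ⟨R, hR⟩ := hQ.isBounded.exists_norm_le
  have hf : ∀ σ, UT fun (x : Q) z => D.f σ ((x : Space d) + z) := fun σ =>
    UT.recentre (ht σ) (fun x : Q => (x : Space d)) fun x => hR x x.2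
  have hc : ∀ u, UT fun (x : Q) (_ : Space d) => (J.tc (-(x : Space d))).ofConv u := fun u =>
    (UT.recentre (J.ut_tc u) (fun x : Q => -(x : Space d)) (R := R) fun x => by
      rw [norm_neg]; exact hR x x.2).eval_zero.congr fun x z => by rw [add_zero]
  exact ((hf b).add (UT.sum (S.low b) fun σ _ => (hc (S.quot b σ)).mul (hf σ))).congr
    fun x z => D.F_act _ b _

/-- The assumption bounds derivatives only at the centre of recentring. For a derivative at `y = x +
z` of the function recentred at `x`, the centre is moved by `t_{-x} = t_{-y} * t_z`; the
coefficients `t_z(b/σ)` grow polynomially in `z`, uniformly in `x`. -/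
lemma regularOn_univ (ht : ∀ b, TG (D.f b)) (hu : IsUniform J fam) : D.RegularOn Set.univ := by
  have hF : ∀ b, S.deg b < 0 → ∀ x : Space d,
      pairRight (famLin S fam) (J.transChar (-x)).toLinearMap (S.Δ (S.basis b)) =
        D.F (S.act (lin (J.tc (-x))) (S.basis b)) := by
    intro b hb x
    rw [pairRight_Δ, ← tc_ofConv, map_act, map_act, D.F_eq_famLin_basis hb]
    congr 1
    exact Finset.sum_congr rfl fun σ hσ => by
      rw [D.F_eq_famLin_basis ((S.mem_low.1 hσ).trans hb)]
  have hbd : ∀ b, S.deg b < 0 → ∀ k, ∃ C, 0 ≤ C ∧ ∀ y : Space d,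
      |mpd k (D.F (S.act (lin (J.tc (-y))) (S.basis b))) y| ≤ C := by
    intro b hb k
    obtain ⟨C, hC⟩ := hu b hb (∑ i, k i)
    refine ⟨C, (norm_nonneg _).trans (hC 0), fun y => ?_⟩
    rw [← hF b hb]
    exact (abs_mpd_le (by rw [hF b hb]; exact (tg_F ht _).smooth) k y).trans (hC y)
  intro b hb
  refine ⟨fun x => ((tg_F ht _).translate _).smooth, fun k => ?_⟩
  choose C hC0 hC using hbd
  choose E N hE0 hE using fun σ => (J.ut_tc (S.quot b σ)).bound_zero
  refine ⟨C b hb k + ∑ σ ∈ (S.low b).attach,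
    E σ * C σ.1 ((S.mem_low.1 σ.2).trans hb) k, ∑ σ ∈ S.low b, N σ, fun x z => ?_⟩
  rw [mpd_translate (tg_F ht _).smooth]
  set y : Space d := (x : Space d) + z
  have h1 : S.act (lin (J.tc (-(x : Space d)))) (S.basis b) =
      S.act (lin (J.tc (-y))) (S.act (lin (J.tc z)) (S.basis b)) := by
    rw [← act_mul, ← tc_add, show -y + z = -(x : Space d) by simp [y]]
  have h2 : D.F (S.act (lin (J.tc (-(x : Space d)))) (S.basis b)) =
      D.F (S.act (lin (J.tc (-y))) (S.basis b)) + ∑ σ ∈ S.low b,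
        (J.tc z).ofConv (S.quot b σ) • D.F (S.act (lin (J.tc (-y))) (S.basis σ)) := by
    rw [h1]
    exact map_act (S := S) (D.F ∘ₗ S.act (lin (J.tc (-y)))) (J.tc z) b
  have hs : ∀ v, ContDiff ℝ ∞ (D.F v) := fun v => (tg_F ht v).smooth
  have hsum : ContDiff ℝ ∞ (∑ σ ∈ S.low b,
      (J.tc z).ofConv (S.quot b σ) • D.F (S.act (lin (J.tc (-y))) (S.basis σ))) := by
    rw [← add_sub_cancel_left (D.F (S.act (lin (J.tc (-y))) (S.basis b))) (∑ σ ∈ S.low b, _),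
      ← h2]
    exact (hs _).sub (hs _)
  simp only
  rw [h2, mpd_add (hs _) hsum,
    mpd_sum _ (f := fun σ => (J.tc z).ofConv (S.quot b σ) •
      D.F (S.act (lin (J.tc (-y))) (S.basis σ))) fun σ _ =>
        (hs (S.act (lin (J.tc (-y))) (S.basis σ))).const_smul ((J.tc z).ofConv (S.quot b σ)),
    Pi.add_apply, Finset.sum_apply, ← Finset.sum_attach, add_mul, Finset.sum_mul]
  refine (abs_add_le _ _).trans (add_le_add ?_ ((Finset.abs_sum_le_sum_abs _ _).trans
    (Finset.sum_le_sum fun σ _ => ?_)))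
  · exact (hC b hb k y).trans (le_mul_of_one_le_right (hC0 _ _ _) (UT.one_le_weight _ _))
  · have hσ := (S.mem_low.1 σ.2).trans hb
    rw [mpd_smul (hs _), Pi.smul_apply, smul_eq_mul, abs_mul]
    have hw := UT.weight_mono z (Finset.single_le_sum (f := N) (fun _ _ => Nat.zero_le _) σ.2)
    calc _ ≤ (E σ * (1 + ‖z‖) ^ N σ) * C σ.1 hσ k :=
          mul_le_mul (hE σ () z) (hC σ.1 hσ k y) (abs_nonneg _)
            (mul_nonneg (hE0 _) (by positivity))
      _ ≤ (E σ * (1 + ‖z‖) ^ (∑ σ ∈ S.low b, N σ)) * C σ.1 hσ k :=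
          mul_le_mul_of_nonneg_right (mul_le_mul_of_nonneg_left hw (hE0 _)) (hC0 _ _ _)
      _ = _ := by ring

section

variable {Q : Set (Space d)}

lemma ut_dn (hJ : J.IsInductive) (ht : ∀ b, TG (D.f b)) (hQ : D.RegularOn Q) (τ σ : B) :
    UT fun (x : Q) (z : Space d) => (D.dn x z).ofConv (S.quot τ σ) :=
  ut_quot (χ := fun (x : Q) z => D.dn x z) hJ
    (fun i => (UT.neg_coord i).congr fun x z => D.dn_Xp x z i)
    (fun η _ n => (regular hJ ht hQ η).2.2 n) σ

lemma GB.one {Θ : Type*} : GB 0 (fun (_ : Θ) (_ : Space d) => (1 : ℝ)) :=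
  GB.of_UT (UT.const (a := fun _ => (1 : ℝ)) (C := 1) (by simp))

/-- A weighted bound for the recentring characters on a subalgebra. -/
lemma gb_adjoin {s : Set Tp}
    (hs : ∀ u ∈ s, ∃ α, u ∈ S.gradeP α ∧ GB α fun (x : Q) (z : Space d) => (D.up x z).ofConv u)
    {u : Tp} (hu : u ∈ Algebra.adjoin ℝ s) {α : ℝ} (hα : u ∈ S.gradeP α) :
    GB α fun (x : Q) (z : Space d) => (D.up x z).ofConv u := by
  refine S.graded_adjoin (p := fun α u => GB α fun (x : Q) (z : Space d) => (D.up x z).ofConv u)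
    (fun α => GB.zero.congr fun x z => map_zero _)
    (fun α u v hu hv => (hu.add hv).congr fun x z => map_add _ _ _)
    (fun α c u hu => (hu.smul c).congr fun x z => by rw [map_smul, smul_eq_mul])
    (GB.one.congr fun x z => map_one _)
    (fun α β u v hα hβ hu hv => (hu.mul hv hα hβ).congr fun x z => map_mul _ _ _) hs hu hα

lemma gb_Xp (i : Fin (d + 1)) : ∃ α, P.Xp i ∈ S.gradeP α ∧
    GB α fun (x : Q) (z : Space d) => (D.up x z).ofConv (P.Xp i) :=
  ⟨_, P.Xp_mem i, (GB.coord i).congr fun x z => D.up_Xp x z i⟩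

/-- In `up_Ip` the values of `a_x` are minus the Taylor coefficients at `x` of `∂ⁿ K Π_x b`. The
values of `a_{x+z}` would reassemble this function at `x + z`, but the terms with `|σ| + 2 ≤ |n|`
are missing, as there `I⁺ₙ σ = 0`. Hence the character is a Taylor remainder of order `|b| + 2 -
|n|` minus those terms, which have the order `|b| - |σ|`, at least as high. -/
lemma gb_up_Ip (hJ : J.IsInductive) (ht : ∀ b, TG (D.f b)) (hQ : D.RegularOn Q) (b : B) :
    ∀ n, GB (S.deg b + 2 - sdeg n)
      fun (x : Q) (z : Space d) => (D.up x z).ofConv (J.Ip n (S.basis b)) := by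
  induction b using S.deg_induction with
  | h b ih =>
  intro n
  have hup : ∀ σ, GB (S.deg b - S.deg σ)
      fun (x : Q) (z : Space d) => (D.up x z).ofConv (S.quot b σ) := by
    intro σ
    refine gb_adjoin ?_ (hJ b σ) (S.quot_mem b σ)
    rintro _ (⟨i, rfl⟩ | ⟨m, η, hη, rfl⟩)
    · exact gb_Xp i
    · exact ⟨_, J.Ip_mem m η, ih η hη m⟩
  by_cases hn : (sdeg n : ℝ) < S.deg b + 2
  swap
  · exact GB.zero.congr fun x z => by rw [J.Ip_zero_of_le hn, map_zero]
  have hγ : 0 < S.deg b + 2 - sdeg n := by linarith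
  have hG : ∀ σ, UT fun (x : Q) (z : Space d) =>
      D.G n (S.act (lin (D.h x)) (S.basis σ)) (x + z) := fun σ =>
    ut_G ht (regular hJ ht hQ σ).1 n
  have hend : ∀ σ, UT fun (x : Q) (z : Space d) =>
      D.G n (S.act (lin (D.h (x + z))) (S.basis σ)) (x + z) := fun σ =>
    ut_G_end ht (regular hJ ht hQ σ).1 (fun ρ _ => (regular hJ ht hQ ρ).1) (ut_dn hJ ht hQ σ) n
  have h1 := GB_taylor (hG b) hγ
  have h2 : ∀ σ ∈ (S.low b).filter fun σ => ¬(sdeg n : ℝ) < S.deg σ + 2,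
      GB (S.deg b + 2 - sdeg n) fun (x : Q) (z : Space d) => (D.up x z).ofConv (S.quot b σ) *
        D.G n (S.act (lin (D.h (x + z))) (S.basis σ)) (x + z) := by
    intro σ hσ
    rw [Finset.mem_filter, mem_low, not_lt] at hσ
    have := (hup σ).mul (GB.of_UT (hend σ)) (by linarith [hσ.1]) le_rfl
    exact this.mono hγ.le (by linarith [hσ.2])
  refine (h1.sub (GB.sum _ h2)).congr fun x z => ?_
  rw [up_Ip, D.a_Ip _ hn]
  have h3 : D.G n (S.act (lin (D.h x)) (S.basis b)) (x + z) =
      D.G n (S.act (lin (D.h (x + z))) (S.basis b)) (x + z) + ∑ σ ∈ S.low b,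
        (D.up x z).ofConv (S.quot b σ) *
          D.G n (S.act (lin (D.h (x + z))) (S.basis σ)) (x + z) := by
    have := congrFun (map_act (S := S) (D.G n ∘ₗ S.act (lin (D.h (x + z)))) (D.up x z) b) (x + z)
    rw [LinearMap.comp_apply, act_up] at this
    rw [this]
    simp
  rw [h3, ← Finset.sum_filter_add_sum_filter_not (S.low b) (fun σ => (sdeg n : ℝ) < S.deg σ + 2),
    ← Finset.sum_filter_add_sum_filter_not (S.low b) (fun σ => (sdeg n : ℝ) < S.deg σ + 2)
      (fun σ => (D.up x z).ofConv (S.quot b σ) *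
        D.G n (S.act (lin (D.h (x + z))) (S.basis σ)) (x + z))]
  have h4 : ∑ σ ∈ (S.low b).filter fun σ => (sdeg n : ℝ) < S.deg σ + 2,
      (D.up x z).ofConv (S.quot b σ) * (D.a (x + z)).ofConv (J.Ip n (S.basis σ)) =
      -∑ σ ∈ (S.low b).filter fun σ => (sdeg n : ℝ) < S.deg σ + 2,
        (D.up x z).ofConv (S.quot b σ) *
          D.G n (S.act (lin (D.h (x + z))) (S.basis σ)) (x + z) := by
    rw [← Finset.sum_neg_distrib]
    refine Finset.sum_congr rfl fun σ hσ => ?_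
    rw [D.a_Ip _ (Finset.mem_filter.1 hσ).2, mul_neg]
  have h5 : ∑ σ ∈ (S.low b).filter fun σ => ¬(sdeg n : ℝ) < S.deg σ + 2,
      (D.up x z).ofConv (S.quot b σ) * (D.a (x + z)).ofConv (J.Ip n (S.basis σ)) = 0 :=
    Finset.sum_eq_zero fun σ hσ => by
      rw [J.Ip_zero_of_le (Finset.mem_filter.1 hσ).2, map_zero, mul_zero]
  have h6 : ∑ l ∈ lowDeg d (S.deg b + 2 - sdeg n),
      nmon l z * (D.a x).ofConv (J.Ip (n + l) (S.basis b)) =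
      -∑ l ∈ lowDeg d (S.deg b + 2 - sdeg n), nmon l z * mpd l
        (fun z => D.G n (S.act (lin (D.h x)) (S.basis b)) (x + z)) 0 := by
    rw [← Finset.sum_neg_distrib]
    refine Finset.sum_congr rfl fun l hl => ?_
    rw [mem_lowDeg] at hl
    rw [D.a_Ip _ (by rw [sdeg_add]; push_cast; linarith), mul_neg,
      mpd_translate (by rw [G_eq ht]; exact ((tg_F ht _).kOp.mpd n).smooth ()), G_eq ht, G_eq ht,
      add_comm n l, mpd_add_idx (tg_F ht _).kOp.smooth]
    simp only [add_zero]
  rw [h4, h5, h6]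
  ring

theorem gb_up (hJ : J.IsInductive) (ht : ∀ b, TG (D.f b)) (hQ : D.RegularOn Q) {u : Tp} {α : ℝ}
    (hu : u ∈ S.gradeP α) : GB α fun (x : Q) (z : Space d) => (D.up x z).ofConv u := by
  refine gb_adjoin ?_ (show u ∈ Algebra.adjoin ℝ _ by rw [J.adjoin_gen]; trivial) hu
  rintro _ (⟨i, rfl⟩ | ⟨m, η, rfl⟩)
  · exact gb_Xp i
  · exact ⟨_, J.Ip_mem m η, gb_up_Ip hJ ht hQ η m⟩

end

end Solution

end IntSector

/-! ### Heat averages of functions that vanish to a given order -/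

namespace Temperate

variable {d : ℕ}

lemma rpow_pn_le (z : Space d) {α : ℝ} (hα : 0 ≤ α) :
    pn z ^ α ≤ 2 ^ ⌈α⌉₊ * (1 + ‖z‖) ^ ⌈α⌉₊ := by
  have h2 : 1 ≤ 2 * (1 + ‖z‖) := by linarith [norm_nonneg z]
  calc pn z ^ α ≤ (2 * (1 + ‖z‖)) ^ α := Real.rpow_le_rpow (pn_nonneg z) (pn_le z) hα
    _ ≤ (2 * (1 + ‖z‖)) ^ (⌈α⌉₊ : ℝ) := Real.rpow_le_rpow_of_exponent_le h2 (Nat.le_ceil α)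
    _ = _ := by rw [Real.rpow_natCast, mul_pow]

/-- Averages of functions vanishing to a given order against the rescaled heat kernel. -/
lemma GB.exists_avg_le {Θ : Type*} {F : Θ → Space d → ℝ} {α : ℝ} (hα : 0 ≤ α) (hF : GB α F) :
    ∃ C, 0 ≤ C ∧ ∀ θ c, 0 ≤ c → c ≤ 1 →
      |avg volume (pker d) (dil c) (F θ) 0| ≤ C * c ^ α := by
  obtain ⟨K, N, hK, h⟩ := hF
  have hint : Integrable fun v : Space d =>
      ‖pker d v‖ * (K * (2 ^ ⌈α⌉₊ * (1 + ‖v‖) ^ ⌈α⌉₊) * (1 + ‖v‖) ^ N) := by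
    refine ((integrable_weight_schwartz (pker d) (⌈α⌉₊ + N)).const_mul (K * 2 ^ ⌈α⌉₊)).congr
      (Filter.Eventually.of_forall fun v => ?_)
    simp only [pow_add]
    ring
  refine ⟨_, integral_nonneg (μ := volume) fun v => (by positivity :
    0 ≤ ‖pker d v‖ * (K * (2 ^ ⌈α⌉₊ * (1 + ‖v‖) ^ ⌈α⌉₊) * (1 + ‖v‖) ^ N)),
    fun θ c hc h1 => ?_⟩
  rw [← integral_mul_const]
  change ‖∫ v, pker d v * F θ (0 + dil c v)‖ ≤ _
  refine norm_integral_le_of_norm_le (hint.mul_const _) (Filter.Eventually.of_forall fun v => ?_)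
  rw [norm_mul, zero_add, mul_assoc]
  refine mul_le_mul_of_nonneg_left ?_ (norm_nonneg _)
  have hn := norm_dil_le hc h1 v
  calc ‖F θ (dil c v)‖ ≤ K * pn (dil c v) ^ α * (1 + ‖dil c v‖) ^ N := h θ _
    _ = K * (c ^ α * pn v ^ α) * (1 + ‖dil c v‖) ^ N := by
      rw [pn_dil hc, Real.mul_rpow hc (pn_nonneg v)]
    _ ≤ K * (c ^ α * (2 ^ ⌈α⌉₊ * (1 + ‖v‖) ^ ⌈α⌉₊)) * (1 + ‖v‖) ^ N := by
      have := rpow_pn_le v hα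
      have := Real.rpow_nonneg hc α
      gcongr
    _ = _ := by ring

end Temperate

/-! ### Recentring bounds at all distances, and the bounds of the model -/

namespace IntSector

open RegStructure Temperate

variable {d : ℕ} {B T Tp : Type*} [AddCommGroup T] [Module ℝ T] [CommRing Tp]
  [Bialgebra ℝ Tp] {S : RegStructure B T Tp} {P : PolySector d S}

namespace Solution

variable {J : IntSector S P} {fam : {b : B // S.deg b < 0} → Space d → ℝ} {D : Solution J fam}
  {Q : Set (Space d)}

/-- The bound of homogeneity `α` for the recentring characters on `Q`. -/
def UpBound (D : Solution J fam) (Q : Set (Space d)) (α : ℝ) (u : Tp) : Prop :=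
  ∃ C, 0 ≤ C ∧ ∀ x ∈ Q, ∀ z, x + z ∈ Q → |(D.up x z).ofConv u| ≤ C * pn z ^ α

lemma upBound_adjoin {s : Set Tp} (hs : ∀ u ∈ s, ∃ α, u ∈ S.gradeP α ∧ D.UpBound Q α u)
    {u : Tp} (hu : u ∈ Algebra.adjoin ℝ s) {α : ℝ} (hα : u ∈ S.gradeP α) : D.UpBound Q α u := by
  refine S.graded_adjoin (p := D.UpBound Q) (fun α => ⟨0, le_rfl, fun x _ z _ => by simp⟩)
    ?_ ?_ ⟨1, zero_le_one, fun x _ z _ => by simp⟩ ?_ hs hu hα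
  · rintro α u v ⟨C, hC, h⟩ ⟨C', hC', h'⟩
    refine ⟨C + C', by positivity, fun x hx z hz => ?_⟩
    rw [map_add, add_mul]
    exact (abs_add_le _ _).trans (add_le_add (h x hx z hz) (h' x hx z hz))
  · rintro α c u ⟨C, hC, h⟩
    refine ⟨|c| * C, by positivity, fun x hx z hz => ?_⟩
    rw [map_smul, smul_eq_mul, abs_mul, mul_assoc]
    exact mul_le_mul_of_nonneg_left (h x hx z hz) (abs_nonneg _)
  · rintro α β u v hα hβ ⟨C, hC, h⟩ ⟨C', hC', h'⟩
    refine ⟨C * C', by positivity, fun x hx z hz => ?_⟩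
    rw [map_mul, abs_mul, Real.rpow_add_of_nonneg (pn_nonneg z) hα hβ]
    have := Real.rpow_nonneg (pn_nonneg z) α
    calc _ ≤ (C * pn z ^ α) * (C' * pn z ^ β) :=
          mul_le_mul (h x hx z hz) (h' x hx z hz) (abs_nonneg _) (by positivity)
      _ = _ := by ring

lemma upBound_Xp (i : Fin (d + 1)) : ∃ α, P.Xp i ∈ S.gradeP α ∧ D.UpBound Q α (P.Xp i) := by
  refine ⟨_, P.Xp_mem i, 1, zero_le_one, fun x _ z _ => ?_⟩
  rw [up_Xp, one_mul, Real.rpow_natCast]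
  exact abs_coord_le_pn z i

lemma exists_a_bound (hJ : J.IsInductive) (ht : ∀ b, TG (D.f b)) (hQ : D.RegularOn Q) (n : MIdx d)
    (b : B) : ∃ C, 0 ≤ C ∧ ∀ x ∈ Q, |(D.a x).ofConv (J.Ip n (S.basis b))| ≤ C := by
  obtain ⟨C, N, hC, h⟩ := (ut_a ht (regular hJ ht hQ b).1 n).bound_zero
  exact ⟨C, hC, fun x hx => by simpa using h ⟨x, hx⟩ 0⟩

/-- Near the base point, `pn z ≤ 1` forces `‖z‖ ≤ 2`, so the polynomial weight in `gb_up_Ip` costs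
at most `3 ^ N`. Far away the weight is useless, but every term of `up_Ip` is a bounded value of `a`
times a quantity of order at most `γ`, and powers of `pn z ≥ 1` increase with the exponent. -/
lemma upBound_Ip (hJ : J.IsInductive) (ht : ∀ b, TG (D.f b)) (hQ : D.RegularOn Q) (b : B) :
    ∀ n, D.UpBound Q (S.deg b + 2 - sdeg n) (J.Ip n (S.basis b)) := by
  induction b using S.deg_induction with
  | h b ih =>
  intro n
  have hup : ∀ σ, D.UpBound Q (S.deg b - S.deg σ) (S.quot b σ) := by
    intro σ
    refine upBound_adjoin ?_ (hJ b σ) (S.quot_mem b σ)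
    rintro _ (⟨i, rfl⟩ | ⟨m, η, hη, rfl⟩)
    · exact upBound_Xp i
    · exact ⟨_, J.Ip_mem m η, ih η hη m⟩
  by_cases hn : (sdeg n : ℝ) < S.deg b + 2
  swap
  · exact ⟨0, le_rfl, fun x _ z _ => by rw [J.Ip_zero_of_le hn]; simp⟩
  set γ := S.deg b + 2 - sdeg n
  have hγ : 0 < γ := by simp only [γ]; linarith
  obtain ⟨C₁, N, hC₁, h₁⟩ := gb_up_Ip hJ ht hQ b n
  choose A hA0 hA using fun m σ => exists_a_bound hJ ht hQ m σ
  choose E hE0 hE using hup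
  refine ⟨C₁ * 3 ^ N + (∑ l ∈ lowDeg d γ, (midxFactorial l : ℝ)⁻¹ * A (n + l) b +
    (A n b + ∑ σ ∈ S.low b, E σ * A n σ)), ?_, fun x hx z hz => ?_⟩
  · have h1 : 0 ≤ ∑ l ∈ lowDeg d γ, (midxFactorial l : ℝ)⁻¹ * A (n + l) b :=
      Finset.sum_nonneg fun l _ => mul_nonneg (by positivity) (hA0 _ _)
    have h2 : 0 ≤ ∑ σ ∈ S.low b, E σ * A n σ :=
      Finset.sum_nonneg fun σ _ => mul_nonneg (hE0 _) (hA0 _ _)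
    have := hA0 n b
    positivity
  have hp : 0 ≤ pn z ^ γ := Real.rpow_nonneg (pn_nonneg z) _
  rw [add_mul]
  rcases le_total (pn z) 1 with h | h
  · refine (h₁ ⟨x, hx⟩ z).trans (le_add_of_le_of_nonneg ?_ (mul_nonneg ?_ hp))
    · have := norm_le_of_pn_le_one h
      rw [mul_right_comm]
      gcongr
      linarith
    · have h1 : 0 ≤ ∑ l ∈ lowDeg d γ, (midxFactorial l : ℝ)⁻¹ * A (n + l) b :=
        Finset.sum_nonneg fun l _ => mul_nonneg (by positivity) (hA0 _ _)
      have h2 : 0 ≤ ∑ σ ∈ S.low b, E σ * A n σ :=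
        Finset.sum_nonneg fun σ _ => mul_nonneg (hE0 _) (hA0 _ _)
      have := hA0 n b
      positivity
  · refine le_add_of_nonneg_of_le (by positivity) ?_
    rw [up_Ip, add_mul, add_mul, Finset.sum_mul, Finset.sum_mul]
    refine (abs_sub _ _).trans (add_le_add ((Finset.abs_sum_le_sum_abs _ _).trans
      (Finset.sum_le_sum fun l hl => ?_)) ((abs_add_le _ _).trans (add_le_add ?_
        ((Finset.abs_sum_le_sum_abs _ _).trans (Finset.sum_le_sum fun σ hσ => ?_)))))
    · rw [mem_lowDeg] at hl
      rw [abs_mul, nmon, abs_mul, abs_of_nonneg (by positivity : (0 : ℝ) ≤ (midxFactorial l : ℝ)⁻¹)]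
      have h3 : |monomialFun l z| ≤ pn z ^ γ := by
        refine (abs_monomialFun_le l z).trans ?_
        rw [← Real.rpow_natCast]
        exact Real.rpow_le_rpow_of_exponent_le h hl.le
      calc _ ≤ ((midxFactorial l : ℝ)⁻¹ * pn z ^ γ) * A (n + l) b :=
            mul_le_mul (mul_le_mul_of_nonneg_left h3 (by positivity)) (hA _ _ x hx)
              (abs_nonneg _) (by positivity)
        _ = _ := by ring
    · exact (hA _ _ _ hz).trans (le_mul_of_one_le_right (hA0 _ _) (Real.one_le_rpow h hγ.le))
    · by_cases hn' : (sdeg n : ℝ) < S.deg σ + 2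
      · rw [abs_mul]
        have h3 : pn z ^ (S.deg b - S.deg σ) ≤ pn z ^ γ :=
          Real.rpow_le_rpow_of_exponent_le h (by simp only [γ]; linarith)
        calc _ ≤ (E σ * pn z ^ (S.deg b - S.deg σ)) * A n σ :=
              mul_le_mul (hE σ x hx z hz) (hA _ _ _ hz) (abs_nonneg _)
                (mul_nonneg (hE0 _) (Real.rpow_nonneg (pn_nonneg z) _))
          _ ≤ (E σ * pn z ^ γ) * A n σ :=
              mul_le_mul_of_nonneg_right (mul_le_mul_of_nonneg_left h3 (hE0 _)) (hA0 _ _)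
          _ = _ := by ring
      · rw [J.Ip_zero_of_le hn', map_zero, mul_zero, abs_zero]
        exact mul_nonneg (mul_nonneg (hE0 _) (hA0 _ _)) hp

/-- For `|b| > 0`, the expansion at the second point retains only `σ` with `|σ| ≤ 0`, whose
coefficients vanish to order `|b| - |σ| ≥ |b|`. For `|b| ≤ 0`, smoothness gives order zero, which
suffices. -/
lemma gb_phi (hJ : J.IsInductive) (ht : ∀ b, TG (D.f b)) (hQ : D.RegularOn Q) (b : B) :
    GB (max (S.deg b) 0) fun (x : Q) => D.phi b x := by
  rcases le_or_gt (S.deg b) 0 with hb | hb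
  · rw [max_eq_right hb]
    exact GB.of_UT (regular hJ ht hQ b).1
  · rw [max_eq_left hb.le]
    refine (GB.sum (S.low b) (F := fun σ (x : Q) (z : Space d) =>
      (D.up x z).ofConv (S.quot b σ) * D.eps (x + z) (S.basis σ)) fun σ hσ => ?_).congr
      fun x z => by rw [phi_eq_eps, D.eps_pos hb, zero_add]
    rcases le_or_gt (S.deg σ) 0 with h | h
    · have := (gb_up hJ ht hQ (S.quot_mem b σ)).mul (GB.of_UT (ut_F_end (regular hJ ht hQ σ).1
        (fun ρ _ => (regular hJ ht hQ ρ).1) (ut_dn hJ ht hQ σ))) (by linarith) le_rfl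
      exact this.mono hb.le (by linarith)
    · exact GB.zero.congr fun x z => by rw [D.eps_pos h, mul_zero]

theorem boundsOn (hJ : J.IsInductive) (ht : ∀ b, TG (D.f b)) (hQ : D.RegularOn Q) :
    D.model.BoundsOn S Q := by
  refine ⟨fun α u hu => ?_, fun b => ?_⟩
  · have hb : D.UpBound Q α u := by
      refine upBound_adjoin ?_ (show u ∈ Algebra.adjoin ℝ _ by rw [J.adjoin_gen]; trivial) hu
      rintro _ (⟨i, rfl⟩ | ⟨m, η, rfl⟩)
      · exact upBound_Xp i
      · exact ⟨_, J.Ip_mem m η, upBound_Ip hJ ht hQ η m⟩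
    obtain ⟨C, hC, h⟩ := hb
    refine ⟨C, fun x hx y hy => ?_⟩
    have := h x hx (y - x) (by rwa [add_sub_cancel])
    rw [up, add_sub_cancel] at this
    rw [model_gyx, pdist_eq]
    exact this
  · obtain ⟨C, hC, h⟩ := (gb_phi hJ ht hQ b).exists_avg_le (le_max_right _ _)
    refine ⟨C, fun x hx t ht0 ht1 => ?_⟩
    have hc : 0 < root4 t := root4_pos ht0
    have hc1 : root4 t ≤ 1 := root4_le_one ht0.le ht1
    rw [model_Pix ht, tdist_apply (tg_F ht _), integral_heatKernel hc (root4_pow ht0.le) ht0]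
    have h1 := h ⟨x, hx⟩ (root4 t) hc.le hc1
    have h2 : avg volume (pker d) (dil (root4 t)) (D.phi b x) 0 =
        avg volume (pker d) (dil (root4 t)) (D.F (S.act (lin (D.h x)) (S.basis b))) x := by
      simp only [avg, phi, zero_add]
    rw [h2] at h1
    -- For negative homogeneity only boundedness is known, and it is enough because `root4 t ≤ 1`.
    refine h1.trans (mul_le_mul_of_nonneg_left ?_ hC)
    calc root4 t ^ max (S.deg b) 0 ≤ root4 t ^ S.deg b :=
          Real.rpow_le_rpow_of_exponent_ge hc hc1 (le_max_left _ _)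
      _ = t ^ (S.deg b / 4) := by
          rw [root4, ← Real.rpow_mul ht0.le]
          congr 1
          ring

end Solution

end IntSector

/-! ## Uniqueness -/

namespace Temperate

variable {d : ℕ}

/-- A nonzero `q` is `cᵐ r(c)` with `r(0) ≠ 0` and `m < γ`; dividing the bound by `cᵐ` would force
`r(0) = 0`. -/
lemma polynomial_eq_zero {q : Polynomial ℝ} {γ C ε : ℝ} (hd : (q.natDegree : ℝ) < γ)
    (hε : 0 < ε) (h : ∀ c, 0 < c → c < ε → |q.eval c| ≤ C * c ^ γ) : q = 0 := by
  by_contra hq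
  obtain ⟨r, hr, hnd⟩ := Polynomial.exists_eq_pow_rootMultiplicity_mul_and_not_dvd q hq 0
  rw [Polynomial.dvd_iff_isRoot, Polynomial.IsRoot.def] at hnd
  set m := Polynomial.rootMultiplicity 0 q
  have hm : (m : ℝ) < γ := by
    refine lt_of_le_of_lt ?_ hd
    have h1 : (Polynomial.X - Polynomial.C (0 : ℝ)) ^ m ∣ q := ⟨r, hr⟩
    have h2 := Polynomial.natDegree_le_of_dvd h1 hq
    rw [Polynomial.natDegree_pow, Polynomial.natDegree_X_sub_C, mul_one] at h2
    exact_mod_cast h2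
  have hlim : Filter.Tendsto (fun c : ℝ => C * c ^ (γ - m)) (nhdsWithin 0 (Set.Ioi 0))
      (nhds 0) := by
    have h1 := (Real.continuousAt_rpow_const 0 (γ - m) (Or.inr (by linarith))).tendsto
    rw [Real.zero_rpow (by linarith)] at h1
    have h2 := (h1.const_mul C).mono_left (nhdsWithin_le_nhds (s := Set.Ioi 0))
    rwa [mul_zero] at h2
  have hr0 : Filter.Tendsto (fun c : ℝ => r.eval c) (nhdsWithin 0 (Set.Ioi 0)) (nhds 0) := by
    refine squeeze_zero_norm' ?_ hlim
    filter_upwards [Ioo_mem_nhdsGT hε] with c hc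
    have hcm : 0 < c ^ m := pow_pos hc.1 m
    have h1 := h c hc.1 hc.2
    rw [hr, Polynomial.eval_mul, Polynomial.eval_pow, Polynomial.eval_sub, Polynomial.eval_X,
      Polynomial.eval_C, sub_zero, abs_mul, abs_of_pos hcm] at h1
    have h2 : c ^ γ = c ^ m * c ^ (γ - m) := by
      rw [← Real.rpow_natCast, ← Real.rpow_add hc.1, add_sub_cancel]
    rw [h2, mul_left_comm] at h1
    exact le_of_mul_le_mul_left h1 hcm
  have hr1 : Filter.Tendsto (fun c : ℝ => r.eval c) (nhdsWithin 0 (Set.Ioi 0))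
      (nhds (r.eval 0)) :=
    (r.continuous.tendsto 0).mono_left nhdsWithin_le_nhds
  exact hnd (tendsto_nhds_unique hr1 hr0)

lemma nmon_dil (c : ℝ) (k : MIdx d) (w : Space d) : nmon k (dil c w) = c ^ sdeg k * nmon k w := by
  have h1 : monomialFun k (dil c w) = c ^ sdeg k * monomialFun k w := by
    have h2 : ∏ i, (c ^ sdeg (Pi.single i 1 : MIdx d)) ^ k i = c ^ sdeg k := by
      simp_rw [← pow_mul]
      rw [Finset.prod_pow_eq_pow_sum, Fin.sum_univ_succ, sdeg_single_zero]
      simp_rw [sdeg_single_succ, one_mul]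
      rfl
    simp only [monomialFun, dil_apply, mul_pow]
    rw [Finset.prod_mul_distrib, h2]
  rw [nmon, h1, nmon]
  ring

/-- A polynomial of scaled degree less than `γ` that vanishes to order `γ` is zero. -/
lemma coeff_eq_zero {γ C : ℝ} (hγ : 0 < γ) (e : MIdx d → ℝ)
    (h : ∀ z : Space d, ‖z‖ ≤ 1 → |∑ k ∈ lowDeg d γ, nmon k z * e k| ≤ C * pn z ^ γ)
    {k : MIdx d} (hk : (sdeg k : ℝ) < γ) : e k = 0 := by
  have hzero : ∀ w : Space d, ∑ k ∈ lowDeg d γ, nmon k w * e k = 0 := by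
    intro w
    -- Along the parabolic curve `c ↦ dil c w` the scaled degree becomes the ordinary degree in `c`.
    let q : Polynomial ℝ := ∑ k ∈ lowDeg d γ, Polynomial.monomial (sdeg k) (nmon k w * e k)
    have heval : ∀ c, q.eval c = ∑ k ∈ lowDeg d γ, nmon k (dil c w) * e k := by
      intro c
      rw [Polynomial.eval_finsetSum]
      refine Finset.sum_congr rfl fun k _ => ?_
      rw [Polynomial.eval_monomial, nmon_dil]
      ring
    have hdeg : (q.natDegree : ℝ) < γ := by
      have h1 : q.natDegree ≤ ⌈γ⌉₊ - 1 := by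
        refine Polynomial.natDegree_sum_le_of_forall_le _ _ fun k hk => ?_
        rw [mem_lowDeg] at hk
        have := Nat.lt_ceil.2 hk
        exact (Polynomial.natDegree_monomial_le _).trans (by omega)
      have h2 : 0 < ⌈γ⌉₊ := Nat.ceil_pos.2 hγ
      have h3 := Nat.ceil_lt_add_one hγ.le
      have h4 : (q.natDegree : ℝ) + 1 ≤ ⌈γ⌉₊ := by exact_mod_cast (by omega)
      linarith
    have hq : q = 0 := by
      refine polynomial_eq_zero (C := C * pn w ^ γ) (ε := 1 / (1 + ‖w‖)) hdeg (by positivity)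
        fun c hc0 hc1 => ?_
      have hw : 0 ≤ ‖w‖ := norm_nonneg w
      rw [lt_div_iff₀ (by positivity)] at hc1
      have hc : c ≤ 1 := by nlinarith
      rw [heval]
      refine (h _ ((norm_dil_le_mul hc0.le hc w).trans (by nlinarith))).trans (le_of_eq ?_)
      rw [pn_dil hc0.le, Real.mul_rpow hc0.le (pn_nonneg w)]
      ring
    have h1 := heval 1
    rw [hq, Polynomial.eval_zero] at h1
    simp_rw [nmon_dil, one_pow, one_mul] at h1
    exact h1.symm
  have hfun : ∑ j ∈ lowDeg d γ, e j • (nmon j : Space d → ℝ) = 0 := by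
    funext w
    rw [Finset.sum_apply, Pi.zero_apply, ← hzero w]
    exact Finset.sum_congr rfl fun j _ => mul_comm _ _
  have h1 := congrFun (congrArg (mpd k) hfun) 0
  rw [mpd_sum _ (f := fun j => e j • (nmon j : Space d → ℝ))
    (fun j _ => (nmon_smooth j).const_smul (e j)), mpd_zero_fun, Finset.sum_apply,
    Finset.sum_eq_single k] at h1
  · rw [mpd_smul (nmon_smooth k), Pi.smul_apply, mpd_nmon_zero, if_pos rfl] at h1
    simpa using h1
  · intro j _ hj
    rw [mpd_smul (nmon_smooth j), Pi.smul_apply, mpd_nmon_zero, if_neg hj, smul_zero]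
  · intro hk'
    exact absurd (mem_lowDeg.2 hk) hk'

/-- The heat kernel `p_t(y, ·)` at `t = (n + 1)⁻⁴`. -/
def hk (n : ℕ) (y : Space d) : 𝓢(Space d, ℝ) :=
  heatKernel ((1 / ((n : ℝ) + 1)) ^ 4) (pow_pos (scale_pos n) 4) y

lemma integral_hk (n : ℕ) (y : Space d) (u : Space d → ℝ) :
    ∫ z, u z * hk n y z = avg volume (pker d) (dil (1 / ((n : ℝ) + 1))) u y :=
  integral_heatKernel (scale_pos n) rfl _ y u

lemma tendsto_integral_hk {u : Space d → ℝ} (hu : TG u) (y : Space d) :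
    Filter.Tendsto (fun n => ∫ z, u z * hk n y z) Filter.atTop (nhds (u y)) := by
  obtain ⟨C, N, -, h⟩ := hu.bound_zero
  simp_rw [integral_hk]
  exact tendsto_avg_pker hu.continuous (h ()) y (fun n => (scale_pos n).le) scale_le_one
    tendsto_scale

lemma tendsto_scale_rpow {β : ℝ} (hβ : 0 < β) (C : ℝ) : Filter.Tendsto
    (fun n : ℕ => C * ((1 / ((n : ℝ) + 1)) ^ 4) ^ (β / 4)) Filter.atTop (nhds 0) := by
  have h1 := tendsto_scale.pow 4
  rw [zero_pow (by norm_num)] at h1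
  have h2 := ((Real.continuousAt_rpow_const 0 (β / 4) (Or.inr (by positivity))).tendsto.comp
    h1).const_mul C
  rw [Real.zero_rpow (by positivity), mul_zero] at h2
  exact h2

end Temperate

/-! ### Uniqueness by induction on homogeneity -/

namespace IntSector

open RegStructure Temperate

variable {d : ℕ} {B T Tp : Type*} [AddCommGroup T] [Module ℝ T] [CommRing Tp]
  [Bialgebra ℝ Tp] {S : RegStructure B T Tp} {P : PolySector d S}

lemma pix_tendsto_zero {M : PreModel d T Tp} {Q : Set (Space d)} (hM : M.BoundsOn S Q)
    {y : Space d} (hy : y ∈ Q) {β : ℝ} (hβ : 0 < β) {v : T} (hv : v ∈ S.gradeT β) :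
    Filter.Tendsto (fun n => M.Pix S y v (hk n y)) Filter.atTop (nhds 0) := by
  induction hv using Submodule.span_induction with
  | mem v hv =>
    obtain ⟨b, hb, rfl⟩ := hv
    obtain ⟨C, hC⟩ := hM.2 b
    have hb' : S.deg b = β := hb
    refine squeeze_zero_norm (fun n => ?_) (tendsto_scale_rpow hβ C)
    have := hC y hy _ (pow_pos (scale_pos n) 4) (pow_le_one₀ (scale_pos n).le (scale_le_one n))
    rw [hb'] at this
    exact this
  | zero => simp
  | add u v _ _ hu hv => simpa using hu.add hv
  | smul a v _ hv => simpa using hv.const_mul a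

variable (J : IntSector S P)

/-- The inverse of the character `g_x` of a model. -/
def hChr (M : PreModel d T Tp) (x : Space d) : Chr Tp := J.cinv (WithConv.toConv (M.g x))

/-- The recentring character `g_{yx}` of a model. -/
def gChr (M : PreModel d T Tp) (y x : Space d) : Chr Tp :=
  WithConv.toConv (M.g y) * J.hChr M x

lemma Pix_eq_hChr (M : PreModel d T Tp) (x : Space d) (v : T) :
    M.Pix S x v = M.Pi (S.act (lin (J.hChr M x)) v) := J.Pix_eq M x v

lemma gyx_eq_gChr (M : PreModel d T Tp) (y x : Space d) : M.gyx y x = lin (J.gChr M y x) :=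
  J.gyx_eq M y x

lemma Pix_recentre (M : PreModel d T Tp) (y x : Space d) (v : T) :
    M.Pix S x v = M.Pix S y (S.act (lin (J.gChr M y x)) v) := by
  rw [J.Pix_eq_hChr, J.Pix_eq_hChr, ← act_mul, gChr, ← mul_assoc, hChr, hChr, cinv_mul, one_mul]

lemma Pix_X_zero (J : IntSector S P) {M : PreModel d T Tp} (hc : M.IsCanonical P) (y : Space d) (n : ℕ) :
    M.Pix S y (S.basis (P.X 0)) (hk n y) = 1 := by
  rw [J.Pix_eq_hChr, Solution.act_X_zero, hc.1, integral_hk]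
  simp [avg, monomialFun_zero, integral_pker]

/-- The pointwise value of `Π_x I₀ b`. -/
lemma tendsto_Pix_I₀ {M : PreModel d T Tp} {Q : Set (Space d)} (hM : M.BoundsOn S Q)
    (hc : M.IsCanonical P) (hβ : ∀ b, -2 < S.deg b) (b : B) {y : Space d} (hy : y ∈ Q)
    (x : Space d) :
    Filter.Tendsto (fun n => M.Pix S x (J.I₀ (S.basis b)) (hk n y)) Filter.atTop
      (nhds (M.gyx y x (J.Ip 0 (S.basis b)))) := by
  have hI : ∀ v, Filter.Tendsto (fun n => M.Pix S y (J.I₀ v) (hk n y)) Filter.atTop (nhds 0) := by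
    intro v
    induction S.basis.mem_span v using Submodule.span_induction with
    | mem v hv =>
      obtain ⟨σ, rfl⟩ := hv
      exact pix_tendsto_zero hM hy (by linarith [hβ σ]) (J.I₀_mem σ)
    | zero => simp
    | add u v _ _ hu hv => simpa using hu.add hv
    | smul a v _ hv => simpa using hv.const_mul a
  have hX : ∀ l : MIdx d, Filter.Tendsto (fun n => M.Pix S y (S.basis (P.X l)) (hk n y))
      Filter.atTop (nhds (if l = 0 then 1 else 0)) := by
    intro l
    split_ifs with hl
    · subst hl
      simp_rw [J.Pix_X_zero hc]
      exact tendsto_const_nhds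
    · exact pix_tendsto_zero hM hy (β := sdeg l) (by exact_mod_cast sdeg_pos hl)
        (Submodule.subset_span ⟨_, P.deg_X l, rfl⟩)
  -- After recentring at `y`, everything of positive homogeneity vanishes in the limit. What
  -- survives is the coefficient of `X⁰`, which is `g_{yx}(I⁺₀ b)`.
  have h1 := (hI (S.act (lin (J.gChr M y x)) (S.basis b))).add
    (tendsto_finsetSum (lowDeg d (S.deg b + 2)) fun l _ => (hX l).const_mul
      ((midxFactorial l : ℝ)⁻¹ * (J.gChr M y x).ofConv (J.Ip l (S.basis b))))
  have h2 : ∀ n, M.Pix S x (J.I₀ (S.basis b)) (hk n y) =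
      M.Pix S y (J.I₀ (S.act (lin (J.gChr M y x)) (S.basis b))) (hk n y) +
      ∑ l ∈ lowDeg d (S.deg b + 2), ((midxFactorial l : ℝ)⁻¹ *
        (J.gChr M y x).ofConv (J.Ip l (S.basis b))) * M.Pix S y (S.basis (P.X l)) (hk n y) := by
    intro n
    rw [J.Pix_recentre M y x, act_I₀, map_add, map_sum]
    simp [sum_apply]
  simp_rw [h2]
  convert h1 using 2
  rw [zero_add, Finset.sum_eq_single 0, J.gyx_eq_gChr]
  · simp [midxFactorial]
  · intro l _ hl
    rw [if_neg hl, mul_zero]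
  · intro h
    rw [mem_lowDeg, sdeg_zero, Nat.cast_zero] at h
    linarith [hβ b]

lemma hChr_Xp {M : PreModel d T Tp} (hc : M.IsCanonical P) (x : Space d) (i : Fin (d + 1)) :
    (J.hChr M x).ofConv (P.Xp i) = (-x) i := by
  rw [hChr, cinv_Xp, PiLp.neg_apply]
  exact congrArg _ (hc.2 x i)

section

variable {J} {M M' : PreModel d T Tp} {b : B}

/-- The values of two models on `b` agree as soon as they agree in lower homogeneity. -/
lemma Pi_unique {fam : {b : B // S.deg b < 0} → Space d → ℝ} (hJ : J.IsInductive)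
    (hM : M.IsLocalModel S) (hM' : M'.IsLocalModel S) (hc : M.IsCanonical P)
    (hc' : M'.IsCanonical P) (he : M.Extends S fam) (he' : M'.Extends S fam)
    (ih : ∀ η, S.deg η < S.deg b → M'.Pi (S.basis η) = M.Pi (S.basis η) ∧
      ∀ x n, (J.hChr M' x).ofConv (J.Ip n (S.basis η)) = (J.hChr M x).ofConv (J.Ip n (S.basis η))) :
    M'.Pi (S.basis b) = M.Pi (S.basis b) := by
  rcases lt_trichotomy (S.deg b) 0 with hb | hb | hb
  · ext φ
    rw [he ⟨b, hb⟩, he' ⟨b, hb⟩]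
  · rw [P.eq_X_zero b hb]
    ext φ
    rw [hc.1, hc'.1]
  -- The lower-order terms of `Π_x b` coincide for the two models, so the difference of the `Π_x b`
  -- does not depend on `x`. The bounds of both models therefore apply to it at every base point.
  · have hdiff : ∀ x, M'.Pix S x (S.basis b) - M.Pix S x (S.basis b) =
        M'.Pi (S.basis b) - M.Pi (S.basis b) := by
      intro x
      rw [J.Pix_eq_hChr, J.Pix_eq_hChr, map_act, map_act]
      have : ∑ σ ∈ S.low b, (J.hChr M' x).ofConv (S.quot b σ) • M'.Pi (S.basis σ) =
          ∑ σ ∈ S.low b, (J.hChr M x).ofConv (S.quot b σ) • M.Pi (S.basis σ) := by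
        refine Finset.sum_congr rfl fun σ hσ => ?_
        rw [(ih σ (S.mem_low.1 hσ)).1, J.quot_congr hJ
          (fun i => (J.hChr_Xp hc' x i).trans (J.hChr_Xp hc x i).symm)
          (fun η hη n => (ih η hη).2 x n)]
      rw [this, add_sub_add_right_eq_sub]
    rw [← sub_eq_zero]
    refine tdist_eq_zero _ (β := S.deg b / 4) (by positivity) fun Q hQ => ?_
    obtain ⟨C, hC⟩ := (hM Q hQ).2 b
    obtain ⟨C', hC'⟩ := (hM' Q hQ).2 b
    refine ⟨C' + C, fun x hx t ht ht1 => ?_⟩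
    rw [← hdiff x, sub_apply, add_mul]
    exact (abs_sub _ _).trans (add_le_add (hC' x hx t ht ht1) (hC x hx t ht ht1))

/-- The characters of two models agree on `b` as soon as the models agree up to `b`. -/
lemma char_unique (hβ : ∀ b, -2 < S.deg b) (hM : M.IsLocalModel S) (hM' : M'.IsLocalModel S)
    (hc : M.IsCanonical P) (hc' : M'.IsCanonical P) (ha : M.IsAdmissible J)
    (ha' : M'.IsAdmissible J) (x : Space d)
    (hPi : ∀ σ, σ = b ∨ σ ∈ S.low b → M'.Pi (S.basis σ) = M.Pi (S.basis σ))
    (hq : ∀ σ, (J.hChr M' x).ofConv (S.quot b σ) = (J.hChr M x).ofConv (S.quot b σ))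
    (n : MIdx d) :
    (J.hChr M' x).ofConv (J.Ip n (S.basis b)) = (J.hChr M x).ofConv (J.Ip n (S.basis b)) := by
  set γ := S.deg b + 2
  have hγ : 0 < γ := by simp only [γ]; linarith [hβ b]
  -- The Taylor coefficients at `x` of the polynomial by which the two functions `y ↦ g_{yx}(I⁺₀ b)`
  -- differ; multiplication by `t_x` moves the centre of expansion from `0` to `x`.
  let e : MIdx d → ℝ := fun k => (J.tc x * J.hChr M' x).ofConv (J.Ip k (S.basis b)) -
    (J.tc x * J.hChr M x).ofConv (J.Ip k (S.basis b))
  have hI : ∀ σ, σ = b ∨ σ ∈ S.low b →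
      M'.Pi (J.I₀ (S.basis σ)) = M.Pi (J.I₀ (S.basis σ)) := by
    intro σ hσ
    ext φ
    rw [ha.1, ha'.1, hPi σ hσ]
  have hdiff : ∀ m y, M'.Pix S x (J.I₀ (S.basis b)) (hk m y) -
      M.Pix S x (J.I₀ (S.basis b)) (hk m y) = ∑ l ∈ lowDeg d γ, ((midxFactorial l : ℝ)⁻¹ *
        ((J.hChr M' x).ofConv (J.Ip l (S.basis b)) - (J.hChr M x).ofConv (J.Ip l (S.basis b)))) *
          ∫ z, monomialFun l z * hk m y z := by
    intro m y
    -- Admissibility determines `Π I₀` from data on which the models agree. The distributions `Π_x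
    -- I₀ b` can therefore differ only in their polynomial part.
    have h1 : M'.Pi (J.I₀ (S.act (lin (J.hChr M' x)) (S.basis b))) =
        M.Pi (J.I₀ (S.act (lin (J.hChr M x)) (S.basis b))) := by
      rw [← LinearMap.comp_apply M'.Pi, ← LinearMap.comp_apply M.Pi, map_act, map_act,
        LinearMap.comp_apply, LinearMap.comp_apply, hI b (Or.inl rfl)]
      congr 1
      refine Finset.sum_congr rfl fun σ hσ => ?_
      rw [LinearMap.comp_apply, LinearMap.comp_apply, hI σ (Or.inr hσ), hq]
    rw [J.Pix_eq_hChr, J.Pix_eq_hChr, act_I₀, act_I₀, map_add, map_add, add_apply, add_apply, h1,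
      add_sub_add_left_eq_sub]
    simp only [map_sum, map_smul, sum_apply, smul_apply, smul_eq_mul, hc.1, hc'.1]
    rw [← Finset.sum_sub_distrib]
    exact Finset.sum_congr rfl fun l _ => by ring
  have hval : ∀ y, M'.gyx y x (J.Ip 0 (S.basis b)) - M.gyx y x (J.Ip 0 (S.basis b)) =
      ∑ l ∈ lowDeg d γ, ((midxFactorial l : ℝ)⁻¹ * ((J.hChr M' x).ofConv (J.Ip l (S.basis b)) -
        (J.hChr M x).ofConv (J.Ip l (S.basis b)))) * monomialFun l y := by
    intro y
    have h1 := (J.tendsto_Pix_I₀ (hM' {y} isCompact_singleton) hc' hβ b (Set.mem_singleton y)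
      x).sub (J.tendsto_Pix_I₀ (hM {y} isCompact_singleton) hc hβ b (Set.mem_singleton y) x)
    simp_rw [hdiff] at h1
    exact tendsto_nhds_unique h1 (tendsto_finsetSum _ fun l _ =>
      (tendsto_integral_hk (UT.monomial l) y).const_mul _)
  have hrec : ∀ z, ∑ k ∈ lowDeg d γ, nmon k z * e k =
      M'.gyx (x + z) x (J.Ip 0 (S.basis b)) - M.gyx (x + z) x (J.Ip 0 (S.basis b)) := by
    intro z
    have h1 : ∀ k : Chr Tp, ∑ l ∈ lowDeg d γ,
        nmon l z * (J.tc x * k).ofConv (J.Ip l (S.basis b)) =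
        ∑ l ∈ lowDeg d γ, nmon l (x + z) * k.ofConv (J.Ip l (S.basis b)) := by
      intro k
      have h2 := J.tc_mul_Ip z (J.tc x * k) 0 b
      have h3 := J.tc_mul_Ip (x + z) k 0 b
      simp only [sdeg_zero, Nat.cast_zero, sub_zero, zero_add] at h2 h3
      rw [← h2, ← h3, ← mul_assoc, ← tc_add, add_comm]
    rw [hval]
    simp only [e, mul_sub, Finset.sum_sub_distrib, sub_mul]
    rw [h1, h1]
    congr 1 <;> exact Finset.sum_congr rfl fun l _ => by rw [nmon]; ring
  have he : ∀ k : MIdx d, (sdeg k : ℝ) < γ → e k = 0 := by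
    intro k hk
    have hmem : J.Ip 0 (S.basis b) ∈ S.gradeP γ := by
      have := J.Ip_mem 0 b
      rwa [sdeg_zero, Nat.cast_zero, sub_zero] at this
    obtain ⟨C, hC⟩ := (hM _ (isCompact_closedBall x 1)).1 γ _ hmem
    obtain ⟨C', hC'⟩ := (hM' _ (isCompact_closedBall x 1)).1 γ _ hmem
    refine coeff_eq_zero (C := C' + C) hγ e (fun z hz => ?_) hk
    have hx : x ∈ Metric.closedBall x 1 := Metric.mem_closedBall_self zero_le_one
    have hz' : x + z ∈ Metric.closedBall x 1 := by simpa using hz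
    rw [hrec, add_mul, ← pdist_add_left x z]
    exact (abs_sub _ _).trans (add_le_add (hC' x hx _ hz') (hC x hx _ hz'))
  -- Undoing `t_x` recovers the values on all `I⁺ₙ b` from the coefficients just shown to agree; the
  -- degrees `|n| + |l|` that occur are below `γ`.
  have hfin : ∀ k : Chr Tp, k.ofConv (J.Ip n (S.basis b)) =
      ∑ l ∈ lowDeg d (S.deg b + 2 - sdeg n), nmon l (-x) *
        (J.tc x * k).ofConv (J.Ip (n + l) (S.basis b)) := by
    intro k
    rw [← tc_mul_Ip, ← mul_assoc, tc_neg_mul, one_mul]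
  rw [hfin, hfin]
  refine Finset.sum_congr rfl fun l hl => ?_
  rw [mem_lowDeg] at hl
  rw [sub_eq_zero.1 (he (n + l) (by rw [sdeg_add]; push_cast; simp only [γ]; linarith))]

theorem model_unique {fam : {b : B // S.deg b < 0} → Space d → ℝ} (hJ : J.IsInductive)
    (hβ : ∀ b, -2 < S.deg b) (hM : M.IsLocalModel S) (hM' : M'.IsLocalModel S)
    (hc : M.IsCanonical P) (hc' : M'.IsCanonical P) (ha : M.IsAdmissible J)
    (ha' : M'.IsAdmissible J) (he : M.Extends S fam) (he' : M'.Extends S fam) : M' = M := by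
  have key : ∀ b, M'.Pi (S.basis b) = M.Pi (S.basis b) ∧ ∀ x n,
      (J.hChr M' x).ofConv (J.Ip n (S.basis b)) = (J.hChr M x).ofConv (J.Ip n (S.basis b)) := by
    intro b
    induction b using S.deg_induction with
    | h b ih =>
    have hPi := Pi_unique hJ hM hM' hc hc' he he' ih
    refine ⟨hPi, fun x n => char_unique hβ hM hM' hc hc' ha ha' x ?_ ?_ n⟩
    · rintro σ (rfl | hσ)
      exacts [hPi, (ih σ (S.mem_low.1 hσ)).1]
    · exact J.quot_congr hJ (fun i => (J.hChr_Xp hc' x i).trans (J.hChr_Xp hc x i).symm)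
        (fun η hη n => (ih η hη).2 x n)
  have hPi : M'.Pi = M.Pi := S.basis.ext fun b => (key b).1
  have hg : M'.g = M.g := by
    funext x
    have h1 : J.hChr M' x = J.hChr M x :=
      J.chr_ext (fun i => (J.hChr_Xp hc' x i).trans (J.hChr_Xp hc x i).symm)
        fun n b _ => (key b).2 x n
    have h2 : WithConv.toConv (M'.g x) = WithConv.toConv (M.g x) :=
      left_inv_eq_right_inv (a := J.hChr M x) (by rw [← h1]; exact J.mul_cinv _) (J.cinv_mul _)
    exact congrArg WithConv.ofConv h2
  cases M
  cases M'
  cases hPi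
  cases hg
  rfl

end

end IntSector

end

theorem mainTheorem5 {d : ℕ} {B T Tp : Type*} [AddCommGroup T] [Module ℝ T] [CommRing Tp]
    [Bialgebra ℝ Tp] (S : RegStructure B T Tp) (P : PolySector d S) (J : IntSector S P)
    (hJ : J.IsInductive) (hβ : ∀ b, -2 < S.deg b)
    (fam : {b : B // S.deg b < 0} → Space d → ℝ) (hfam : ∀ b, (fam b).HasTemperateGrowth)
    (hX : IsCompatible P fam) :
    (∃! M : PreModel d T Tp,
      M.IsLocalModel S ∧ M.IsCanonical P ∧ M.IsAdmissible J ∧ M.Extends S fam) ∧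
    (IsUniform J fam → ∃! M : PreModel d T Tp,
      M.IsModel S ∧ M.IsCanonical P ∧ M.IsAdmissible J ∧ M.Extends S fam) := by
  obtain ⟨D⟩ := IntSector.exists_solution hJ fam
  have ht : ∀ b, Temperate.TG (D.f b) := fun b => (D.tg_aux hJ hfam b).1
  have hc := IntSector.Solution.model_canonical ht
  have ha := IntSector.Solution.model_admissible ht hX hβ
  have he := IntSector.Solution.model_extends ht
  have hl : D.model.IsLocalModel S := fun Q hQ =>
    IntSector.Solution.boundsOn hJ ht (IntSector.Solution.regularOn_of_isCompact ht hQ)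
  refine ⟨⟨D.model, ⟨hl, hc, ha, he⟩, fun M h => ?_⟩,
    fun hu => ⟨D.model, ⟨?_, hc, ha, he⟩, fun M h => ?_⟩⟩
  · exact IntSector.model_unique hJ hβ hl h.1 hc h.2.1 ha h.2.2.1 he h.2.2.2
  · exact IntSector.Solution.boundsOn hJ ht (IntSector.Solution.regularOn_univ ht hu)
  -- A model is in particular a local model, so uniqueness among local models covers the second part
  -- as well.
  · have hloc : M.IsLocalModel S := fun Q _ =>
      ⟨fun α u hα => (h.1.1 α u hα).imp fun C hC x _ y _ => hC x trivial y trivial,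
        fun b => (h.1.2 b).imp fun C hC x _ => hC x trivial⟩
    exact IntSector.model_unique hJ hβ hl hloc hc h.2.1 ha h.2.2.1 he h.2.2.2
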